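/- Let $S$ be a locally compact Hausdorff topological $*$-semigroup with identity, i.e. a locally compact Hausdorff monoid with jointly continuous multiplication and a continuous involution $x\mapsto x^*$ satisfying $(xy)^*=y^*x^*$ and $x^{**}=x$. Notation. $M(S)$ is the Banach space of bounded regular complex Borel measures on $S$ with the total variation norm. $L(S)$ is the set of $\mu\in M(S)$ such that $x\mapsto|\mu|*\delta_x$ and $x\mapsto\delta_x*|\mu|$ are continuous from $S$ into $M(S)$ with its weak topology $\sigma(M(S),M(S)^*)$. The semigroup $S$ is called foundation if $\bigcup_{\mu\in L(S)}\operatorname{supp}\mu$ is dense in $S$. $\Sigma(S)$ is the family of weakly continuous $*$-representations $\pi:S\to B(H_\pi)$ on Hilbert spaces with $\sup_{x\in S}\|\pi(x)\|\le 1$; for $\pi\in\Sigma(S)$ and $\mu\in M(S)$ the operator $\tilde\pi(\mu)$ is given by $\langle\tilde\pi(\mu)\xi,\eta\rangle=\int_S\langle\pi(x)\xi,\eta\rangle\,d\mu(x)$, and $\|\mu\|_\Sigma=\sup_{\pi\in\Sigma(S)}\|\tilde\pi(\mu)\|$. The full semigroup $C^*$-algebra $C^*(S)$ is the completion of $L(S)/\{\mu\in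 L(S):\|\mu\|_\Sigma=0\}$ in the norm induced by $\|\cdot\|_\Sigma$. A function $u:S\to\mathbb C$ is positive definite if $\sum_{i,j=1}^n\lambda_i\overline{\lambda_j}\,u(x_ix_j^*)\ge 0$ for all $n\ge 1$, $\lambda_1,\dots,\lambda_n\in\mathbb C$ and $x_1,\dots,x_n\in S$. The Fourier–Stieltjes algebra $B(S)$ is the linear span of the bounded continuous positive definite functions on $S$, with $$\|u\|=\sup\Big\{\Big|\int_S u\,d\mu\Big|:\mu\in L(S),\ \|\mu\|_\Sigma\le 1\Big\}\qquad(u\in B(S)).$$ Theorem. Suppose that $S$ is foundation and that $\Sigma(S)$ separates the points of $S$. Then the supremum above is finite for every $u\in B(S)$, and $B(S)$ with the norm $\|\cdot\|$ is isometrically isomorphic, as a Banach space, to the dual space $C^*(S)^*$. More precisely, there is a linear bijection $\Phi:B(S)\to C^*(S)^*$ with $\|\Phi(u)\|=\|u\|$ for all $u\in B(S)$ and $\Phi(u)(\mu)=\int_S u\,d\mu$ for all $u\in B(S)$ and $\mu\in L(S)$, where $\mu$ is identified with its image in $C^*(S)$. -/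

import Mathlib

open MeasureTheory Topology
open scoped ENNReal ComplexOrder ComplexConjugate InnerProductSpace

universe u

noncomputable section

namespace FoundationSemigroup

/-! ### The measure algebra `M(S)` -/

section Measures

variable {S : Type u} [TopologicalSpace S] [T2Space S] [MeasurableSpace S] [BorelSpace S]

/-- Every complex measure has finite total variation. -/
instance isFiniteMeasure_variation {X : Type*} [MeasurableSpace X] (μ : ComplexMeasure X) :
    IsFiniteMeasure μ.variation := by
  have h : μ.variation ≤ (ComplexMeasure.re μ).totalVariation
      + (ComplexMeasure.im μ).totalVariation := by
    refine VectorMeasure.variation_le_of_forall_enorm_le fun E _ => ?_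
    have h1 : ‖μ E‖ₑ ≤ ‖(μ E).re‖ₑ + ‖(μ E).im‖ₑ := by
      have h2 : ‖μ E‖₊ ≤ ‖(μ E).re‖₊ + ‖(μ E).im‖₊ := by
        exact_mod_cast Complex.norm_le_abs_re_add_abs_im (μ E)
      simp only [enorm_eq_nnnorm]
      exact_mod_cast h2
    refine h1.trans ?_
    rw [Measure.add_apply]
    exact add_le_add ((ComplexMeasure.re μ).enorm_le_totalVariation E)
      ((ComplexMeasure.im μ).enorm_le_totalVariation E)
  exact isFiniteMeasure_of_le _ h

/-- A finite Borel measure on a Hausdorff space which is approximated from within by compact sets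
is regular. -/
theorem regular_of_forall_exists_isCompact (μ : Measure S) [IsFiniteMeasure μ]
    (h : ∀ E, MeasurableSet E → ∀ ε : ℝ≥0∞, ε ≠ 0 → ∃ K ⊆ E, IsCompact K ∧ μ (E \ K) < ε) :
    μ.Regular := by
  have hin : μ.InnerRegular := by
    refine ⟨fun E hE r hr => ?_⟩
    obtain ⟨K, hKE, hK, hlt⟩ := h E hE (μ E - r) (tsub_pos_of_lt hr).ne'
    refine ⟨K, hKE, hK, ?_⟩
    by_contra hcon
    push Not at hcon
    have h1 : μ E ≤ μ K + μ (E \ K) := by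
      calc μ E ≤ μ (K ∪ E \ K) := measure_mono (by intro x hx; by_cases x ∈ K <;> simp_all)
        _ ≤ _ := measure_union_le _ _
    have h2 : μ E < r + (μ E - r) :=
      lt_of_le_of_lt (h1.trans (add_le_add_left hcon _))
        (ENNReal.add_lt_add_left (ne_top_of_lt hr) hlt)
    rw [add_tsub_cancel_of_le hr.le] at h2
    exact lt_irrefl _ h2
  have hout : μ.OuterRegular := by
    refine ⟨fun E hE r hr => ?_⟩
    obtain ⟨K, hKE, hK, hlt⟩ := h Eᶜ hE.compl (r - μ E) (tsub_pos_of_lt hr).ne'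
    refine ⟨Kᶜ, Set.subset_compl_comm.mp hKE, hK.isClosed.isOpen_compl, ?_⟩
    have h1 : μ Kᶜ ≤ μ E + μ (Eᶜ \ K) := by
      calc μ Kᶜ ≤ μ (E ∪ Eᶜ \ K) := measure_mono (by intro x hx; by_cases x ∈ E <;> simp_all)
        _ ≤ _ := measure_union_le _ _
    have h2 := lt_of_le_of_lt h1 (ENNReal.add_lt_add_left (measure_ne_top μ E) hlt)
    rwa [add_tsub_cancel_of_le hr.le] at h2
  exact { innerRegular := fun U hU r hr => hin.innerRegular hU.measurableSet r hr }

theorem exists_isCompact_diff_lt_of_regular (μ : Measure S) [IsFiniteMeasure μ] [μ.Regular]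
    {E : Set S} (hE : MeasurableSet E) {ε : ℝ≥0∞} (hε : ε ≠ 0) :
    ∃ K ⊆ E, IsCompact K ∧ μ (E \ K) < ε :=
  hE.exists_isCompact_sdiff_lt (measure_ne_top μ E) hε

theorem regular_of_le {μ ν : Measure S} [IsFiniteMeasure ν] [ν.Regular] (h : μ ≤ ν) :
    μ.Regular := by
  have : IsFiniteMeasure μ := isFiniteMeasure_of_le _ h
  refine regular_of_forall_exists_isCompact μ fun E hE ε hε => ?_
  obtain ⟨K, hKE, hK, hlt⟩ := exists_isCompact_diff_lt_of_regular ν hE hε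
  exact ⟨K, hKE, hK, lt_of_le_of_lt (h _) hlt⟩

theorem regular_add {μ ν : Measure S} [IsFiniteMeasure μ] [μ.Regular] [IsFiniteMeasure ν]
    [ν.Regular] : (μ + ν).Regular := by
  refine regular_of_forall_exists_isCompact _ fun E hE ε hε => ?_
  have hε' : ε / 2 ≠ 0 := by simpa using hε
  obtain ⟨K, hKE, hK, hK'⟩ := exists_isCompact_diff_lt_of_regular μ hE hε'
  obtain ⟨L, hLE, hL, hL'⟩ := exists_isCompact_diff_lt_of_regular ν hE hε'
  refine ⟨K ∪ L, Set.union_subset hKE hLE, hK.union hL, ?_⟩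
  rw [Measure.add_apply]
  calc μ (E \ (K ∪ L)) + ν (E \ (K ∪ L)) ≤ μ (E \ K) + ν (E \ L) := by
        gcongr <;> simp
    _ < ε / 2 + ε / 2 := ENNReal.add_lt_add hK' hL'
    _ = ε := ENNReal.add_halves ε

variable (S) in
/-- The complex Borel measures on `S` whose total variation is a regular measure. -/
def regularMeasures : Submodule ℂ (ComplexMeasure S) where
  carrier := {μ | μ.variation.Regular}
  zero_mem' := by
    show (VectorMeasure.variation (0 : ComplexMeasure S)).Regular
    rw [VectorMeasure.variation_zero]
    infer_instance
  add_mem' {μ ν} hμ hν := by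
    have : μ.variation.Regular := hμ
    have : ν.variation.Regular := hν
    have : (μ.variation + ν.variation).Regular := regular_add
    exact regular_of_le VectorMeasure.variation_add_le
  smul_mem' c μ hμ := by
    have : μ.variation.Regular := hμ
    show (VectorMeasure.variation (c • μ)).Regular
    rw [VectorMeasure.variation_smul]
    infer_instance

variable (S) in
/-- `M(S)`: the bounded regular complex Borel measures on `S`. -/
abbrev RegMeasure : Type u := ↥(regularMeasures S)

/-- The total variation norm `‖μ‖ = |μ|(S)`. -/
instance : Norm (RegMeasure S) := ⟨fun μ => (μ : ComplexMeasure S).variation.real Set.univ⟩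

theorem regMeasure_norm_def (μ : RegMeasure S) :
    ‖μ‖ = (μ : ComplexMeasure S).variation.real Set.univ := rfl

theorem regMeasure_normedSpaceCore : NormedSpace.Core ℂ (RegMeasure S) where
  norm_nonneg μ := measureReal_nonneg
  norm_smul c μ := by
    rw [regMeasure_norm_def, regMeasure_norm_def, Submodule.coe_smul,
      VectorMeasure.variation_smul]
    simp [measureReal_def]
  norm_triangle μ ν := by
    simp only [regMeasure_norm_def, Submodule.coe_add]
    rw [← measureReal_add_apply]
    exact ENNReal.toReal_mono (measure_ne_top _ _) (VectorMeasure.variation_add_le _)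
  norm_eq_zero_iff μ := by
    rw [regMeasure_norm_def, measureReal_eq_zero_iff, Measure.measure_univ_eq_zero,
      VectorMeasure.variation_eq_zero, Submodule.coe_eq_zero]

instance : NormedAddCommGroup (RegMeasure S) :=
  NormedAddCommGroup.ofCore regMeasure_normedSpaceCore

instance : NormedSpace ℂ (RegMeasure S) :=
  NormedSpace.ofCore regMeasure_normedSpaceCore

/-- The total variation `|μ|`, as an element of `M(S)`. -/
def absMeasure (μ : RegMeasure S) : RegMeasure S :=
  ⟨(μ : ComplexMeasure S).variation.toSignedMeasure.toComplexMeasure 0, by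
    have : (μ : ComplexMeasure S).variation.Regular := μ.2
    refine regular_of_le (ν := (μ : ComplexMeasure S).variation) ?_
    refine VectorMeasure.variation_le_of_forall_enorm_le fun E hE => ?_
    have h : (((μ : ComplexMeasure S).variation.toSignedMeasure.toComplexMeasure 0) E : ℂ)
        = (((μ : ComplexMeasure S).variation.real E : ℝ) : ℂ) := by
      rw [SignedMeasure.toComplexMeasure_apply]
      apply Complex.ext <;> simp [Measure.toSignedMeasure_apply_measurable hE]
    rw [h]
    rw [← ofReal_norm, Complex.norm_real, Real.norm_of_nonneg measureReal_nonneg,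
      ofReal_measureReal]⟩

/-- The push-forward of `μ ∈ M(S)` under a continuous map. -/
def pushforward (f : C(S, S)) (μ : RegMeasure S) : RegMeasure S :=
  ⟨(μ : ComplexMeasure S).map f, by
    have : (μ : ComplexMeasure S).variation.Regular := μ.2
    have : (Measure.map f (μ : ComplexMeasure S).variation).Regular := by
      refine regular_of_forall_exists_isCompact _ fun E hE ε hε => ?_
      obtain ⟨K, hKE, hK, hlt⟩ := exists_isCompact_diff_lt_of_regular
        (μ : ComplexMeasure S).variation (f.continuous.measurable hE) hε
      refine ⟨f '' K, by simpa using hKE, hK.image f.continuous, ?_⟩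
      rw [Measure.map_apply f.continuous.measurable
        (hE.diff (hK.image f.continuous).isClosed.measurableSet)]
      refine lt_of_le_of_lt (measure_mono ?_) hlt
      rintro x ⟨hx, hx'⟩
      exact ⟨hx, fun hxK => hx' ⟨x, hxK, rfl⟩⟩
    exact regular_of_le VectorMeasure.variation_map_le⟩

/-- The integral `∫ f dμ` of a complex function against a complex measure. -/
def integral (f : S → ℂ) (μ : RegMeasure S) : ℂ :=
  (μ : ComplexMeasure S).integral f (ContinuousLinearMap.mul ℝ ℂ)

theorem integrable_of_bounded {f : S → ℂ} (hf : Continuous f) {C : ℝ} (hC : ∀ x, ‖f x‖ ≤ C)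
    (μ : RegMeasure S) : (μ : ComplexMeasure S).Integrable f := by
  have : AEStronglyMeasurable f (μ : ComplexMeasure S).variation :=
    hf.measurable.aestronglyMeasurable
  exact Integrable.of_bound this C (Filter.Eventually.of_forall hC)

theorem integral_const_mul (c : ℂ) (f : S → ℂ) (μ : RegMeasure S) :
    integral (fun x => c * f x) μ = c * integral f μ := by
  unfold integral
  rw [VectorMeasure.integral_eq_setToFun, VectorMeasure.integral_eq_setToFun]
  exact setToFun_smul (𝕜 := ℂ) _ (fun c s x => by
    simp [transpose_eq_cbmApplyMeasure, mul_assoc]) c f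

theorem norm_integral_le {f : S → ℂ} {C : ℝ} (hC : ∀ x, ‖f x‖ ≤ C) (μ : RegMeasure S) :
    ‖integral f μ‖ ≤ C * ‖μ‖ := by
  have h := VectorMeasure.norm_integral_le_of_norm_le_const (μ := (μ : ComplexMeasure S))
    (B := ContinuousLinearMap.mul ℝ ℂ) (Filter.Eventually.of_forall hC)
  simpa [integral, regMeasure_norm_def] using h

end Measures

/-! ### The semigroup algebra `L(S)` -/

section SemigroupAlgebra

variable {S : Type u} [Monoid S] [TopologicalSpace S] [T2Space S] [ContinuousMul S]
  [MeasurableSpace S] [BorelSpace S]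

/-- `L_μ(x) = μ * δ_x`. The convolution of `μ` with a point mass at `x` is characterised by
`∫ f d(μ * δ_x) = ∫ f(yx) dμ(y)`, so it is the push-forward of `μ` under `y ↦ yx`. -/
def convDirac (μ : RegMeasure S) (x : S) : RegMeasure S :=
  pushforward (ContinuousMap.mk (fun y => y * x) (continuous_mul_const x)) μ

/-- `R_μ(x) = δ_x * μ`, the push-forward of `μ` under `y ↦ xy`. -/
def diracConv (x : S) (μ : RegMeasure S) : RegMeasure S :=
  pushforward (ContinuousMap.mk (fun y => x * y) (continuous_const_mul x)) μ

variable (S) in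
/-- The semigroup algebra `L(S)`: the measures `μ ∈ M(S)` for which `x ↦ |μ| * δ_x` and
`x ↦ δ_x * |μ|` are continuous from `S` to `M(S)` with its weak (Banach space) topology. -/
def semigroupAlgebra : Set (RegMeasure S) :=
  {μ | Continuous (fun x : S => toWeakSpace ℂ (RegMeasure S) (convDirac (absMeasure μ) x)) ∧
    Continuous (fun x : S => toWeakSpace ℂ (RegMeasure S) (diracConv x (absMeasure μ)))}

variable (S) in
/-- `S` is foundation: the supports of the measures in `L(S)` have dense union. -/
def IsFoundation : Prop :=
  Dense (⋃ μ ∈ semigroupAlgebra S, (μ : ComplexMeasure S).variation.support)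

end SemigroupAlgebra

/-! ### Representations -/

/-- `Σ(S)`: the weakly continuous `*`-representations `π` of `S` by operators on a Hilbert space
with `‖π‖ ≤ 1`. Hilbert spaces in the universe of `S` suffice: every such representation is a
direct sum of cyclic ones and of a zero one, and a cyclic one acts on a Hilbert space which is the
closed span of an image of `S`. -/
structure StarRep (S : Type u) [Monoid S] [StarMul S] [TopologicalSpace S] : Type (u + 1) where
  /-- the Hilbert space `H_π` -/
  H : Type u
  [instNACG : NormedAddCommGroup H]
  [instIPS : InnerProductSpace ℂ H]
  [instComplete : CompleteSpace H]
  /-- the semigroup homomorphism `π` -/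
  op : S →ₙ* (H →L[ℂ] H)
  map_star : ∀ x, op (star x) = ContinuousLinearMap.adjoint (op x)
  norm_le_one : ∀ x, ‖op x‖ ≤ 1
  continuous_coeff : ∀ ξ η : H, Continuous fun x => ⟪η, op x ξ⟫_ℂ

attribute [instance] StarRep.instNACG StarRep.instIPS StarRep.instComplete

section Representations

variable {S : Type u} [Monoid S] [StarMul S] [TopologicalSpace S]

variable (S) in
/-- `Σ(S)` separates the points of `S`. -/
def RepsSeparatePoints : Prop :=
  ∀ x y : S, x ≠ y → ∃ π : StarRep S, π.op x ≠ π.op y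

theorem StarRep.norm_coeff_le (π : StarRep S) (ξ η : π.H) (x : S) :
    ‖⟪η, π.op x ξ⟫_ℂ‖ ≤ ‖η‖ * ‖ξ‖ := by
  refine (norm_inner_le_norm _ _).trans ?_
  gcongr
  simpa using (π.op x).le_of_opNorm_le (π.norm_le_one x) ξ

variable [T2Space S] [MeasurableSpace S] [BorelSpace S]

/-- The bounded sesquilinear form `(η, ξ) ↦ ∫ ⟨π(x)ξ, η⟩ dμ(x)`. -/
def StarRep.form (π : StarRep S) (μ : RegMeasure S) : π.H →L⋆[ℂ] π.H →L[ℂ] ℂ :=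
  LinearMap.mkContinuous₂
    (LinearMap.mk₂'ₛₗ (starRingEnd ℂ) (RingHom.id ℂ)
      (fun η ξ => integral (fun x => ⟪η, π.op x ξ⟫_ℂ) μ)
      (fun η₁ η₂ ξ => by
        simp only [inner_add_left]
        exact VectorMeasure.integral_fun_add
          (integrable_of_bounded (π.continuous_coeff _ _) (π.norm_coeff_le _ _) μ)
          (integrable_of_bounded (π.continuous_coeff _ _) (π.norm_coeff_le _ _) μ))
      (fun c η ξ => by
        simp only [inner_smul_left]
        exact integral_const_mul _ _ μ)
      (fun η ξ₁ ξ₂ => by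
        simp only [map_add, inner_add_right]
        exact VectorMeasure.integral_fun_add
          (integrable_of_bounded (π.continuous_coeff _ _) (π.norm_coeff_le _ _) μ)
          (integrable_of_bounded (π.continuous_coeff _ _) (π.norm_coeff_le _ _) μ))
      (fun c η ξ => by
        simp only [map_smul, inner_smul_right]
        exact integral_const_mul _ _ μ))
    ‖μ‖
    (fun η ξ => by
      refine (norm_integral_le (π.norm_coeff_le ξ η) μ).trans (le_of_eq ?_)
      ring)

/-- The operator `π̃(μ) = ∫ π(x) dμ(x)`, see `StarRep.inner_intOp`. -/
def StarRep.intOp (π : StarRep S) (μ : RegMeasure S) : π.H →L[ℂ] π.H :=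
  ContinuousLinearMap.adjoint (InnerProductSpace.continuousLinearMapOfBilin (π.form μ))

/-- The defining property `⟨π̃(μ)ξ, η⟩ = ∫ ⟨π(x)ξ, η⟩ dμ(x)` (the inner product of Mathlib is
linear in its second argument). -/
theorem StarRep.inner_intOp (π : StarRep S) (μ : RegMeasure S) (ξ η : π.H) :
    ⟪η, π.intOp μ ξ⟫_ℂ = integral (fun x => ⟪η, π.op x ξ⟫_ℂ) μ := by
  rw [StarRep.intOp, ContinuousLinearMap.adjoint_inner_right,
    InnerProductSpace.continuousLinearMapOfBilin_apply]
  rfl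

theorem StarRep.norm_intOp_le (π : StarRep S) (μ : RegMeasure S) : ‖π.intOp μ‖ ≤ ‖μ‖ := by
  refine ContinuousLinearMap.opNorm_le_bound _ (norm_nonneg μ) fun ξ => ?_
  rcases eq_or_ne (π.intOp μ ξ) 0 with h0 | h0
  · rw [h0, norm_zero]; positivity
  have h : ‖π.intOp μ ξ‖ * ‖π.intOp μ ξ‖ ≤ (‖μ‖ * ‖ξ‖) * ‖π.intOp μ ξ‖ := by
    have h1 : ‖⟪π.intOp μ ξ, π.intOp μ ξ⟫_ℂ‖ ≤ (‖π.intOp μ ξ‖ * ‖ξ‖) * ‖μ‖ := by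
      rw [StarRep.inner_intOp]
      exact norm_integral_le (π.norm_coeff_le ξ _) μ
    rw [inner_self_eq_norm_sq_to_K] at h1
    simp only [norm_pow, RCLike.norm_ofReal, abs_norm] at h1
    linarith
  exact le_of_mul_le_mul_right h (norm_pos_iff.mpr h0)

/-- `‖μ‖_Σ = sup {‖π̃(μ)‖ : π ∈ Σ(S)}`. -/
def sigmaNorm (μ : RegMeasure S) : ℝ := ⨆ π : StarRep S, ‖π.intOp μ‖

variable (S) in
/-- The `ℓ^∞`-product of the C*-algebras `B(H_π)`, `π ∈ Σ(S)`. -/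
abbrev RepProduct : Type (u + 1) := lp (fun π : StarRep S => π.H →L[ℂ] π.H) ∞

instance : NonUnitalNormedRing (RepProduct S) := lp.nonUnitalNormedRing

instance : StarRing (RepProduct S) := lp.inftyStarRing

instance : CStarRing (RepProduct S) := lp.inftyCStarRing

instance : NonUnitalCStarAlgebra (RepProduct S) where

instance : NonUnitalRing (RepProduct S) := NonUnitalNormedRing.toNonUnitalRing

instance : NonUnitalSemiring (RepProduct S) := NonUnitalRing.toNonUnitalSemiring

instance : NonUnitalNonAssocSemiring (RepProduct S) :=
  NonUnitalSemiring.toNonUnitalNonAssocSemiring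

/-- The family `(π̃(μ))_{π ∈ Σ(S)}`, in the `ℓ^∞`-product of the algebras `B(H_π)`. -/
def sigmaRep (μ : RegMeasure S) : RepProduct S :=
  ⟨fun π => π.intOp μ, memℓp_infty ⟨‖μ‖, by
    rintro _ ⟨π, rfl⟩
    exact π.norm_intOp_le μ⟩⟩

theorem norm_sigmaRep (μ : RegMeasure S) : ‖sigmaRep μ‖ = sigmaNorm μ :=
  lp.norm_eq_ciSup _

end Representations

/-! ### The semigroup C*-algebra -/

section CStar

variable {S : Type u} [Monoid S] [StarMul S] [TopologicalSpace S] [T2Space S] [ContinuousMul S]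
  [MeasurableSpace S] [BorelSpace S]

variable (S) in
/-- The full semigroup C*-algebra `C*(S)`, the completion of `L(S)/I_Σ` in the norm induced by
`‖·‖_Σ`. It is realised in the `ℓ^∞`-product of the C*-algebras `B(H_π)`, `π ∈ Σ(S)`, where the
image of `μ` has norm `‖μ‖_Σ` and vanishes exactly when `μ ∈ I_Σ`: there it is the norm closure of
the `*`-algebra formed by the images of the elements of `L(S)`. -/
def cstarSubalgebra : NonUnitalStarSubalgebra ℂ (RepProduct S) :=
  (NonUnitalStarAlgebra.adjoin ℂ (sigmaRep '' semigroupAlgebra S)).topologicalClosure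

variable (S) in
/-- The full semigroup C*-algebra `C*(S)`, as a type. -/
def SemigroupCStar : Type (u + 1) := ↥(cstarSubalgebra S)

instance : NonUnitalCStarAlgebra (SemigroupCStar S) :=
  @NonUnitalStarSubalgebra.nonUnitalCStarAlgebra _ _ _ _ _ _ _ (cstarSubalgebra S)
    (NonUnitalStarSubalgebra.isClosed_topologicalClosure _)

/-- The canonical map `L(S) → C*(S)`. -/
def toCStar (μ : semigroupAlgebra S) : SemigroupCStar S :=
  ⟨sigmaRep (μ : RegMeasure S), NonUnitalStarSubalgebra.le_topologicalClosure _
    (NonUnitalStarAlgebra.subset_adjoin ℂ _ ⟨μ, μ.2, rfl⟩)⟩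

theorem norm_toCStar (μ : semigroupAlgebra S) :
    ‖toCStar μ‖ = sigmaNorm (μ : RegMeasure S) :=
  norm_sigmaRep _

end CStar

/-! ### The Fourier–Stieltjes algebra -/

/-- Positive definite functions on a `*`-semigroup. -/
def IsPosDef {S : Type u} [Monoid S] [StarMul S] (u : S → ℂ) : Prop :=
  ∀ (n : ℕ) (c : Fin n → ℂ) (x : Fin n → S),
    0 ≤ ∑ i, ∑ j, c i * conj (c j) * u (x i * star (x j))

/-- `P(S)`: the bounded continuous positive definite functions on `S`. -/
def posDefFunctions (S : Type u) [Monoid S] [StarMul S] [TopologicalSpace S] : Set (S → ℂ) :=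
  {u | Continuous u ∧ (∃ C : ℝ, ∀ x, ‖u x‖ ≤ C) ∧ IsPosDef u}

/-- The Fourier–Stieltjes algebra `B(S)`, as a vector space: the linear span of `P(S)`. -/
def fourierStieltjes (S : Type u) [Monoid S] [StarMul S] [TopologicalSpace S] :
    Submodule ℂ (S → ℂ) :=
  Submodule.span ℂ (posDefFunctions S)

section Norm

variable {S : Type u} [Monoid S] [StarMul S] [TopologicalSpace S] [T2Space S] [ContinuousMul S]
  [MeasurableSpace S] [BorelSpace S]

/-- The numbers `|∫ u dμ|` with `μ ∈ L(S)` and `‖μ‖_Σ ≤ 1`. -/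
def pairingValues (u : S → ℂ) : Set ℝ :=
  {r | ∃ μ ∈ semigroupAlgebra S, sigmaNorm μ ≤ 1 ∧ r = ‖integral u μ‖}

/-- The norm of `B(S)`: `‖u‖ = sup {|∫ u dμ| : μ ∈ L(S), ‖μ‖_Σ ≤ 1}`. -/
def fsNorm (u : S → ℂ) : ℝ := sSup (pairingValues u)

end Norm

end FoundationSemigroup

end

set_option linter.unusedSectionVars false

noncomputable section

namespace FoundationSemigroup

/-! ### Positive measures inside `M(S)` -/

/-! Each u in B(S) acts on L(S) by integration. The theorem says that this action extends to C*(S),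
and that every functional on C*(S) arises in this way.

From B(S) to functionals: a bounded continuous positive definite u is a coefficient ⟨ξ, π(x)ξ⟩ with
π in Σ(S), by the GNS construction (`exists_starRep_of_mem_posDefFunctions`). Hence ∫ u dμ = ⟨ξ,
π̃(μ)ξ⟩ is bounded by ‖ξ‖²‖μ‖_Σ, and spans follow by linearity. The image of L(S) is dense in C*(S),
so the norm of the functional is the supremum defining ‖u‖ (`norm_eq_fsNorm`). If u annihilates
L(S), it annihilates every restriction of |μ| for μ in L(S), so it vanishes on supp μ; the
foundation property then gives u = 0.

From functionals to B(S): vector functionals norm C*(S), and by polarisation each one with vectors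
in the unit balls is a sum of i^k φ_k, k < 4, with quasi-states φ_k. Such sums form a weak*-compact
convex set, so by Hahn–Banach separation they exhaust the dual unit ball
(`mem_phaseHull_of_norm_le_one`). For one quasi-state φ, the operators U_x = (π(x))_π act on C*(S)
by left multiplication, and GNS for ⟨a, b⟩ = φ(a*b) turns them into a representation of S. The
inequality |φ(a)|² ≤ φ(a*a) produces a vector Ω with φ(a) = ⟨Ω, ι a⟩, without an approximate
identity. The identity ∫ φ(U_x a) dμ(x) = φ(μa) then shows that u(x) = ⟨Ω, U_x Ω⟩ represents φ
(`exists_posDef_of_mem_quasiStates`).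

The measure theory behind this is that L(S) is a solid subspace of M(S), stable under translation,
involution and convolution, and that every bounded functional on M(S) passes through the integral
defining a convolution (`functional_conv`). The orbits x ↦ δ_x * ν are only assumed weakly
continuous, so the integral is not treated as a norm-convergent one. Instead, over a compact set all
translates are uniformly absolutely continuous with respect to one finite measure q
(`exists_control_measure`), and on measures absolutely continuous with respect to q a functional is
integration of a bounded function (`exists_density_of_functional`). Questions about arbitrary
functionals thus become questions about measurable sets. -/

/-- An induction principle for bounded measurable functions. -/
theorem bounded_measurable_induction {X : Type*} [MeasurableSpace X] {P : (X → ℂ) → Prop}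
    (hind : ∀ (c : ℂ) (E : Set X), MeasurableSet E → P (E.indicator fun _ => c))
    (hadd : ∀ f g : X → ℂ, Measurable f → Measurable g → (∃ C : ℝ, ∀ x, ‖f x‖ ≤ C) →
      (∃ C : ℝ, ∀ x, ‖g x‖ ≤ C) → P f → P g → P (f + g))
    (hlim : ∀ f : X → ℂ, Measurable f → (∃ C : ℝ, ∀ x, ‖f x‖ ≤ C) →
      (∀ ε > 0, ∃ g : X → ℂ, Measurable g ∧ (∃ C : ℝ, ∀ x, ‖g x‖ ≤ C) ∧
        (∀ x, ‖f x - g x‖ ≤ ε) ∧ P g) → P f)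
    {f : X → ℂ} (hf : Measurable f) {C : ℝ} (hC : ∀ x, ‖f x‖ ≤ C) : P f := by
  have hsimple : ∀ s : SimpleFunc X ℂ, P s := by
    intro s
    induction s using SimpleFunc.induction with
    | const c hE =>
      convert hind c _ hE using 1
      simp only [SimpleFunc.coe_piecewise, SimpleFunc.coe_const]
      rfl
    | add _ hf hg =>
      exact hadd _ _ (SimpleFunc.measurable _) (SimpleFunc.measurable _)
        (SimpleFunc.exists_forall_norm_le _) (SimpleFunc.exists_forall_norm_le _) hf hg
  refine hlim f hf ⟨C, hC⟩ fun ε hε => ?_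
  let e := TopologicalSpace.denseSeq ℂ
  -- The values of `f` lie in a compact ball, so finitely many points of the dense sequence come
  -- within `ε` of all of them. Rounding to the nearest of these points gives the simple function.
  obtain ⟨N, hN⟩ : ∃ N, Metric.closedBall (0 : ℂ) C ⊆ ⋃ k ∈ Finset.range N, Metric.ball (e k) ε := by
    obtain ⟨t, ht⟩ := (isCompact_closedBall (0 : ℂ) C).elim_finite_subcover
      (fun k => Metric.ball (e k) ε) (fun _ => Metric.isOpen_ball) (fun z _ => by
        obtain ⟨k, hk⟩ := (TopologicalSpace.denseRange_denseSeq ℂ).exists_dist_lt z hε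
        exact Set.mem_iUnion.2 ⟨k, hk⟩)
    obtain ⟨N, hN⟩ := t.exists_nat_subset_range
    refine ⟨N, ht.trans (Set.biUnion_subset_biUnion_left hN)⟩
  refine ⟨(SimpleFunc.nearestPt e N).comp f hf, SimpleFunc.measurable _,
    SimpleFunc.exists_forall_norm_le _, fun x => ?_, hsimple _⟩
  obtain ⟨k, hk, hx⟩ := Set.mem_iUnion₂.1 (hN (by simpa using hC x : f x ∈ _))
  have h1 := SimpleFunc.edist_nearestPt_le e (f x) (Finset.mem_range.1 hk).le
  rw [edist_dist, edist_dist, ENNReal.ofReal_le_ofReal_iff dist_nonneg] at h1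
  rw [← dist_eq_norm, dist_comm]
  refine h1.trans ?_
  rw [dist_comm]
  exact (Metric.mem_ball.1 hx).le

section Measures

variable {S : Type u} [TopologicalSpace S] [T2Space S] [MeasurableSpace S] [BorelSpace S]

theorem integral_indicator (c : ℂ) {E : Set S} (hE : MeasurableSet E) (μ : RegMeasure S) :
    integral (E.indicator fun _ => c) μ = c * (μ : ComplexMeasure S) E := by
  rw [integral, VectorMeasure.integral_eq_setToFun,
    setToFun_indicator_const _ hE (measure_ne_top _ _)]
  simp [transpose_eq_cbmApplyMeasure]

theorem integrable_of_measurable_of_bounded {f : S → ℂ} (hf : Measurable f)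
    (hC : ∃ C : ℝ, ∀ x, ‖f x‖ ≤ C) (μ : RegMeasure S) :
    (μ : ComplexMeasure S).Integrable f := by
  obtain ⟨C, hC⟩ := hC
  exact Integrable.of_bound hf.aestronglyMeasurable C (Filter.Eventually.of_forall hC)

theorem integral_add {f g : S → ℂ} (hf : Measurable f) (hg : Measurable g)
    (hCf : ∃ C : ℝ, ∀ x, ‖f x‖ ≤ C) (hCg : ∃ C : ℝ, ∀ x, ‖g x‖ ≤ C) (μ : RegMeasure S) :
    integral (f + g) μ = integral f μ + integral g μ :=
  VectorMeasure.integral_add (integrable_of_measurable_of_bounded hf hCf μ)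
    (integrable_of_measurable_of_bounded hg hCg μ)

theorem integral_sub {f g : S → ℂ} (hf : Measurable f) (hg : Measurable g)
    (hCf : ∃ C : ℝ, ∀ x, ‖f x‖ ≤ C) (hCg : ∃ C : ℝ, ∀ x, ‖g x‖ ≤ C) (μ : RegMeasure S) :
    integral (f - g) μ = integral f μ - integral g μ :=
  VectorMeasure.integral_sub (integrable_of_measurable_of_bounded hf hCf μ)
    (integrable_of_measurable_of_bounded hg hCg μ)

theorem norm_integral_sub_le {f g : S → ℂ} (hf : Measurable f) (hg : Measurable g)
    (hCf : ∃ C : ℝ, ∀ x, ‖f x‖ ≤ C) (hCg : ∃ C : ℝ, ∀ x, ‖g x‖ ≤ C) {ε : ℝ}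
    (h : ∀ x, ‖f x - g x‖ ≤ ε) (μ : RegMeasure S) :
    ‖integral f μ - integral g μ‖ ≤ ε * ‖μ‖ := by
  rw [← integral_sub hf hg hCf hCg]
  exact norm_integral_le h μ

theorem integral_add_measure {f : S → ℂ} (hf : Measurable f) (hC : ∃ C : ℝ, ∀ x, ‖f x‖ ≤ C)
    (μ ν : RegMeasure S) : integral f (μ + ν) = integral f μ + integral f ν :=
  VectorMeasure.integral_add_vectorMeasure (integrable_of_measurable_of_bounded hf hC μ)
    (integrable_of_measurable_of_bounded hf hC ν)

/-- Both sides agree on indicators, are additive in `f`, and are continuous in `f` for the supremum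
norm. -/
theorem integral_smul_measure {f : S → ℂ} (hf : Measurable f) (hC : ∃ C : ℝ, ∀ x, ‖f x‖ ≤ C)
    (c : ℂ) (μ : RegMeasure S) : integral f (c • μ) = c * integral f μ := by
  obtain ⟨C, hC⟩ := hC
  refine bounded_measurable_induction (P := fun f => integral f (c • μ) = c * integral f μ)
    ?_ ?_ ?_ hf hC
  · intro d E hE
    rw [integral_indicator _ hE, integral_indicator _ hE]
    simp only [Submodule.coe_smul, FunLike.coe_smul, Pi.smul_apply, smul_eq_mul]
    ring
  · intro f g hf hg hCf hCg h1 h2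
    rw [integral_add hf hg hCf hCg, integral_add hf hg hCf hCg, h1, h2, mul_add]
  · intro f hf hCf h
    rw [← sub_eq_zero, ← norm_eq_zero]
    refine le_antisymm (le_of_forall_pos_le_add fun ε hε => ?_) (norm_nonneg _)
    have hD : 0 < ‖c • μ‖ + ‖c‖ * ‖μ‖ + 1 := by positivity
    obtain ⟨g, hg, hCg, hfg, hPg⟩ := h (ε / (‖c • μ‖ + ‖c‖ * ‖μ‖ + 1)) (by positivity)
    have h1 := norm_integral_sub_le hf hg hCf hCg hfg (c • μ)
    have h2 := norm_integral_sub_le hf hg hCf hCg hfg μ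
    have h3 : integral f (c • μ) - c * integral f μ
        = (integral f (c • μ) - integral g (c • μ)) - c * (integral f μ - integral g μ) := by
      rw [hPg]; ring
    rw [h3]
    refine (norm_sub_le _ _).trans ?_
    rw [norm_mul]
    calc _ ≤ ε / (‖c • μ‖ + ‖c‖ * ‖μ‖ + 1) * ‖c • μ‖
          + ‖c‖ * (ε / (‖c • μ‖ + ‖c‖ * ‖μ‖ + 1) * ‖μ‖) := by gcongr
      _ = ε * ((‖c • μ‖ + ‖c‖ * ‖μ‖) / (‖c • μ‖ + ‖c‖ * ‖μ‖ + 1)) := by ring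
      _ ≤ ε * 1 := by
        gcongr
        rw [div_le_one hD]
        linarith
      _ = 0 + ε := by ring

/-- Integration of a bounded measurable function, as a bounded functional on `M(S)`. -/
def integralCLM (f : S → ℂ) (hf : Measurable f) (C : ℝ) (hC : ∀ x, ‖f x‖ ≤ C) :
    StrongDual ℂ (RegMeasure S) :=
  LinearMap.mkContinuous
    { toFun := integral f
      map_add' := integral_add_measure hf ⟨C, hC⟩
      map_smul' := integral_smul_measure hf ⟨C, hC⟩ } C (norm_integral_le hC)

theorem integralCLM_apply (f : S → ℂ) (hf : Measurable f) (C : ℝ) (hC : ∀ x, ‖f x‖ ≤ C)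
    (μ : RegMeasure S) : integralCLM f hf C hC μ = integral f μ := rfl

/-- A finite regular positive measure as an element of `M(S)`. -/
def ofMeasure (p : Measure S) [IsFiniteMeasure p] [hp : p.Regular] : RegMeasure S :=
  ⟨p.toSignedMeasure.toComplexMeasure 0, by
    refine regular_of_le (ν := p) ?_
    refine VectorMeasure.variation_le_of_forall_enorm_le fun E hE => ?_
    have h : ((p.toSignedMeasure.toComplexMeasure 0) E : ℂ) = ((p.real E : ℝ) : ℂ) := by
      rw [SignedMeasure.toComplexMeasure_apply]
      apply Complex.ext <;> simp [Measure.toSignedMeasure_apply_measurable hE]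
    rw [h]
    rw [← ofReal_norm, Complex.norm_real, Real.norm_of_nonneg measureReal_nonneg,
      ofReal_measureReal]⟩

theorem ofMeasure_apply (p : Measure S) [IsFiniteMeasure p] [p.Regular] {E : Set S}
    (hE : MeasurableSet E) : (ofMeasure p : ComplexMeasure S) E = p.real E := by
  rw [ofMeasure, SignedMeasure.toComplexMeasure_apply]
  apply Complex.ext <;> simp [Measure.toSignedMeasure_apply_measurable hE]

theorem regMeasure_ext {μ ν : RegMeasure S}
    (h : ∀ E, MeasurableSet E → (μ : ComplexMeasure S) E = (ν : ComplexMeasure S) E) : μ = ν :=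
  Subtype.ext (VectorMeasure.ext h)

theorem enorm_ofMeasure_apply (p : Measure S) [IsFiniteMeasure p] [p.Regular] {E : Set S}
    (hE : MeasurableSet E) : ‖(ofMeasure p : ComplexMeasure S) E‖ₑ = p E := by
  rw [ofMeasure_apply p hE, ← ofReal_norm, Complex.norm_real,
    Real.norm_of_nonneg measureReal_nonneg, ofReal_measureReal]

theorem variation_ofMeasure (p : Measure S) [IsFiniteMeasure p] [p.Regular] :
    (ofMeasure p : ComplexMeasure S).variation = p := by
  refine le_antisymm (VectorMeasure.variation_le_of_forall_enorm_le fun E hE =>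
    (enorm_ofMeasure_apply p hE).le) ?_
  refine Measure.le_iff.2 fun E hE => ?_
  rw [← enorm_ofMeasure_apply p hE]
  exact VectorMeasure.enorm_measure_le_variation _ _

theorem norm_ofMeasure (p : Measure S) [IsFiniteMeasure p] [p.Regular] :
    ‖ofMeasure p‖ = p.real Set.univ := by
  rw [regMeasure_norm_def, variation_ofMeasure]

theorem ofMeasure_congr {p q : Measure S} [IsFiniteMeasure p] [p.Regular] [IsFiniteMeasure q]
    [q.Regular] (h : p = q) : ofMeasure p = ofMeasure q := by subst h; rfl

instance (μ : RegMeasure S) : (μ : ComplexMeasure S).variation.Regular := μ.2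

theorem regular_map (p : Measure S) [IsFiniteMeasure p] [p.Regular] (f : C(S, S)) :
    (p.map f).Regular := by
  refine regular_of_forall_exists_isCompact _ fun E hE ε hε => ?_
  obtain ⟨K, hKE, hK, hlt⟩ := exists_isCompact_diff_lt_of_regular
    p (f.continuous.measurable hE) hε
  refine ⟨f '' K, by simpa using hKE, hK.image f.continuous, ?_⟩
  rw [Measure.map_apply f.continuous.measurable
    (hE.diff (hK.image f.continuous).isClosed.measurableSet)]
  refine lt_of_le_of_lt (measure_mono ?_) hlt
  rintro x ⟨hx, hx'⟩
  exact ⟨hx, fun hxK => hx' ⟨x, hxK, rfl⟩⟩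

instance (p : Measure S) [IsFiniteMeasure p] [p.Regular] (f : C(S, S)) : (p.map f).Regular :=
  regular_map p f

theorem pushforward_apply (f : C(S, S)) (μ : RegMeasure S) {E : Set S} (hE : MeasurableSet E) :
    (pushforward f μ : ComplexMeasure S) E = (μ : ComplexMeasure S) (f ⁻¹' E) :=
  VectorMeasure.map_apply _ f.continuous.measurable hE

theorem pushforward_ofMeasure (f : C(S, S)) (p : Measure S) [IsFiniteMeasure p] [p.Regular] :
    pushforward f (ofMeasure p) = ofMeasure (p.map f) := by
  refine regMeasure_ext fun E hE => ?_
  rw [pushforward_apply _ _ hE, ofMeasure_apply _ hE,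
    ofMeasure_apply _ (f.continuous.measurable hE), measureReal_def, measureReal_def,
    Measure.map_apply f.continuous.measurable hE]

theorem variation_pushforward_le (f : C(S, S)) (μ : RegMeasure S) :
    (pushforward f μ : ComplexMeasure S).variation ≤ (μ : ComplexMeasure S).variation.map f :=
  VectorMeasure.variation_map_le

theorem norm_pushforward_le (f : C(S, S)) (μ : RegMeasure S) : ‖pushforward f μ‖ ≤ ‖μ‖ := by
  rw [regMeasure_norm_def, regMeasure_norm_def]
  refine ENNReal.toReal_mono (measure_ne_top _ _) ((variation_pushforward_le f μ _).trans ?_)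
  rw [Measure.map_apply f.continuous.measurable MeasurableSet.univ, Set.preimage_univ]

/-- The push-forward as a bounded operator on `M(S)`. -/
def pushforwardCLM (f : C(S, S)) : RegMeasure S →L[ℂ] RegMeasure S :=
  LinearMap.mkContinuous
    { toFun := pushforward f
      map_add' := fun μ ν => regMeasure_ext fun E hE => by
        simp [pushforward_apply _ _ hE]
      map_smul' := fun c μ => regMeasure_ext fun E hE => by
        simp [pushforward_apply _ _ hE] } 1
    (fun μ => by simpa using norm_pushforward_le f μ)

theorem pushforwardCLM_apply (f : C(S, S)) (μ : RegMeasure S) :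
    pushforwardCLM f μ = pushforward f μ := rfl

theorem integral_pushforward (T : C(S, S)) {f : S → ℂ} (hf : Measurable f)
    (hC : ∃ C : ℝ, ∀ x, ‖f x‖ ≤ C) (μ : RegMeasure S) :
    integral f (pushforward T μ) = integral (fun x => f (T x)) μ := by
  obtain ⟨C, hC⟩ := hC
  exact VectorMeasure.integral_map T.continuous.measurable hf.aestronglyMeasurable
    (integrable_of_measurable_of_bounded (hf.comp T.continuous.measurable) ⟨C, fun x => hC _⟩ μ)

theorem integral_ofMeasure {f : S → ℂ} (hf : Measurable f) (hC : ∃ C : ℝ, ∀ x, ‖f x‖ ≤ C)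
    (p : Measure S) [IsFiniteMeasure p] [p.Regular] :
    integral f (ofMeasure p) = ∫ x, f x ∂p := by
  have hint : ∀ f : S → ℂ, Measurable f → (∃ C : ℝ, ∀ x, ‖f x‖ ≤ C) → Integrable f p := by
    rintro f hf ⟨C, hC⟩
    exact Integrable.of_bound hf.aestronglyMeasurable C (Filter.Eventually.of_forall hC)
  obtain ⟨C, hC⟩ := hC
  refine bounded_measurable_induction (P := fun f => integral f (ofMeasure p) = ∫ x, f x ∂p)
    ?_ ?_ ?_ hf hC
  · intro d E hE
    rw [integral_indicator _ hE, ofMeasure_apply _ hE, MeasureTheory.integral_indicator_const _ hE,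
      mul_comm]
    simp
  · intro f g hf hg hCf hCg h1 h2
    rw [integral_add hf hg hCf hCg, h1, h2]
    exact (MeasureTheory.integral_add (hint f hf hCf) (hint g hg hCg)).symm
  · intro f hf hCf h
    rw [← sub_eq_zero, ← norm_eq_zero]
    refine le_antisymm (le_of_forall_pos_le_add fun ε hε => ?_) (norm_nonneg _)
    have hD : 0 < 2 * p.real Set.univ + 1 := by positivity
    obtain ⟨g, hg, hCg, hfg, hPg⟩ := h (ε / (2 * p.real Set.univ + 1)) (by positivity)
    have h1 := norm_integral_sub_le hf hg hCf hCg hfg (ofMeasure p)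
    have h2 : ‖(∫ x, f x ∂p) - ∫ x, g x ∂p‖ ≤ ε / (2 * p.real Set.univ + 1) * p.real Set.univ := by
      rw [← MeasureTheory.integral_sub (hint f hf hCf) (hint g hg hCg)]
      exact norm_integral_le_of_norm_le_const (Filter.Eventually.of_forall hfg)
    rw [norm_ofMeasure] at h1
    have h3 : integral f (ofMeasure p) - ∫ x, f x ∂p
        = (integral f (ofMeasure p) - integral g (ofMeasure p))
          - ((∫ x, f x ∂p) - ∫ x, g x ∂p) := by
      rw [hPg]; ring
    rw [h3]
    refine (norm_sub_le _ _).trans ?_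
    calc _ ≤ ε / (2 * p.real Set.univ + 1) * p.real Set.univ
          + ε / (2 * p.real Set.univ + 1) * p.real Set.univ := add_le_add h1 h2
      _ = ε * (2 * p.real Set.univ / (2 * p.real Set.univ + 1)) := by ring
      _ ≤ ε * 1 := by
        gcongr
        rw [div_le_one hD]
        linarith
      _ = 0 + ε := by ring

end Measures

theorem regular_smul_nnreal {X : Type*} [TopologicalSpace X] [MeasurableSpace X] (p : Measure X)
    [p.Regular] (c : NNReal) : (c • p).Regular := by
  rw [show c • p = (c : ℝ≥0∞) • p from rfl]
  exact Measure.Regular.smul ENNReal.coe_ne_top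

/-! ### Positive parts, densities, and functionals on `M(S)` -/

section Measures

variable {S : Type u} [TopologicalSpace S] [T2Space S] [MeasurableSpace S] [BorelSpace S]

/-- Every `μ ∈ M(S)` is a combination of four positive measures dominated by `|μ|`. -/
theorem exists_eq_sum_ofMeasure (μ : RegMeasure S) :
    ∃ (p : Fin 4 → Measure S) (_ : ∀ k, IsFiniteMeasure (p k)) (_ : ∀ k, (p k).Regular),
      (∀ k, p k ≤ (μ : ComplexMeasure S).variation) ∧
      μ = ∑ k : Fin 4, Complex.I ^ (k : ℕ) • ofMeasure (p k) := by
  let m : ComplexMeasure S := μ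
  -- Both Jordan parts of `s` lie below `|s|`, and `|s| ≤ |μ|` because `s` is setwise dominated by
  -- `μ`.
  have hle : ∀ (s : SignedMeasure S), (∀ E, ‖s E‖ₑ ≤ ‖m E‖ₑ) →
      s.toJordanDecomposition.posPart ≤ m.variation ∧
      s.toJordanDecomposition.negPart ≤ m.variation := by
    intro s hs
    have h : s.totalVariation ≤ m.variation := by
      rw [SignedMeasure.totalVariation_eq_variation]
      exact VectorMeasure.variation_le_of_forall_enorm_le fun E _ =>
        (hs E).trans (VectorMeasure.enorm_measure_le_variation _ _)
    exact ⟨(Measure.le_add_right le_rfl).trans h, (Measure.le_add_left le_rfl).trans h⟩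
  have hre := hle (ComplexMeasure.re m) fun E => by
    simp only [enorm_eq_nnnorm]
    exact_mod_cast Complex.abs_re_le_norm (m E)
  have him := hle (ComplexMeasure.im m) fun E => by
    simp only [enorm_eq_nnnorm]
    exact_mod_cast Complex.abs_im_le_norm (m E)
  -- The order matches the phases 1, i, -1, -i: the positive parts of the real and imaginary parts
  -- come first, then the negative parts.
  let p : Fin 4 → Measure S := ![(ComplexMeasure.re m).toJordanDecomposition.posPart,
    (ComplexMeasure.im m).toJordanDecomposition.posPart,
    (ComplexMeasure.re m).toJordanDecomposition.negPart,
    (ComplexMeasure.im m).toJordanDecomposition.negPart]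
  have hp : ∀ k, p k ≤ m.variation := by
    intro k
    fin_cases k
    exacts [hre.1, him.1, hre.2, him.2]
  have hfin : ∀ k, IsFiniteMeasure (p k) := fun k => isFiniteMeasure_of_le _ (hp k)
  have hreg : ∀ k, (p k).Regular := fun k => regular_of_le (hp k)
  refine ⟨p, hfin, hreg, hp, regMeasure_ext fun E hE => ?_⟩
  have key : ∀ s : SignedMeasure S, s E = s.toJordanDecomposition.posPart.real E
      - s.toJordanDecomposition.negPart.real E := by
    intro s
    conv_lhs => rw [← s.toSignedMeasure_toJordanDecomposition]
    simp [JordanDecomposition.toSignedMeasure, Measure.toSignedMeasure_apply_measurable hE]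
  have h1 : (m E).re = (p 0).real E - (p 2).real E := key (ComplexMeasure.re m)
  have h2 : (m E).im = (p 1).real E - (p 3).real E := key (ComplexMeasure.im m)
  simp only [Fin.sum_univ_four, Submodule.coe_add, Submodule.coe_smul, FunLike.coe_add,
    FunLike.coe_smul, Pi.add_apply, Pi.smul_apply, ofMeasure_apply _ hE, smul_eq_mul]
  apply Complex.ext
  · simp [pow_succ]
    change (m E).re = _
    rw [h1]; ring
  · simp [pow_succ]
    change (m E).im = _
    rw [h2]; ring

theorem ofMeasure_add (p q : Measure S) [IsFiniteMeasure p] [p.Regular] [IsFiniteMeasure q]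
    [q.Regular] [(p + q).Regular] : ofMeasure (p + q) = ofMeasure p + ofMeasure q := by
  refine regMeasure_ext fun E hE => ?_
  simp only [Submodule.coe_add, FunLike.coe_add, Pi.add_apply, ofMeasure_apply _ hE]
  rw [measureReal_add_apply]
  push_cast; rfl

instance (p : Measure S) [IsFiniteMeasure p] [p.Regular] (E : Set S) : (p.restrict E).Regular :=
  regular_of_le Measure.restrict_le_self

theorem ofMeasure_restrict_add (p : Measure S) [IsFiniteMeasure p] [p.Regular] {A B : Set S}
    (hAB : Disjoint A B) (hB : MeasurableSet B) :
    ofMeasure (p.restrict (A ∪ B)) = ofMeasure (p.restrict A) + ofMeasure (p.restrict B) := by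
  refine regMeasure_ext fun E hE => ?_
  simp only [Submodule.coe_add, FunLike.coe_add, Pi.add_apply, ofMeasure_apply _ hE]
  rw [Measure.restrict_union hAB hB, measureReal_add_apply]
  push_cast; rfl

theorem norm_ofMeasure_sub_restrict (p : Measure S) [IsFiniteMeasure p] [p.Regular] {A : Set S}
    (hA : MeasurableSet A) : ‖ofMeasure p - ofMeasure (p.restrict A)‖ = p.real Aᶜ := by
  have h : ofMeasure p = ofMeasure (p.restrict A) + ofMeasure (p.restrict Aᶜ) := by
    rw [← ofMeasure_restrict_add p disjoint_compl_right hA.compl]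
    exact ofMeasure_congr (by simp)
  rw [h, add_sub_cancel_left, norm_ofMeasure, measureReal_restrict_apply MeasurableSet.univ,
    Set.univ_inter]

/-- The measure with bounded density `f` with respect to a finite regular measure `p`. -/
def densityMeasure (p : Measure S) [IsFiniteMeasure p] [p.Regular] (f : S → ℂ) (hf : Measurable f)
    (hC : ∃ C : ℝ, ∀ x, ‖f x‖ ≤ C) : RegMeasure S :=
  ⟨p.withDensityᵥ f, by
    have hint : Integrable f p := by
      obtain ⟨C, hC⟩ := hC
      exact Integrable.of_bound hf.aestronglyMeasurable C (Filter.Eventually.of_forall hC)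
    obtain ⟨C, hC⟩ := hC
    have hreg : (C.toNNReal • p).Regular := regular_smul_nnreal p _
    refine regular_of_le (ν := C.toNNReal • p) (Measure.le_iff.2 fun E hE => ?_)
    rw [Measure.variation_withDensityᵥ hint, withDensity_apply _ hE]
    calc ∫⁻ x in E, ‖f x‖ₑ ∂p ≤ ∫⁻ _ in E, (C.toNNReal : ℝ≥0∞) ∂p := by
          refine lintegral_mono fun x => ?_
          rw [← ofReal_norm]
          exact ENNReal.ofReal_le_ofReal (hC x)
      _ = _ := by rw [setLIntegral_const]; rfl⟩

theorem densityMeasure_apply (p : Measure S) [IsFiniteMeasure p] [p.Regular] {f : S → ℂ}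
    (hf : Measurable f) (hC : ∃ C : ℝ, ∀ x, ‖f x‖ ≤ C) {E : Set S} (hE : MeasurableSet E) :
    (densityMeasure p f hf hC : ComplexMeasure S) E = ∫ x in E, f x ∂p := by
  refine withDensityᵥ_apply ?_ hE
  obtain ⟨C, hC⟩ := hC
  exact Integrable.of_bound hf.aestronglyMeasurable C (Filter.Eventually.of_forall hC)

theorem variation_densityMeasure_le (p : Measure S) [IsFiniteMeasure p] [p.Regular] {f : S → ℂ}
    (hf : Measurable f) {C : ℝ} (hC : ∀ x, ‖f x‖ ≤ C) :
    (densityMeasure p f hf ⟨C, hC⟩ : ComplexMeasure S).variation ≤ C.toNNReal • p := by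
  refine VectorMeasure.variation_le_of_forall_enorm_le fun E hE => ?_
  rw [densityMeasure_apply _ _ _ hE]
  refine (enorm_integral_le_lintegral_enorm _).trans ?_
  calc ∫⁻ x in E, ‖f x‖ₑ ∂p ≤ ∫⁻ _ in E, (C.toNNReal : ℝ≥0∞) ∂p := by
        refine lintegral_mono fun x => ?_
        rw [← ofReal_norm]
        exact ENNReal.ofReal_le_ofReal (hC x)
    _ = _ := by rw [setLIntegral_const]; rfl

theorem norm_densityMeasure_le (p : Measure S) [IsFiniteMeasure p] [p.Regular] {f : S → ℂ}
    (hf : Measurable f) (hC' : ∃ C : ℝ, ∀ x, ‖f x‖ ≤ C) {C : ℝ} (h0 : 0 ≤ C)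
    (hC : ∀ x, ‖f x‖ ≤ C) : ‖densityMeasure p f hf hC'‖ ≤ C * p.real Set.univ := by
  rw [regMeasure_norm_def]
  refine (ENNReal.toReal_mono (measure_ne_top _ _)
    (variation_densityMeasure_le p hf hC Set.univ)).trans (le_of_eq ?_)
  simp [measureReal_def, Measure.smul_apply, h0]

/-- A bounded functional on `M(S)` which vanishes on the restrictions of `q` vanishes on the
positive measures which are absolutely continuous with respect to `q`. -/
theorem functional_eq_zero_of_absolutelyContinuous (q : Measure S) [IsFiniteMeasure q] [q.Regular]
    (G : StrongDual ℂ (RegMeasure S))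
    (hG : ∀ E, MeasurableSet E → G (ofMeasure (q.restrict E)) = 0)
    (p : Measure S) [IsFiniteMeasure p] [p.Regular] (hpq : p ≪ q) : G (ofMeasure p) = 0 := by
  have hint : ∀ f : S → ℂ, Measurable f → (∃ C : ℝ, ∀ x, ‖f x‖ ≤ C) → Integrable f q := by
    rintro f hf ⟨C, hC⟩
    exact Integrable.of_bound hf.aestronglyMeasurable C (Filter.Eventually.of_forall hC)
  have hdens : ∀ f : S → ℂ, Measurable f → ∀ C : ℝ, (∀ x, ‖f x‖ ≤ C) →
      ∀ hf hC, G (densityMeasure q f hf hC) = 0 := by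
    intro f hf C hC
    refine bounded_measurable_induction
      (P := fun f => ∀ hf hC, G (densityMeasure q f hf hC) = 0) ?_ ?_ ?_ hf hC
    · intro c E hE hf hC
      have : densityMeasure q _ hf hC = c • ofMeasure (q.restrict E) := by
        refine regMeasure_ext fun A hA => ?_
        rw [densityMeasure_apply _ _ _ hA]
        simp only [Submodule.coe_smul, FunLike.coe_smul, Pi.smul_apply, smul_eq_mul,
          ofMeasure_apply _ hA]
        rw [MeasureTheory.integral_indicator_const _ hE, measureReal_restrict_apply hE,
          measureReal_restrict_apply hA, Set.inter_comm, mul_comm]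
        simp
      rw [this, map_smul, hG E hE, smul_zero]
    · intro f g hf hg hCf hCg h1 h2 hf' hC'
      have : densityMeasure q (f + g) hf' hC'
          = densityMeasure q f hf hCf + densityMeasure q g hg hCg := by
        refine regMeasure_ext fun A hA => ?_
        simp only [Submodule.coe_add, FunLike.coe_add, Pi.add_apply, densityMeasure_apply _ _ _ hA]
        exact MeasureTheory.integral_add (hint f hf hCf).integrableOn (hint g hg hCg).integrableOn
      rw [this, map_add, h1, h2, add_zero]
    · intro f hf hCf h hf' hC'
      rw [← norm_eq_zero]
      refine le_antisymm (le_of_forall_pos_le_add fun ε hε => ?_) (norm_nonneg _)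
      have hD : 0 < ‖G‖ * q.real Set.univ + 1 := by positivity
      obtain ⟨g, hg, hCg, hfg, hPg⟩ := h (ε / (‖G‖ * q.real Set.univ + 1)) (by positivity)
      have hCfg : ∃ C : ℝ, ∀ x, ‖(f - g) x‖ ≤ C := ⟨_, hfg⟩
      have : densityMeasure q f hf' hC' = densityMeasure q (f - g) (hf.sub hg) hCfg
          + densityMeasure q g hg hCg := by
        refine regMeasure_ext fun A hA => ?_
        simp only [Submodule.coe_add, FunLike.coe_add, Pi.add_apply, densityMeasure_apply _ _ _ hA]
        rw [← MeasureTheory.integral_add (hint _ (hf.sub hg) hCfg).integrableOn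
          (hint g hg hCg).integrableOn]
        simp
      rw [this, map_add, hPg, add_zero, zero_add]
      refine (G.le_opNorm _).trans ?_
      calc _ ≤ ‖G‖ * (ε / (‖G‖ * q.real Set.univ + 1) * q.real Set.univ) := by
            gcongr
            exact norm_densityMeasure_le q _ _ (by positivity) hfg
        _ = ε * ((‖G‖ * q.real Set.univ) / (‖G‖ * q.real Set.univ + 1)) := by ring
        _ ≤ ε * 1 := by
          gcongr
          rw [div_le_one hD]
          linarith
        _ = ε := mul_one _
  -- The Radon–Nikodym derivative may be unbounded, so `p` is cut off where it exceeds `n`. The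
  -- cut-off measures have bounded densities, and they converge to `p` in norm because the
  -- derivative is finite almost everywhere.
  let g := p.rnDeriv q
  have hg : Measurable g := Measure.measurable_rnDeriv p q
  let A : ℕ → Set S := fun n => {x | g x ≤ n}
  have hA : ∀ n, MeasurableSet (A n) := fun n => measurableSet_le hg measurable_const
  have hmem : ∀ n x, x ∈ A n ↔ g x ≤ n := fun n x => by simp [A]
  have hzero : ∀ n, G (ofMeasure (p.restrict (A n))) = 0 := by
    intro n
    let f : S → ℂ := (A n).indicator fun x => ((g x).toReal : ℂ)
    have hf : Measurable f :=
      (Complex.measurable_ofReal.comp hg.ennreal_toReal).indicator (hA n)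
    have hC : ∀ x, ‖f x‖ ≤ n := by
      intro x
      by_cases hx : x ∈ A n
      · simp only [f, Set.indicator_of_mem hx, Complex.norm_real,
          Real.norm_of_nonneg ENNReal.toReal_nonneg]
        exact ENNReal.toReal_le_of_le_ofReal (Nat.cast_nonneg n) (by simpa using (hmem n x).1 hx)
      · simp [f, Set.indicator_of_notMem hx]
    have : ofMeasure (p.restrict (A n)) = densityMeasure q f hf ⟨n, hC⟩ := by
      refine regMeasure_ext fun E hE => ?_
      rw [ofMeasure_apply _ hE, densityMeasure_apply _ _ _ hE,
        MeasureTheory.setIntegral_indicator (hA n), integral_complex_ofReal,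
        Measure.setIntegral_toReal_rnDeriv hpq, measureReal_restrict_apply hE]
    rw [this]
    exact hdens f hf n hC hf _
  have hlim : Filter.Tendsto (fun n => p.real (A n)ᶜ) Filter.atTop (𝓝 0) := by
    have h1 : Filter.Tendsto (fun n => p (A n)ᶜ) Filter.atTop (𝓝 (p (⋂ n, (A n)ᶜ))) := by
      refine tendsto_measure_iInter_atTop (fun n => (hA n).compl.nullMeasurableSet) ?_
        ⟨0, measure_ne_top _ _⟩
      intro m n hmn x hx hx'
      exact hx ((hmem n x).2 (((hmem m x).1 hx').trans (by exact_mod_cast hmn)))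
    have h2 : p (⋂ n, (A n)ᶜ) = 0 := by
      refine hpq ?_
      refine measure_mono_null (t := {x | ¬ g x < ∞}) ?_ (Measure.rnDeriv_lt_top p q)
      intro x hx hlt
      obtain ⟨n, hn⟩ := ENNReal.exists_nat_gt hlt.ne
      exact Set.mem_iInter.1 hx n ((hmem n x).2 hn.le)
    rw [h2] at h1
    simpa [measureReal_def, Function.comp_def] using
      (ENNReal.tendsto_toReal ENNReal.zero_ne_top).comp h1
  have hbound : ∀ n, ‖G (ofMeasure p)‖ ≤ ‖G‖ * p.real (A n)ᶜ := by
    intro n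
    rw [← norm_ofMeasure_sub_restrict p (hA n)]
    refine le_trans (le_of_eq ?_) (G.le_opNorm _)
    rw [map_sub, hzero, sub_zero]
  rw [← norm_eq_zero]
  have hlim' := hlim.const_mul ‖G‖
  rw [mul_zero] at hlim'
  exact le_antisymm (ge_of_tendsto' hlim' hbound) (norm_nonneg _)

/-- A bounded functional on `M(S)` is given by integration of a bounded function on the measures
which are absolutely continuous with respect to a fixed one. -/
theorem exists_density_of_functional (q : Measure S) [IsFiniteMeasure q] [q.Regular]
    (F : StrongDual ℂ (RegMeasure S)) :
    ∃ (f : S → ℂ) (C : ℝ), Measurable f ∧ (∀ x, ‖f x‖ ≤ C) ∧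
      ∀ (p : Measure S) [IsFiniteMeasure p] [p.Regular], p ≪ q →
        F (ofMeasure p) = integral f (ofMeasure p) := by
  classical
  -- The set function `E ↦ F(q|_E)` is additive and dominated by `‖F‖ q`, hence a complex measure.
  -- Its density with respect to `q` is the desired function.
  let m₀ : Set S → ℂ := fun E => if MeasurableSet E then F (ofMeasure (q.restrict E)) else 0
  have hm₀ : ∀ E, ‖m₀ E‖ₑ ≤ (‖F‖₊ • q) E := by
    intro E
    by_cases hE : MeasurableSet E
    · have h1 : ‖m₀ E‖ ≤ ‖F‖ * q.real E := by
        simp only [m₀, if_pos hE]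
        refine (F.le_opNorm _).trans ?_
        rw [norm_ofMeasure, measureReal_restrict_apply MeasurableSet.univ, Set.univ_inter]
      rw [← ofReal_norm]
      refine (ENNReal.ofReal_le_ofReal h1).trans (le_of_eq ?_)
      rw [ENNReal.ofReal_mul (norm_nonneg _), ofReal_measureReal, ofReal_norm]
      rfl
    · simp [m₀, hE]
  let m : ComplexMeasure S := VectorMeasure.of_additive_of_le_measure m₀ hm₀
    (fun A B hA hB hAB => by
      simp only [m₀, if_pos hA, if_pos hB, if_pos (hA.union hB), ofMeasure_restrict_add q hAB hB,
        map_add])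
    (fun E hE => by simp [m₀, hE])
  have hm : ∀ E, MeasurableSet E → m E = F (ofMeasure (q.restrict E)) := fun E hE => if_pos hE
  have hmle : ∀ E, MeasurableSet E → ‖m E‖ ≤ ‖F‖ * q.real E := by
    intro E hE
    rw [hm E hE]
    refine (F.le_opNorm _).trans ?_
    rw [norm_ofMeasure, measureReal_restrict_apply MeasurableSet.univ, Set.univ_inter]
  have key : ∀ s : SignedMeasure S, (∀ E, MeasurableSet E → |s E| ≤ ‖F‖ * q.real E) →
      ∃ g : S → ℝ, Measurable g ∧ (∀ x, |g x| ≤ ‖F‖) ∧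
        ∀ E, MeasurableSet E → ∫ x in E, g x ∂q = s E := by
    intro s hs
    have hac : s ≪ᵥ q.toENNRealVectorMeasure := by
      intro E hE
      by_cases hEm : MeasurableSet E
      · rw [Measure.toENNRealVectorMeasure_apply_measurable hEm] at hE
        have := hs E hEm
        rw [measureReal_def, hE] at this
        simpa using this
      · exact s.not_measurable hEm
    have hrn := SignedMeasure.withDensityᵥ_rnDeriv_eq s q hac
    have hi : Integrable (s.rnDeriv q) q := SignedMeasure.integrable_rnDeriv s q
    have hint : ∀ E, MeasurableSet E → ∫ x in E, s.rnDeriv q x ∂q = s E := by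
      intro E hE
      rw [← withDensityᵥ_apply hi hE, hrn]
    have hup : ∀ᵐ x ∂q, s.rnDeriv q x ≤ ‖F‖ := by
      refine ae_le_of_forall_setIntegral_le hi (integrable_const ‖F‖) fun E hE _ => ?_
      rw [hint E hE, setIntegral_const, smul_eq_mul, mul_comm]
      exact (le_abs_self _).trans (hs E hE)
    have hlow : ∀ᵐ x ∂q, -‖F‖ ≤ s.rnDeriv q x := by
      refine ae_le_of_forall_setIntegral_le (integrable_const (-‖F‖)) hi fun E hE _ => ?_
      rw [hint E hE, setIntegral_const, smul_eq_mul]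
      have := (neg_abs_le (s E)).trans' (neg_le_neg (hs E hE))
      linarith
    -- The density is bounded by `‖F‖` only almost everywhere; clamping makes the bound hold at
    -- every point.
    refine ⟨fun x => max (-‖F‖) (min ‖F‖ (s.rnDeriv q x)),
      measurable_const.max (measurable_const.min (SignedMeasure.measurable_rnDeriv s q)),
      fun x => ?_, fun E hE => ?_⟩
    · rw [abs_le]
      exact ⟨le_max_left _ _, max_le (by linarith [norm_nonneg F]) (min_le_left _ _)⟩
    · rw [← hint E hE]
      refine setIntegral_congr_ae hE ?_
      filter_upwards [hup, hlow] with x h1 h2 _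
      rw [min_eq_right h1, max_eq_right h2]
  obtain ⟨g₁, hg₁, hb₁, hi₁⟩ := key (ComplexMeasure.re m) fun E hE =>
    (Complex.abs_re_le_norm (m E)).trans (hmle E hE)
  obtain ⟨g₂, hg₂, hb₂, hi₂⟩ := key (ComplexMeasure.im m) fun E hE =>
    (Complex.abs_im_le_norm (m E)).trans (hmle E hE)
  let f : S → ℂ := fun x => (g₁ x : ℂ) + Complex.I * (g₂ x : ℂ)
  have hf : Measurable f := by
    exact (Complex.measurable_ofReal.comp hg₁).add
      ((Complex.measurable_ofReal.comp hg₂).const_mul _)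
  have hC : ∀ x, ‖f x‖ ≤ ‖F‖ + ‖F‖ := by
    intro x
    refine (norm_add_le _ _).trans (add_le_add ?_ ?_)
    · simpa using hb₁ x
    · simpa using hb₂ x
  refine ⟨f, ‖F‖ + ‖F‖, hf, hC, fun p _ _ hpq => ?_⟩
  have hz := functional_eq_zero_of_absolutelyContinuous q (F - integralCLM f hf _ hC) ?_ p hpq
  · rwa [_root_.sub_apply, sub_eq_zero, integralCLM_apply] at hz
  · intro E hE
    have hi₁' : Integrable g₁ (q.restrict E) :=
      Integrable.of_bound hg₁.aestronglyMeasurable ‖F‖ (Filter.Eventually.of_forall hb₁)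
    have hi₂' : Integrable g₂ (q.restrict E) :=
      Integrable.of_bound hg₂.aestronglyMeasurable ‖F‖ (Filter.Eventually.of_forall hb₂)
    rw [_root_.sub_apply, sub_eq_zero, integralCLM_apply,
      integral_ofMeasure hf ⟨_, hC⟩, ← hm E hE]
    simp only [f]
    rw [MeasureTheory.integral_add hi₁'.ofReal (hi₂'.ofReal.const_mul _),
      MeasureTheory.integral_const_mul, integral_complex_ofReal,
      integral_complex_ofReal, hi₁ E hE, hi₂ E hE,
      mul_comm]
    exact (Complex.re_add_im (m E)).symm

end Measures

/-! ### Setwise continuous families of measures -/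

/-- A `q`-null set lies below every threshold `δ`, so its `θ x`-measure lies below every `ε`. -/
theorem absolutelyContinuous_of_control {X S : Type*} [MeasurableSpace S] {K : Set X} {θ : X → Measure S}
    [∀ x, IsFiniteMeasure (θ x)] {q : Measure S} [IsFiniteMeasure q]
    (hq : ∀ ε : ℝ, 0 < ε → ∃ δ : ℝ, 0 < δ ∧ ∀ E, MeasurableSet E → q.real E < δ →
        ∀ x ∈ K, (θ x).real E < ε) {x : X} (hx : x ∈ K) : θ x ≪ q := by
  refine Measure.AbsolutelyContinuous.mk fun E hE h0 => ?_
  have : (θ x).real E = 0 := by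
    refine le_antisymm (le_of_forall_pos_le_add fun ε hε => ?_) measureReal_nonneg
    obtain ⟨δ, hδ, h⟩ := hq ε hε
    have := h E hE (by rw [measureReal_def, h0]; simpa using hδ) x hx
    linarith
  exact (measureReal_eq_zero_iff (measure_ne_top _ _)).1 this

theorem regular_finset_sum {ι S : Type*} [TopologicalSpace S] [T2Space S]
    [MeasurableSpace S] [BorelSpace S] (θ : ι → Measure S) [∀ x, IsFiniteMeasure (θ x)]
    [∀ x, (θ x).Regular] (t : Finset ι) : (∑ y ∈ t, θ y).Regular := by
  classical
  induction t using Finset.induction_on with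
  | empty => rw [Finset.sum_empty]; infer_instance
  | insert a t ha ih =>
    rw [Finset.sum_insert ha]
    exact regular_add

section Control

variable {X S : Type*} [TopologicalSpace X] [MeasurableSpace S]

/-- A setwise continuous family of finite measures on a compact set is uniformly countably
additive. -/
theorem exists_forall_measureReal_lt {K : Set X} (hK : IsCompact K) (θ : X → Measure S)
    [∀ x, IsFiniteMeasure (θ x)]
    (hθ : ∀ E, MeasurableSet E → ContinuousOn (fun x => (θ x).real E) K)
    {G : ℕ → Set S} (hG : ∀ n, MeasurableSet (G n)) (hanti : Antitone G) (hempty : ⋂ n, G n = ∅)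
    {ε : ℝ} (hε : 0 < ε) : ∃ n, ∀ x ∈ K, (θ x).real (G n) < ε := by
  -- Dini's argument: near each point one `G n` is already small, and since `G` decreases the
  -- largest index of a finite cover serves all of `K`.
  refine hK.induction_on (p := fun s => ∃ n, ∀ x ∈ s, (θ x).real (G n) < ε) ⟨0, by simp⟩ ?_ ?_ ?_
  · rintro s t hst ⟨n, hn⟩
    exact ⟨n, fun x hx => hn x (hst hx)⟩
  · rintro s t ⟨n, hn⟩ ⟨m, hm⟩
    refine ⟨max n m, ?_⟩
    rintro x (hx | hx)
    · exact (measureReal_mono (hanti (le_max_left n m))).trans_lt (hn x hx)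
    · exact (measureReal_mono (hanti (le_max_right n m))).trans_lt (hm x hx)
  · intro x hx
    have h1 : Filter.Tendsto (fun n => θ x (G n)) Filter.atTop (𝓝 (θ x (⋂ n, G n))) :=
      tendsto_measure_iInter_atTop (fun n => (hG n).nullMeasurableSet) hanti
        ⟨0, measure_ne_top _ _⟩
    rw [hempty, measure_empty] at h1
    have h2 := (ENNReal.tendsto_toReal ENNReal.zero_ne_top).comp h1
    obtain ⟨n, hn⟩ := (h2.eventually (gt_mem_nhds (by simpa using hε))).exists
    exact ⟨_, (hθ (G n) (hG n) x hx).eventually (gt_mem_nhds hn), n, fun y hy => hy⟩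

/-- If no finite set of points controls `K`, one finds successively sets `A n` of measure less than
`2⁻ⁿ` at all points found before, and a new point giving `A n` measure at least `ε`. By
Borel–Cantelli the upper limit `N` of the `A n` is null at every point found. Off `N` the tails of
the sequence decrease to the empty set, which contradicts uniform countable additivity on `K`. -/
theorem exists_finset_control {K : Set X} (hK : IsCompact K) (θ : X → Measure S)
    [∀ x, IsFiniteMeasure (θ x)]
    (hθ : ∀ E, MeasurableSet E → ContinuousOn (fun x => (θ x).real E) K) {ε : ℝ} (hε : 0 < ε) :
    ∃ (t : Finset X) (δ : ℝ), 0 < δ ∧ ∀ E, MeasurableSet E → (∀ y ∈ t, (θ y).real E < δ) →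
      ∀ x ∈ K, (θ x).real E < ε := by
  classical
  by_contra hcon
  push Not at hcon
  have : Nonempty X := by
    obtain ⟨E, -, -, x, -⟩ := hcon ∅ 1 one_pos
    exact ⟨x⟩
  choose! E hE hlt x hxK hx using hcon
  -- `t n` collects the points produced at the stages before `n`, so the set chosen at stage `n` is
  -- small for all of them.
  let t : ℕ → Finset X := fun n => Nat.rec ∅ (fun n t => insert (x t ((1 / 2) ^ n)) t) n
  have ht : ∀ n, t (n + 1) = insert (x (t n) ((1 / 2) ^ n)) (t n) := fun n => rfl
  have hmono : Monotone t := monotone_nat_of_le_succ fun n => by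
    rw [ht]; exact Finset.subset_insert _ _
  have hpos : ∀ n : ℕ, (0 : ℝ) < (1 / 2) ^ n := fun n => by positivity
  let A : ℕ → Set S := fun n => E (t n) ((1 / 2) ^ n)
  have hA : ∀ n, MeasurableSet (A n) := fun n => hE _ _ (hpos n)
  let G : ℕ → Set S := fun m => ⋃ n, A (m + n)
  have hG : ∀ m, MeasurableSet (G m) := fun m => MeasurableSet.iUnion fun n => hA _
  have hGanti : Antitone G := antitone_nat_of_succ_le fun m => by
    refine Set.iUnion_subset fun n => ?_
    refine Set.subset_iUnion_of_subset (n + 1) ?_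
    rw [show m + (n + 1) = m + 1 + n by ring]
  let N : Set S := ⋂ m, G m
  have hN : MeasurableSet N := MeasurableSet.iInter hG
  have hnull : ∀ k, ∀ y ∈ t k, θ y N = 0 := by
    intro k y hy
    have hb : ∀ n, θ y (A (k + n)) ≤ ENNReal.ofReal ((1 / 2) ^ n) := by
      intro n
      have h1 := hlt _ _ (hpos (k + n)) y (hmono (Nat.le_add_right k n) hy)
      rw [← ofReal_measureReal (measure_ne_top _ _)]
      refine ENNReal.ofReal_le_ofReal (h1.le.trans ?_)
      exact pow_le_pow_of_le_one (by norm_num) (by norm_num) (Nat.le_add_left n k)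
    have hsum : ∑' n, θ y (A (k + n)) ≠ ∞ := by
      refine ne_top_of_le_ne_top ?_ (ENNReal.tsum_le_tsum hb)
      rw [← ENNReal.ofReal_tsum_of_nonneg (fun n => (hpos n).le) summable_geometric_two]
      exact ENNReal.ofReal_ne_top
    refine measure_mono_null ?_ (measure_limsup_atTop_eq_zero hsum)
    intro z hz
    rw [Filter.mem_limsup_iff_frequently_mem, Filter.frequently_atTop]
    intro m
    obtain ⟨n, hn⟩ := Set.mem_iUnion.1 (Set.mem_iInter.1 hz (k + m))
    refine ⟨m + n, Nat.le_add_right m n, ?_⟩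
    rwa [← add_assoc]
  obtain ⟨m, hm⟩ := exists_forall_measureReal_lt hK θ hθ (G := fun m => G m \ N)
    (fun m => (hG m).diff hN) (fun a b hab => Set.sdiff_subset_sdiff_left (hGanti hab))
    (by
      ext z
      simp only [Set.mem_iInter, Set.mem_sdiff, Set.mem_empty_iff_false, iff_false, not_forall]
      by_cases hz : z ∈ N
      · exact ⟨0, fun h => h.2 hz⟩
      · obtain ⟨m, hm⟩ := not_forall.1 (mt Set.mem_iInter.2 hz)
        exact ⟨m, fun h => hm h.1⟩) hε
  let y := x (t m) ((1 / 2) ^ m)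
  have hy : θ y N = 0 := hnull (m + 1) y (by rw [ht]; exact Finset.mem_insert_self _ _)
  have h1 : ε ≤ (θ y).real (A m) := hx _ _ (hpos m)
  have h2 : (θ y).real (A m) ≤ (θ y).real (G m \ N) := by
    refine ENNReal.toReal_mono (measure_ne_top _ _) ?_
    calc θ y (A m) ≤ θ y ((G m \ N) ∪ N) := by
          refine measure_mono fun z hz => ?_
          by_cases hzN : z ∈ N
          · exact Or.inr hzN
          · exact Or.inl ⟨Set.mem_iUnion.2 ⟨0, hz⟩, hzN⟩
      _ ≤ θ y (G m \ N) + θ y N := measure_union_le _ _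
      _ = θ y (G m \ N) := by rw [hy, add_zero]
  exact absurd (hm y (hxK _ _ (hpos m))) (not_lt.2 (h1.trans h2))

variable [TopologicalSpace S] [T2Space S] [BorelSpace S]

theorem regular_sum (μ : ℕ → Measure S) [∀ n, IsFiniteMeasure (μ n)] [∀ n, (μ n).Regular]
    [IsFiniteMeasure (Measure.sum μ)] : (Measure.sum μ).Regular := by
  refine regular_of_forall_exists_isCompact _ fun E hE ε hε => ?_
  obtain ⟨δ, hδ, hsum⟩ := ENNReal.exists_pos_sum_of_countable' hε ℕ
  choose K hKE hK hlt using fun n => exists_isCompact_diff_lt_of_regular (μ n) hE (hδ n).ne'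
  -- No single `K n` serves all summands. The finite unions exhaust `E` up to measure less than `ε`,
  -- and continuity from above selects one of them.
  let L : ℕ → Set S := fun n => ⋃ k ∈ Finset.range n, K k
  have hL : ∀ n, IsCompact (L n) := fun n => (Finset.range n).isCompact_biUnion fun k _ => hK k
  have hlim : Filter.Tendsto (fun n => Measure.sum μ (E \ L n)) Filter.atTop
      (𝓝 (Measure.sum μ (⋂ n, E \ L n))) := by
    refine tendsto_measure_iInter_atTop
      (fun n => (hE.diff (hL n).isClosed.measurableSet).nullMeasurableSet) ?_
      ⟨0, measure_ne_top _ _⟩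
    intro m n hmn
    refine Set.sdiff_subset_sdiff_right (Set.biUnion_subset_biUnion_left ?_)
    exact Finset.range_mono hmn
  have hlt' : Measure.sum μ (⋂ n, E \ L n) < ε := by
    rw [Measure.sum_apply _ (MeasurableSet.iInter fun n => hE.diff (hL n).isClosed.measurableSet)]
    refine lt_of_le_of_lt (ENNReal.tsum_le_tsum fun n => ?_) hsum
    refine (measure_mono ?_).trans (hlt n).le
    intro z hz
    have := Set.mem_iInter.1 hz (n + 1)
    refine ⟨this.1, fun hzK => this.2 ?_⟩
    exact Set.mem_biUnion (Finset.mem_coe.2 (Finset.self_mem_range_succ n)) hzK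
  obtain ⟨n, hn⟩ := (hlim.eventually (gt_mem_nhds hlt')).exists
  exact ⟨L n, Set.iUnion₂_subset fun k _ => hKE k, hL n, hn⟩

/-- A setwise continuous family of finite regular measures on a compact set is uniformly
absolutely continuous with respect to a single finite regular measure. -/
theorem exists_control_measure {K : Set X} (hK : IsCompact K) (θ : X → Measure S)
    [∀ x, IsFiniteMeasure (θ x)] [∀ x, (θ x).Regular]
    (hθ : ∀ E, MeasurableSet E → ContinuousOn (fun x => (θ x).real E) K) :
    ∃ (q : Measure S) (_ : IsFiniteMeasure q) (_ : q.Regular),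
      ∀ ε : ℝ, 0 < ε → ∃ δ : ℝ, 0 < δ ∧ ∀ E, MeasurableSet E → q.real E < δ →
        ∀ x ∈ K, (θ x).real E < ε := by
  choose t δ hδ ht using fun n : ℕ =>
    exists_finset_control hK θ hθ (ε := 1 / ((n : ℝ) + 1)) (by positivity)
  let ν : ℕ → Measure S := fun n => ∑ y ∈ t n, θ y
  have hνfin : ∀ n, IsFiniteMeasure (ν n) := fun n => inferInstance
  have hνreg : ∀ n, (ν n).Regular := fun n => regular_finset_sum θ (t n)
  -- The weights make the total mass of the weighted sum less than one while keeping every finite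
  -- control set inside it.
  obtain ⟨c, hc, hsum⟩ := ENNReal.exists_pos_tsum_mul_lt_of_countable one_ne_zero
    (fun n => ν n Set.univ) (fun n => measure_ne_top _ _)
  let μ : ℕ → Measure S := fun n => c n • ν n
  have hμreg : ∀ n, (μ n).Regular := fun n => regular_smul_nnreal _ _
  have hfin : IsFiniteMeasure (Measure.sum μ) := by
    refine ⟨?_⟩
    rw [Measure.sum_apply _ MeasurableSet.univ]
    refine lt_of_le_of_lt (le_of_eq ?_) (hsum.trans ENNReal.one_lt_top)
    refine tsum_congr fun n => ?_
    rw [mul_comm]; rfl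
  refine ⟨Measure.sum μ, hfin, regular_sum μ, fun ε hε => ?_⟩
  obtain ⟨n, hn⟩ := exists_nat_one_div_lt hε
  have hcn : (0 : ℝ) < c n := by exact_mod_cast hc n
  -- If the weighted sum gives `E` mass below `c n * δ n`, then each `θ y` with `y ∈ t n` gives it
  -- mass below `δ n`.
  refine ⟨c n * δ n, mul_pos hcn (hδ n), fun E hE hlt x hx => ?_⟩
  refine (ht n E hE (fun y hy => ?_) x hx).trans hn
  have h1 : (c n : ℝ) * (θ y).real E ≤ (Measure.sum μ).real E := by
    have h2 : (c n : ℝ≥0∞) * θ y E ≤ Measure.sum μ E := by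
      calc (c n : ℝ≥0∞) * θ y E ≤ (c n : ℝ≥0∞) * ν n E := by
            refine mul_le_mul_right ?_ _
            exact Finset.single_le_sum (f := θ) (fun _ _ => Measure.zero_le _) hy E
        _ = μ n E := rfl
        _ ≤ _ := Measure.le_sum μ n E
    have h3 := ENNReal.toReal_mono (measure_ne_top _ _) h2
    rwa [ENNReal.toReal_mul] at h3
  exact lt_of_mul_lt_mul_left (h1.trans_lt hlt) hcn.le

end Control

/-! ### Families of push-forwards -/

section Translates

variable {X : Type*} {S : Type u} [TopologicalSpace X] [TopologicalSpace S] [T2Space S]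
  [MeasurableSpace S] [BorelSpace S]

theorem continuous_toWeakSpace_iff {θ : X → RegMeasure S} :
    Continuous (fun x => toWeakSpace ℂ (RegMeasure S) (θ x)) ↔
      ∀ F : StrongDual ℂ (RegMeasure S), Continuous fun x => F (θ x) := by
  constructor
  · intro h F
    exact (WeakBilin.eval_continuous (topDualPairing ℂ (RegMeasure S)).flip F).comp h
  · intro h
    exact WeakBilin.continuous_of_continuous_eval _ h

/-- Evaluation at a measurable set, as a bounded functional on `M(S)`. -/
theorem exists_functional_eq_apply {E : Set S} (hE : MeasurableSet E) :
    ∃ F : StrongDual ℂ (RegMeasure S), ∀ μ, F μ = (μ : ComplexMeasure S) E := by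
  refine ⟨integralCLM (E.indicator fun _ => 1) (measurable_const.indicator hE) 1 fun x => ?_,
    fun μ => ?_⟩
  · by_cases hx : x ∈ E <;> simp [hx]
  · rw [integralCLM_apply, integral_indicator _ hE, one_mul]

theorem continuous_measureReal_of_weak {θ : X → Measure S} [∀ x, IsFiniteMeasure (θ x)]
    [∀ x, (θ x).Regular] (h : ∀ F : StrongDual ℂ (RegMeasure S),
      Continuous fun x => F (ofMeasure (θ x))) {E : Set S} (hE : MeasurableSet E) :
    Continuous fun x => (θ x).real E := by
  obtain ⟨F, hF⟩ := exists_functional_eq_apply hE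
  have := Complex.continuous_re.comp (h F)
  simpa [Function.comp_def, hF, ofMeasure_apply _ hE] using this

/-- Up to a small mass, `p` lives on a compact set, where `f (T x y)` tends to `f (T x₀ y)`
uniformly in `y`. Dominated convergence is not at hand, since neighbourhoods in `X` need not be
countably generated. -/
theorem continuous_integral_comp (T : X → C(S, S)) (hT : Continuous fun z : X × S => T z.1 z.2)
    {f : S → ℂ} (hf : Continuous f) {C : ℝ} (hC : ∀ x, ‖f x‖ ≤ C)
    (p : Measure S) [IsFiniteMeasure p] [p.Regular] :
    Continuous fun x => ∫ y, f (T x y) ∂p := by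
  have h0 : ∀ x, Integrable (fun y => f (T x y)) p := fun x =>
    Integrable.of_bound (hf.comp (T x).continuous).measurable.aestronglyMeasurable C
      (Filter.Eventually.of_forall fun y => hC _)
  rw [continuous_iff_continuousAt]
  intro x₀
  rw [Metric.continuousAt_iff']
  intro ε hε
  have hC0 : 0 ≤ |C| := abs_nonneg C
  -- The integrand varies by at most `2|C|`, so the complement of `K` contributes at most `ε/2`; the
  -- tolerance `ε2` on `K` below contributes at most `ε/4`.
  have hε1 : 0 < ε / (4 * (|C| + 1)) := by positivity
  obtain ⟨K, -, hK, hlt⟩ := exists_isCompact_diff_lt_of_regular p MeasurableSet.univ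
    (ε := ENNReal.ofReal (ε / (4 * (|C| + 1)))) (by simpa using hε1)
  have hKc : p.real Kᶜ < ε / (4 * (|C| + 1)) := by
    rw [← Set.compl_eq_univ_sdiff] at hlt
    exact (ENNReal.lt_ofReal_iff_toReal_lt (measure_ne_top _ _)).1 hlt
  let ε2 := ε / (4 * (p.real Set.univ + 1))
  have hε2 : 0 < ε2 := by positivity
  have hunif : ∀ᶠ x in 𝓝 x₀, ∀ y ∈ K, ‖f (T x y) - f (T x₀ y)‖ < ε2 := by
    have hcont : Continuous fun z : X × S => ‖f (T z.1 z.2) - f (T x₀ z.2)‖ := by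
      have h1 : Continuous fun z : X × S => f (T z.1 z.2) := hf.comp hT
      have h2 : Continuous fun z : X × S => f (T x₀ z.2) :=
        hf.comp ((T x₀).continuous.comp continuous_snd)
      exact (h1.sub h2).norm
    refine hK.eventually_forall_of_forall_eventually fun y hy => ?_
    refine hcont.continuousAt.eventually (gt_mem_nhds ?_)
    simpa using hε2
  filter_upwards [hunif] with x hx
  rw [dist_eq_norm, ← MeasureTheory.integral_sub (h0 x) (h0 x₀)]
  have hi : Integrable (fun y => f (T x y) - f (T x₀ y)) p := (h0 x).sub (h0 x₀)
  rw [← integral_add_compl hK.measurableSet hi]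
  have h1 : ‖∫ y in K, (f (T x y) - f (T x₀ y)) ∂p‖ ≤ ε2 * p.real K :=
    norm_setIntegral_le_of_norm_le_const (measure_lt_top _ _) fun y hy => (hx y hy).le
  have h2 : ‖∫ y in Kᶜ, (f (T x y) - f (T x₀ y)) ∂p‖ ≤ (2 * |C|) * p.real Kᶜ := by
    refine norm_setIntegral_le_of_norm_le_const (measure_lt_top _ _) fun y hy => ?_
    refine (norm_sub_le _ _).trans ?_
    linarith [hC (T x y), hC (T x₀ y), le_abs_self C]
  have h3 : ε2 * p.real K ≤ ε / 4 := by
    calc ε2 * p.real K ≤ ε2 * (p.real Set.univ + 1) := by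
          gcongr
          exact (measureReal_mono (Set.subset_univ K)).trans (by linarith)
      _ = ε / 4 := by simp only [ε2]; field_simp
  have h4 : (2 * |C|) * p.real Kᶜ ≤ ε / 2 := by
    calc (2 * |C|) * p.real Kᶜ ≤ (2 * (|C| + 1)) * (ε / (4 * (|C| + 1))) := by
          gcongr
          linarith
      _ = ε / 2 := by field_simp; norm_num
  calc _ ≤ _ := norm_add_le _ _
    _ < ε := by linarith

variable [LocallyCompactSpace S]

/-- If the translates of `p` are weakly continuous and `ν ≤ p`, then the translates of `ν` take
continuous values on each measurable set. -/
theorem continuousOn_measureReal_map (T : X → C(S, S)) (hT : Continuous fun z : X × S => T z.1 z.2)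
    (p ν : Measure S) [IsFiniteMeasure p] [p.Regular] [IsFiniteMeasure ν] [ν.Regular] (hν : ν ≤ p)
    {K : Set X} {q : Measure S} [IsFiniteMeasure q] [q.Regular]
    (hq : ∀ ε : ℝ, 0 < ε → ∃ δ : ℝ, 0 < δ ∧ ∀ E, MeasurableSet E → q.real E < δ →
        ∀ x ∈ K, (p.map (T x)).real E < ε) {E : Set S} (hE : MeasurableSet E) :
    ContinuousOn (fun x => ((ν.map (T x)).real E : ℂ)) K := by
  have hνp : ∀ x A, (ν.map (T x)).real A ≤ (p.map (T x)).real A := fun x A =>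
    ENNReal.toReal_mono (measure_ne_top _ _) (Measure.map_mono hν (T x).continuous.measurable A)
  -- The function is a uniform limit on `K` of continuous ones: `E` is squeezed between a compact
  -- `A` and an open `V` with `q (V \ A) < δ`, and its indicator is replaced by a Urysohn function
  -- `h`. The error is at most the translated mass of `V \ A`, which the control makes uniformly
  -- small.
  refine continuousOn_of_uniform_approx_of_continuousOn fun U hU => ?_
  obtain ⟨ε, hε, hεU⟩ := Metric.mem_uniformity_dist.1 hU
  obtain ⟨δ, hδ, hδE⟩ := hq ε hε
  have hδ2 : ENNReal.ofReal (δ / 2) ≠ 0 := by simpa using hδ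
  obtain ⟨A, hAE, hA, hAlt⟩ := exists_isCompact_diff_lt_of_regular q hE hδ2
  obtain ⟨V, hEV, hV, -, hVlt⟩ := hE.exists_isOpen_sdiff_lt (measure_ne_top q E) hδ2
  obtain ⟨h, hh1, hh0, -, hh⟩ := exists_continuous_one_zero_of_isCompact hA hV.isClosed_compl
    (Set.disjoint_compl_right_iff_subset.2 (hAE.trans hEV))
  have hlt : q.real (V \ A) < δ := by
    have : q (V \ A) < ENNReal.ofReal δ := by
      calc q (V \ A) ≤ q (V \ E ∪ E \ A) := measure_mono (by
            intro z hz
            by_cases hzE : z ∈ E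
            · exact Or.inr ⟨hzE, hz.2⟩
            · exact Or.inl ⟨hz.1, hzE⟩)
        _ ≤ q (V \ E) + q (E \ A) := measure_union_le _ _
        _ < ENNReal.ofReal (δ / 2) + ENNReal.ofReal (δ / 2) := ENNReal.add_lt_add hVlt hAlt
        _ = ENNReal.ofReal δ := by
          rw [← ENNReal.ofReal_add (by positivity) (by positivity), add_halves]
    exact (ENNReal.lt_ofReal_iff_toReal_lt (measure_ne_top _ _)).1 this
  have hVA : MeasurableSet (V \ A) := hV.measurableSet.diff hA.measurableSet
  have hsmall := hδE _ hVA hlt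
  let f : S → ℂ := fun y => (h y : ℂ)
  have hfc : Continuous f := Complex.continuous_ofReal.comp h.continuous
  have hfb : ∀ y, ‖f y‖ ≤ 1 := fun y => by
    simp only [f, Complex.norm_real, Real.norm_of_nonneg (hh y).1]
    exact (hh y).2
  refine ⟨fun x => ∫ y, f (T x y) ∂ν, (continuous_integral_comp T hT hfc hfb ν).continuousOn,
    fun x hx => hεU ?_⟩
  have hi : Integrable f (ν.map (T x)) :=
    Integrable.of_bound hfc.measurable.aestronglyMeasurable 1 (Filter.Eventually.of_forall hfb)
  have hi' : Integrable (E.indicator fun _ => (1 : ℂ)) (ν.map (T x)) :=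
    (integrable_const 1).indicator hE
  have h1 : ((ν.map (T x)).real E : ℂ) = ∫ y, E.indicator (fun _ => (1 : ℂ)) y ∂(ν.map (T x)) := by
    rw [MeasureTheory.integral_indicator_const _ hE]; simp
  have h2 : ∫ y, f (T x y) ∂ν = ∫ y, f y ∂(ν.map (T x)) :=
    (MeasureTheory.integral_map (T x).continuous.aemeasurable
      hfc.measurable.aestronglyMeasurable).symm
  rw [dist_eq_norm, h1]
  beta_reduce
  rw [h2, ← MeasureTheory.integral_sub hi' hi]
  refine lt_of_le_of_lt ?_ ((hνp x (V \ A)).trans_lt (hsmall x hx))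
  have h3 : ∀ y, ‖E.indicator (fun _ => (1 : ℂ)) y - f y‖ ≤ (V \ A).indicator (fun _ => (1 : ℝ)) y := by
    intro y
    by_cases hyA : y ∈ A
    · have : f y = 1 := by simp [f, hh1 hyA]
      rw [Set.indicator_of_mem (hAE hyA), this, Set.indicator_of_notMem (fun hy => hy.2 hyA)]
      simp
    by_cases hyV : y ∈ V
    · rw [Set.indicator_of_mem (s := V \ A) ⟨hyV, hyA⟩]
      by_cases hyE : y ∈ E
      · rw [Set.indicator_of_mem hyE]
        have : (1 : ℂ) - f y = ((1 - h y : ℝ) : ℂ) := by simp [f]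
        rw [this, Complex.norm_real, Real.norm_of_nonneg (by linarith [(hh y).2])]
        linarith [(hh y).1]
      · rw [Set.indicator_of_notMem hyE, zero_sub, norm_neg]
        exact hfb y
    · have : f y = 0 := by simp [f, hh0 hyV]
      rw [Set.indicator_of_notMem (fun hy => hyV (hEV hy)), this,
        Set.indicator_of_notMem (fun hy => hyV hy.1)]
      simp
  calc _ ≤ ∫ y, (V \ A).indicator (fun _ => (1 : ℝ)) y ∂(ν.map (T x)) :=
        norm_integral_le_of_norm_le ((integrable_const 1).indicator hVA)
          (Filter.Eventually.of_forall h3)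
    _ = _ := by rw [MeasureTheory.integral_indicator_const _ hVA]; simp

/-- Weak continuity of translates passes to dominated measures. -/
theorem continuous_translates_of_le (hX : ∀ x : X, ∃ K ∈ 𝓝 x, IsCompact K) (T : X → C(S, S))
    (hT : Continuous fun z : X × S => T z.1 z.2)
    (p ν : Measure S) [IsFiniteMeasure p] [p.Regular] [IsFiniteMeasure ν] [ν.Regular] (hν : ν ≤ p)
    (hp : ∀ F : StrongDual ℂ (RegMeasure S), Continuous fun x => F (ofMeasure (p.map (T x))))
    (F : StrongDual ℂ (RegMeasure S)) : Continuous fun x => F (ofMeasure (ν.map (T x))) := by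
  rw [continuous_iff_continuousAt]
  intro x₀
  obtain ⟨K, hKx, hK⟩ := hX x₀
  suffices h : ContinuousOn (fun x => F (ofMeasure (ν.map (T x)))) K from h.continuousAt hKx
  -- On the compact neighbourhood all translates of `p`, and hence those of `ν`, are absolutely
  -- continuous with respect to one `q`, so `F` acts on them as integration of a bounded function
  -- `f`. Indicators are handled by `continuousOn_measureReal_map`, and general `f` by uniform
  -- approximation.
  obtain ⟨q, _, _, hq⟩ := exists_control_measure hK (fun x => p.map (T x))
    (fun E hE => (continuous_measureReal_of_weak hp hE).continuousOn)
  obtain ⟨f, C, hf, hC, hF⟩ := exists_density_of_functional q F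
  have hac : ∀ x ∈ K, ν.map (T x) ≪ q := fun x hx =>
    ((Measure.absolutelyContinuous_of_le hν).map (T x).continuous.measurable).trans
      (absolutelyContinuous_of_control hq hx)
  suffices h : ContinuousOn (fun x => integral f (ofMeasure (ν.map (T x)))) K from
    h.congr fun x hx => hF _ (hac x hx)
  refine bounded_measurable_induction
    (P := fun f => ContinuousOn (fun x => integral f (ofMeasure (ν.map (T x)))) K) ?_ ?_ ?_ hf hC
  · intro c E hE
    have h := continuousOn_measureReal_map T hT p ν hν hq hE
    refine ((continuousOn_const (c := c)).mul h).congr fun x hx => ?_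
    rw [integral_indicator _ hE, ofMeasure_apply _ hE]
    rfl
  · intro f g hf hg hCf hCg h1 h2
    refine (h1.add h2).congr fun x _ => ?_
    exact integral_add hf hg hCf hCg _
  · intro f hf hCf h
    refine continuousOn_of_uniform_approx_of_continuousOn fun U hU => ?_
    obtain ⟨ε, hε, hεU⟩ := Metric.mem_uniformity_dist.1 hU
    obtain ⟨g, hg, hCg, hfg, hPg⟩ := h (ε / (ν.real Set.univ + 1)) (by positivity)
    refine ⟨_, hPg, fun x _ => hεU ?_⟩
    rw [dist_eq_norm]
    refine (norm_integral_sub_le hf hg hCf hCg hfg _).trans_lt ?_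
    rw [norm_ofMeasure, map_measureReal_apply (T x).continuous.measurable MeasurableSet.univ,
      Set.preimage_univ, div_mul_eq_mul_div, div_lt_iff₀ (by positivity)]
    nlinarith [measureReal_nonneg (μ := ν) (s := Set.univ)]

end Translates

/-! ### Positive measures with weakly continuous translates -/

theorem map_map_continuousMap {X : Type*} [TopologicalSpace X] [MeasurableSpace X] [BorelSpace X]
    (p : Measure X) (f g : C(X, X)) : (p.map f).map g = p.map (g.comp f) :=
  Measure.map_map g.continuous.measurable f.continuous.measurable

section Translation

variable {S : Type u} [Monoid S] [TopologicalSpace S] [ContinuousMul S]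

/-- Left multiplication by `x`. -/
abbrev leftMul (x : S) : C(S, S) := ContinuousMap.mk (fun y => x * y) (continuous_const_mul x)

/-- Right multiplication by `x`. -/
abbrev rightMul (x : S) : C(S, S) := ContinuousMap.mk (fun y => y * x) (continuous_mul_const x)

variable [T2Space S] [MeasurableSpace S] [BorelSpace S]

/-- The translates of `p` from both sides are weakly continuous. -/
def IsTranslationContinuous (p : Measure S) [IsFiniteMeasure p] [p.Regular] : Prop :=
  (∀ F : StrongDual ℂ (RegMeasure S), Continuous fun x => F (ofMeasure (p.map (rightMul x)))) ∧
    ∀ F : StrongDual ℂ (RegMeasure S), Continuous fun x => F (ofMeasure (p.map (leftMul x)))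

/-- Membership concerns `|μ|` alone, so the structure of `L(S)` can be worked out on positive
measures. -/
theorem mem_semigroupAlgebra_iff {μ : RegMeasure S} :
    μ ∈ semigroupAlgebra S ↔ IsTranslationContinuous (μ : ComplexMeasure S).variation := by
  have h1 : ∀ x, convDirac (absMeasure μ) x
      = ofMeasure ((μ : ComplexMeasure S).variation.map (rightMul x)) := fun x =>
    pushforward_ofMeasure _ _
  have h2 : ∀ x, diracConv x (absMeasure μ)
      = ofMeasure ((μ : ComplexMeasure S).variation.map (leftMul x)) := fun x =>
    pushforward_ofMeasure _ _
  rw [semigroupAlgebra, Set.mem_ofPred_eq, continuous_toWeakSpace_iff, continuous_toWeakSpace_iff,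
    IsTranslationContinuous]
  simp only [h1, h2]

namespace IsTranslationContinuous

variable {p q : Measure S} [IsFiniteMeasure p] [p.Regular] [IsFiniteMeasure q] [q.Regular]

theorem add (hp : IsTranslationContinuous p) (hq : IsTranslationContinuous q)
    [(p + q).Regular] : IsTranslationContinuous (p + q) := by
  have key : ∀ T : C(S, S), ofMeasure ((p + q).map T)
      = ofMeasure (p.map T) + ofMeasure (q.map T) := by
    intro T
    rw [← pushforward_ofMeasure, ofMeasure_add, ← pushforward_ofMeasure, ← pushforward_ofMeasure,
      ← pushforwardCLM_apply, map_add]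
    rfl
  constructor
  · intro F
    simp only [key, map_add]
    exact (hp.1 F).add (hq.1 F)
  · intro F
    simp only [key, map_add]
    exact (hp.2 F).add (hq.2 F)

theorem smul_nnreal (hp : IsTranslationContinuous p) (c : NNReal) [(c • p).Regular] :
    IsTranslationContinuous (c • p) := by
  have key : ∀ T : C(S, S), ofMeasure ((c • p).map T) = (c : ℂ) • ofMeasure (p.map T) := by
    intro T
    refine regMeasure_ext fun E hE => ?_
    simp only [Submodule.coe_smul, FunLike.coe_smul, Pi.smul_apply, ofMeasure_apply _ hE,
      map_measureReal_apply T.continuous.measurable hE, measureReal_nnreal_smul_apply]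
    simp
  constructor
  · intro F
    simp only [key, map_smul]
    exact (hp.1 F).fun_const_smul _
  · intro F
    simp only [key, map_smul]
    exact (hp.2 F).fun_const_smul _

/-- Left and right translations commute, so the right orbit is the old one followed by a bounded
operator on `M(S)`; the left orbit is the old one reparametrised by `y ↦ y * x`. -/
theorem map_leftMul (hp : IsTranslationContinuous p) (x : S) :
    IsTranslationContinuous (p.map (leftMul x)) := by
  constructor
  · intro F
    have h : ∀ y, ofMeasure ((p.map (leftMul x)).map (rightMul y))
        = pushforwardCLM (leftMul x) (ofMeasure (p.map (rightMul y))) := by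
      intro y
      rw [pushforwardCLM_apply, pushforward_ofMeasure]
      refine ofMeasure_congr ?_
      rw [map_map_continuousMap, map_map_continuousMap]
      congr 1
      ext z
      simp [mul_assoc]
    simp only [h]
    exact hp.1 (F.comp (pushforwardCLM (leftMul x)))
  · intro F
    have h : ∀ y, ofMeasure ((p.map (leftMul x)).map (leftMul y))
        = ofMeasure (p.map (leftMul (y * x))) := by
      intro y
      refine ofMeasure_congr ?_
      rw [map_map_continuousMap]
      congr 1
      ext z
      simp [mul_assoc]
    simp only [h]
    exact (hp.2 F).comp (continuous_mul_const x)

theorem map_rightMul (hp : IsTranslationContinuous p) (x : S) :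
    IsTranslationContinuous (p.map (rightMul x)) := by
  constructor
  · intro F
    have h : ∀ y, ofMeasure ((p.map (rightMul x)).map (rightMul y))
        = ofMeasure (p.map (rightMul (x * y))) := by
      intro y
      refine ofMeasure_congr ?_
      rw [map_map_continuousMap]
      congr 1
      ext z
      simp [mul_assoc]
    simp only [h]
    exact (hp.1 F).comp (continuous_const_mul x)
  · intro F
    have h : ∀ y, ofMeasure ((p.map (rightMul x)).map (leftMul y))
        = pushforwardCLM (rightMul x) (ofMeasure (p.map (leftMul y))) := by
      intro y
      rw [pushforwardCLM_apply, pushforward_ofMeasure]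
      refine ofMeasure_congr ?_
      rw [map_map_continuousMap, map_map_continuousMap]
      congr 1
      ext z
      simp [mul_assoc]
    simp only [h]
    exact hp.2 (F.comp (pushforwardCLM (rightMul x)))

variable [LocallyCompactSpace S]

/-- This is the solidity of `L(S)`, from which its linear structure and its stability under
restriction follow. Local compactness supplies the compact neighbourhoods and the Urysohn functions.
-/
theorem of_le (hp : IsTranslationContinuous p) (hqp : q ≤ p) : IsTranslationContinuous q := by
  have hX : ∀ x : S, ∃ K ∈ 𝓝 x, IsCompact K := fun x =>
    let ⟨K, hK, hx⟩ := exists_compact_mem_nhds x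
    ⟨K, hx, hK⟩
  exact ⟨continuous_translates_of_le hX rightMul (continuous_snd.mul continuous_fst) p q hqp hp.1,
    continuous_translates_of_le hX leftMul (continuous_fst.mul continuous_snd) p q hqp hp.2⟩

theorem mem_of_variation_le (hp : IsTranslationContinuous p) {μ : RegMeasure S}
    (h : (μ : ComplexMeasure S).variation ≤ p) : μ ∈ semigroupAlgebra S :=
  mem_semigroupAlgebra_iff.2 (hp.of_le h)

theorem ofMeasure_mem (hp : IsTranslationContinuous p) : ofMeasure p ∈ semigroupAlgebra S :=
  hp.mem_of_variation_le (variation_ofMeasure p).le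

end IsTranslationContinuous

section Star

variable [StarMul S] [ContinuousStar S]

variable (S) in
/-- The involution as a continuous map. -/
abbrev starMap : C(S, S) := ContinuousMap.mk star continuous_star

/-- Translating on one side by `y` after the involution is translating on the other side by `star y`
before it, so the two conditions are exchanged. -/
theorem IsTranslationContinuous.map_star {p : Measure S} [IsFiniteMeasure p] [p.Regular]
    (hp : IsTranslationContinuous p) : IsTranslationContinuous (p.map (starMap S)) := by
  constructor
  · intro F
    have h : ∀ y, ofMeasure ((p.map (starMap S)).map (rightMul y))
        = pushforwardCLM (starMap S) (ofMeasure (p.map (leftMul (star y)))) := by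
      intro y
      rw [pushforwardCLM_apply, pushforward_ofMeasure]
      refine ofMeasure_congr ?_
      rw [map_map_continuousMap, map_map_continuousMap]
      congr 1
      ext z
      simp
    simp only [h]
    exact (hp.2 (F.comp (pushforwardCLM (starMap S)))).comp continuous_star
  · intro F
    have h : ∀ y, ofMeasure ((p.map (starMap S)).map (leftMul y))
        = pushforwardCLM (starMap S) (ofMeasure (p.map (rightMul (star y)))) := by
      intro y
      rw [pushforwardCLM_apply, pushforward_ofMeasure]
      refine ofMeasure_congr ?_
      rw [map_map_continuousMap, map_map_continuousMap]
      congr 1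
      ext z
      simp
    simp only [h]
    exact (hp.1 (F.comp (pushforwardCLM (starMap S)))).comp continuous_star

end Star

variable [LocallyCompactSpace S]

variable (S) in
/-- `L(S)` as a linear subspace of `M(S)`. -/
def semigroupSubmodule : Submodule ℂ (RegMeasure S) where
  carrier := semigroupAlgebra S
  zero_mem' := by
    have h : IsTranslationContinuous (0 : Measure S) := by
      have key : ∀ T : C(S, S), ofMeasure ((0 : Measure S).map T) = 0 := by
        intro T
        refine regMeasure_ext fun E hE => ?_
        rw [ofMeasure_apply _ hE, Measure.map_zero]
        simp
      constructor <;> · intro F; simp only [key]; exact continuous_const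
    refine h.mem_of_variation_le ?_
    rw [Submodule.coe_zero, VectorMeasure.variation_zero]
  add_mem' {μ ν} hμ hν := by
    have : ((μ : ComplexMeasure S).variation + (ν : ComplexMeasure S).variation).Regular :=
      regular_add
    exact ((mem_semigroupAlgebra_iff.1 hμ).add (mem_semigroupAlgebra_iff.1 hν)).mem_of_variation_le
      VectorMeasure.variation_add_le
  smul_mem' c μ hμ := by
    have : (‖c‖₊ • (μ : ComplexMeasure S).variation).Regular := regular_smul_nnreal _ _
    refine ((mem_semigroupAlgebra_iff.1 hμ).smul_nnreal ‖c‖₊).mem_of_variation_le (le_of_eq ?_)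
    rw [Submodule.coe_smul, VectorMeasure.variation_smul]

theorem exists_eq_sum_of_mem {μ : RegMeasure S} (hμ : μ ∈ semigroupAlgebra S) :
    ∃ (p : Fin 4 → Measure S) (_ : ∀ k, IsFiniteMeasure (p k)) (_ : ∀ k, (p k).Regular),
      (∀ k, IsTranslationContinuous (p k)) ∧
      μ = ∑ k : Fin 4, Complex.I ^ (k : ℕ) • ofMeasure (p k) := by
  obtain ⟨p, hfin, hreg, hle, h⟩ := exists_eq_sum_ofMeasure μ
  exact ⟨p, hfin, hreg, fun k => (mem_semigroupAlgebra_iff.1 hμ).of_le (hle k), h⟩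

/-- The definition of `L(S)` speaks of the translates of `|μ|`; solidity carries the continuity to
the four positive parts of `μ`, and so to `μ` itself. -/
theorem continuous_pushforward_leftMul {μ : RegMeasure S} (hμ : μ ∈ semigroupAlgebra S)
    (F : StrongDual ℂ (RegMeasure S)) : Continuous fun x => F (pushforward (leftMul x) μ) := by
  obtain ⟨p, _, _, hp, rfl⟩ := exists_eq_sum_of_mem hμ
  simp only [← pushforwardCLM_apply, map_sum, map_smul]
  refine continuous_finsetSum _ fun k _ => Continuous.fun_const_smul ?_ _
  simp only [pushforwardCLM_apply, pushforward_ofMeasure]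
  exact (hp k).2 F

theorem pushforward_leftMul_mem {μ : RegMeasure S} (hμ : μ ∈ semigroupAlgebra S) (x : S) :
    pushforward (leftMul x) μ ∈ semigroupAlgebra S :=
  ((mem_semigroupAlgebra_iff.1 hμ).map_leftMul x).mem_of_variation_le
    (variation_pushforward_le _ _)

end Translation

/-! ### Convolution of positive measures -/

section Convolution

variable {S : Type u} [Monoid S] [TopologicalSpace S] [ContinuousMul S]
  [T2Space S] [MeasurableSpace S] [BorelSpace S]

/-- The convolution of the positive measures `p` and `q`. -/
def conv (p q : Measure S) : Measure S := p.bind fun x => q.map (leftMul x)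

variable {p q : Measure S} [IsFiniteMeasure p] [p.Regular] [IsFiniteMeasure q] [q.Regular]

theorem measurable_map_leftMul (hq : IsTranslationContinuous q) :
    Measurable fun x => q.map (leftMul x) := by
  refine Measure.measurable_of_measurable_coe _ fun E hE => ?_
  have h := (continuous_measureReal_of_weak hq.2 hE).measurable.ennreal_ofReal
  simpa using h

theorem conv_apply {p : Measure S} (hq : IsTranslationContinuous q) {E : Set S} (hE : MeasurableSet E) :
    conv p q E = ∫⁻ x, q.map (leftMul x) E ∂p :=
  Measure.bind_apply hE (measurable_map_leftMul hq).aemeasurable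

theorem conv_univ {p : Measure S} (hq : IsTranslationContinuous q) :
    conv p q Set.univ = q Set.univ * p Set.univ := by
  rw [conv_apply hq MeasurableSet.univ]
  have : ∀ x : S, q.map (leftMul x) Set.univ = q Set.univ := fun x => by
    rw [Measure.map_apply (leftMul x).continuous.measurable MeasurableSet.univ, Set.preimage_univ]
  simp only [this, lintegral_const]

theorem isFiniteMeasure_conv (hq : IsTranslationContinuous q) : IsFiniteMeasure (conv p q) :=
  ⟨by rw [conv_univ hq]; exact ENNReal.mul_lt_top (measure_lt_top _ _) (measure_lt_top _ _)⟩

theorem conv_real_univ (hq : IsTranslationContinuous q) :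
    (conv p q).real Set.univ = q.real Set.univ * p.real Set.univ := by
  rw [measureReal_def, conv_univ hq, ENNReal.toReal_mul]; rfl

/-- One compact subset of `E` serves all translates of `q` by points of a compact set `K`: a compact
set good at `x` stays good near `x` by setwise continuity, and finitely many of them cover `K`.
Outside `K` the measure `p` has little mass. -/
theorem regular_conv (hq : IsTranslationContinuous q) : (conv p q).Regular := by
  have := isFiniteMeasure_conv (p := p) hq
  refine regular_of_forall_exists_isCompact _ fun E hE ε hε => ?_
  have hε2 : ε / 2 ≠ 0 := by simpa using hε
  -- `δ₁` bounds the mass of `p` outside `K`, against inner mass at most `q(S)`; `δ₂` bounds the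
  -- inner mass over `K`, against `p(S)`.
  obtain ⟨δ₁, hδ₁, hδ₁q⟩ := ENNReal.exists_nnreal_pos_mul_lt (measure_ne_top q Set.univ) hε2
  obtain ⟨δ₂, hδ₂, hδ₂p⟩ := ENNReal.exists_nnreal_pos_mul_lt (measure_ne_top p Set.univ) hε2
  obtain ⟨K, -, hK, hKlt⟩ := exists_isCompact_diff_lt_of_regular p MeasurableSet.univ
    (ε := δ₁) (by simpa using hδ₁.ne')
  rw [← Set.compl_eq_univ_sdiff] at hKlt
  have hunif : ∃ A ⊆ E, IsCompact A ∧ ∀ x ∈ K, q.map (leftMul x) (E \ A) ≤ δ₂ := by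
    refine hK.induction_on
      (p := fun s => ∃ A ⊆ E, IsCompact A ∧ ∀ x ∈ s, q.map (leftMul x) (E \ A) ≤ δ₂)
      ⟨∅, Set.empty_subset _, isCompact_empty, by simp⟩ ?_ ?_ ?_
    · rintro s t hst ⟨A, hAE, hA, h⟩
      exact ⟨A, hAE, hA, fun x hx => h x (hst hx)⟩
    · rintro s t ⟨A, hAE, hA, h⟩ ⟨B, hBE, hB, h'⟩
      refine ⟨A ∪ B, Set.union_subset hAE hBE, hA.union hB, ?_⟩
      rintro x (hx | hx)
      · exact (measure_mono (Set.sdiff_subset_sdiff_right Set.subset_union_left)).trans (h x hx)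
      · exact (measure_mono (Set.sdiff_subset_sdiff_right Set.subset_union_right)).trans (h' x hx)
    · intro x _
      obtain ⟨A, hAE, hA, hlt⟩ := exists_isCompact_diff_lt_of_regular (q.map (leftMul x)) hE
        (ε := δ₂) (by simpa using hδ₂.ne')
      have hc := continuous_measureReal_of_weak hq.2 (hE.diff hA.measurableSet)
      have hlt' : (q.map (leftMul x)).real (E \ A) < δ₂ := by
        have := (ENNReal.toReal_lt_toReal (measure_ne_top _ _) ENNReal.coe_ne_top).2 hlt
        simpa [measureReal_def] using this
      refine ⟨_, mem_nhdsWithin_of_mem_nhds (hc.continuousAt.eventually (gt_mem_nhds hlt')),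
        A, hAE, hA, fun y hy => ?_⟩
      have hy' : (q.map (leftMul y)).real (E \ A) < δ₂ := hy
      rw [← ofReal_measureReal (measure_ne_top _ _)]
      exact ENNReal.ofReal_le_of_le_toReal (by simpa using hy'.le)
  obtain ⟨A, hAE, hA, hlt⟩ := hunif
  refine ⟨A, hAE, hA, ?_⟩
  rw [conv_apply hq (hE.diff hA.measurableSet), ← lintegral_add_compl _ hK.measurableSet]
  have h1 : ∫⁻ x in K, q.map (leftMul x) (E \ A) ∂p ≤ δ₂ * p Set.univ := by
    calc _ ≤ ∫⁻ _ in K, (δ₂ : ℝ≥0∞) ∂p := setLIntegral_mono measurable_const hlt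
      _ ≤ _ := by
        rw [setLIntegral_const]
        gcongr
        exact Set.subset_univ _
  have h2 : ∫⁻ x in Kᶜ, q.map (leftMul x) (E \ A) ∂p ≤ δ₁ * q Set.univ := by
    calc _ ≤ ∫⁻ _ in Kᶜ, q Set.univ ∂p := by
          refine lintegral_mono fun x => ?_
          rw [Measure.map_apply (leftMul x).continuous.measurable (hE.diff hA.measurableSet)]
          exact measure_mono (Set.subset_univ _)
      _ ≤ _ := by
        rw [setLIntegral_const, mul_comm]
        gcongr
  calc _ ≤ (δ₂ : ℝ≥0∞) * p Set.univ + δ₁ * q Set.univ := add_le_add h1 h2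
    _ < ε / 2 + ε / 2 := ENNReal.add_lt_add hδ₂p hδ₁q
    _ = ε := ENNReal.add_halves ε

theorem integral_conv (hq : IsTranslationContinuous q) [IsFiniteMeasure (conv p q)]
    [(conv p q).Regular] {f : S → ℂ} (hf : Measurable f) {C : ℝ} (hC : ∀ x, ‖f x‖ ≤ C) :
    integral f (ofMeasure (conv p q))
      = ∫ x, integral f (ofMeasure (q.map (leftMul x))) ∂p := by
  have hnorm : ∀ x : S, ‖ofMeasure (q.map (leftMul x))‖ = q.real Set.univ := fun x => by
    rw [norm_ofMeasure, map_measureReal_apply (leftMul x).continuous.measurable MeasurableSet.univ,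
      Set.preimage_univ]
  have hint : ∀ f : S → ℂ, Measurable f → (∃ C : ℝ, ∀ x, ‖f x‖ ≤ C) →
      Integrable (fun x => integral f (ofMeasure (q.map (leftMul x)))) p := by
    rintro f hf ⟨C, hC⟩
    refine Integrable.of_bound (hq.2 (integralCLM f hf C hC)).measurable.aestronglyMeasurable
      (C * q.real Set.univ) (Filter.Eventually.of_forall fun x => ?_)
    rw [← hnorm x]
    exact norm_integral_le hC _
  refine bounded_measurable_induction (P := fun f => integral f (ofMeasure (conv p q))
      = ∫ x, integral f (ofMeasure (q.map (leftMul x))) ∂p) ?_ ?_ ?_ hf hC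
  · intro c E hE
    simp only [integral_indicator _ hE, ofMeasure_apply _ hE]
    rw [MeasureTheory.integral_const_mul, integral_complex_ofReal]
    congr 2
    rw [measureReal_def, conv_apply hq hE, ← integral_toReal]
    · rfl
    · exact ((Measure.measurable_coe hE).comp (measurable_map_leftMul hq)).aemeasurable
    · exact Filter.Eventually.of_forall fun x => measure_lt_top _ _
  · intro f g hf hg hCf hCg h1 h2
    rw [integral_add hf hg hCf hCg, h1, h2, ← MeasureTheory.integral_add (hint f hf hCf)
      (hint g hg hCg)]
    simp only [integral_add hf hg hCf hCg]
  · intro f hf hCf h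
    rw [← sub_eq_zero, ← norm_eq_zero]
    refine le_antisymm (le_of_forall_pos_le_add fun ε hε => ?_) (norm_nonneg _)
    set D := q.real Set.univ * p.real Set.univ with hDdef
    have hD : 0 < 2 * D + 1 := by positivity
    obtain ⟨g, hg, hCg, hfg, hPg⟩ := h (ε / (2 * D + 1)) (by positivity)
    have h1 := norm_integral_sub_le hf hg hCf hCg hfg (ofMeasure (conv p q))
    rw [norm_ofMeasure, conv_real_univ hq] at h1
    have h2 : ‖(∫ x, integral f (ofMeasure (q.map (leftMul x))) ∂p)
        - ∫ x, integral g (ofMeasure (q.map (leftMul x))) ∂p‖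
        ≤ (ε / (2 * D + 1) * q.real Set.univ) * p.real Set.univ := by
      rw [← MeasureTheory.integral_sub (hint f hf hCf) (hint g hg hCg)]
      refine norm_integral_le_of_norm_le_const (Filter.Eventually.of_forall fun x => ?_)
      rw [← hnorm x]
      exact norm_integral_sub_le hf hg hCf hCg hfg _
    rw [← sub_sub_sub_cancel_right _ _ (integral g (ofMeasure (conv p q)))]
    nth_rewrite 2 [hPg]
    refine (norm_sub_le _ _).trans ?_
    calc _ ≤ ε / (2 * D + 1) * D + (ε / (2 * D + 1) * q.real Set.univ) * p.real Set.univ :=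
          add_le_add h1 h2
      _ = ε * (2 * D / (2 * D + 1)) := by rw [hDdef]; ring
      _ ≤ ε * 1 := by
        gcongr
        rw [div_le_one hD]
        linarith
      _ = 0 + ε := by ring

theorem conv_restrict_add_compl (p q : Measure S) {K : Set S} (hK : MeasurableSet K)
    [IsFiniteMeasure q] [q.Regular] (hq : IsTranslationContinuous q) :
    conv p q = conv (p.restrict K) q + conv (p.restrict Kᶜ) q := by
  refine Measure.ext fun E hE => ?_
  have hm := (measurable_map_leftMul hq).aemeasurable (μ := p)
  rw [Measure.add_apply, conv, conv, conv, Measure.bind_apply hE hm,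
    Measure.bind_apply hE (measurable_map_leftMul hq).aemeasurable,
    Measure.bind_apply hE (measurable_map_leftMul hq).aemeasurable, lintegral_add_compl _ hK]

/-- Over compact `K` the translates of `q` and the convolution are all absolutely continuous with
respect to one `r`. There `F` is integration of a bounded function, for which `integral_conv`
applies. -/
theorem functional_conv_restrict (hq : IsTranslationContinuous q) {K : Set S} (hK : IsCompact K)
    [IsFiniteMeasure (conv (p.restrict K) q)] [(conv (p.restrict K) q).Regular]
    (F : StrongDual ℂ (RegMeasure S)) :
    F (ofMeasure (conv (p.restrict K) q)) = ∫ x in K, F (ofMeasure (q.map (leftMul x))) ∂p := by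
  obtain ⟨r, _, _, hr⟩ := exists_control_measure hK (fun x => q.map (leftMul x))
    (fun E hE => (continuous_measureReal_of_weak hq.2 hE).continuousOn)
  obtain ⟨f, C, hf, hC, hF⟩ := exists_density_of_functional r F
  have hac : conv (p.restrict K) q ≪ r := by
    refine Measure.AbsolutelyContinuous.mk fun E hE h0 => ?_
    rw [conv_apply hq hE]
    refine (setLIntegral_congr_fun (g := fun _ => 0) hK.measurableSet fun x hx => ?_).trans
      (by simp)
    exact absolutelyContinuous_of_control hr hx h0
  rw [hF _ hac, integral_conv hq hf hC]
  refine setIntegral_congr_fun hK.measurableSet fun x hx => ?_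
  exact (hF _ (absolutelyContinuous_of_control hr hx)).symm

theorem norm_functional_map_leftMul_le (F : StrongDual ℂ (RegMeasure S)) (x : S) :
    ‖F (ofMeasure (q.map (leftMul x)))‖ ≤ ‖F‖ * q.real Set.univ := by
  refine (F.le_opNorm _).trans (le_of_eq ?_)
  rw [norm_ofMeasure, map_measureReal_apply (leftMul x).continuous.measurable MeasurableSet.univ,
    Set.preimage_univ]

/-- Bounded functionals can be taken inside a convolution. -/
theorem functional_conv (hq : IsTranslationContinuous q)
    [IsFiniteMeasure (conv p q)] [(conv p q).Regular] (F : StrongDual ℂ (RegMeasure S)) :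
    F (ofMeasure (conv p q)) = ∫ x, F (ofMeasure (q.map (leftMul x))) ∂p := by
  have hint : Integrable (fun x => F (ofMeasure (q.map (leftMul x)))) p :=
    Integrable.of_bound (hq.2 F).measurable.aestronglyMeasurable _
      (Filter.Eventually.of_forall (norm_functional_map_leftMul_le F))
  rw [← sub_eq_zero, ← norm_eq_zero]
  refine le_antisymm (le_of_forall_pos_le_add fun ε hε => ?_) (norm_nonneg _)
  set D := ‖F‖ * q.real Set.univ with hDdef
  have hD : 0 < 2 * D + 1 := by positivity
  have hη : 0 < ε / (2 * D + 1) := by positivity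
  -- Outside `K` both sides are at most `D * p.real Kᶜ`, hence the tolerance `ε / (2 * D + 1)`.
  obtain ⟨K, -, hK, hKlt⟩ := exists_isCompact_diff_lt_of_regular p MeasurableSet.univ
    (ε := ENNReal.ofReal (ε / (2 * D + 1))) (by simpa using hη)
  rw [← Set.compl_eq_univ_sdiff] at hKlt
  have hKlt' : p.real Kᶜ < ε / (2 * D + 1) :=
    (ENNReal.lt_ofReal_iff_toReal_lt (measure_ne_top _ _)).1 hKlt
  have := isFiniteMeasure_conv (p := p.restrict K) hq
  have := regular_conv (p := p.restrict K) hq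
  have := isFiniteMeasure_conv (p := p.restrict Kᶜ) hq
  have := regular_conv (p := p.restrict Kᶜ) hq
  have hsplit : ofMeasure (conv p q)
      = ofMeasure (conv (p.restrict K) q) + ofMeasure (conv (p.restrict Kᶜ) q) := by
    have : (conv (p.restrict K) q + conv (p.restrict Kᶜ) q).Regular := regular_add
    rw [← ofMeasure_add]
    exact ofMeasure_congr (conv_restrict_add_compl p q hK.measurableSet hq)
  rw [hsplit, map_add, functional_conv_restrict hq hK F, ← integral_add_compl hK.measurableSet hint,
    add_sub_add_left_eq_sub]
  have h1 : ‖F (ofMeasure (conv (p.restrict Kᶜ) q))‖ ≤ D * p.real Kᶜ := by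
    refine (F.le_opNorm _).trans (le_of_eq ?_)
    rw [norm_ofMeasure, conv_real_univ hq, measureReal_restrict_apply MeasurableSet.univ,
      Set.univ_inter, ← mul_assoc]
  have h2 : ‖∫ x in Kᶜ, F (ofMeasure (q.map (leftMul x))) ∂p‖ ≤ D * p.real Kᶜ :=
    norm_setIntegral_le_of_norm_le_const (measure_lt_top _ _)
      fun x _ => norm_functional_map_leftMul_le F x
  have hD0 : 0 ≤ D := by positivity
  calc _ ≤ D * p.real Kᶜ + D * p.real Kᶜ := (norm_sub_le _ _).trans (add_le_add h1 h2)
    _ ≤ D * (ε / (2 * D + 1)) + D * (ε / (2 * D + 1)) := by gcongr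
    _ = ε * (2 * D / (2 * D + 1)) := by ring
    _ ≤ ε * 1 := by
      gcongr
      rw [div_le_one hD]
      linarith
    _ = 0 + ε := by ring

theorem conv_map_rightMul {p : Measure S} (hq : IsTranslationContinuous q) (y : S) :
    (conv p q).map (rightMul y) = conv p (q.map (rightMul y)) := by
  refine Measure.ext fun E hE => ?_
  have hE' := (rightMul y).continuous.measurable hE
  rw [Measure.map_apply (rightMul y).continuous.measurable hE, conv_apply hq hE',
    conv_apply (hq.map_rightMul y) hE]
  refine lintegral_congr fun x => ?_
  rw [map_map_continuousMap, Measure.map_apply (leftMul x).continuous.measurable hE',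
    Measure.map_apply (ContinuousMap.continuous _).measurable hE]
  congr 1
  ext z
  simp [mul_assoc]

theorem conv_map_leftMul {p : Measure S} (hq : IsTranslationContinuous q) (y : S) :
    (conv p q).map (leftMul y) = conv (p.map (leftMul y)) q := by
  refine Measure.ext fun E hE => ?_
  have hE' := (leftMul y).continuous.measurable hE
  have hm : Measurable fun x => q.map (leftMul x) E :=
    (Measure.measurable_coe hE).comp (measurable_map_leftMul hq)
  rw [Measure.map_apply (leftMul y).continuous.measurable hE, conv_apply hq hE',
    conv_apply hq hE, lintegral_map hm
      (leftMul y).continuous.measurable]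
  refine lintegral_congr fun x => ?_
  rw [Measure.map_apply (leftMul x).continuous.measurable hE',
    Measure.map_apply (ContinuousMap.continuous _).measurable hE]
  congr 1
  ext z
  simp [mul_assoc]

variable [LocallyCompactSpace S]

/-- The integrand is known to be continuous only for `ν` in `L(S)`, so the functional is defined on
that subspace and extended by Hahn–Banach to `M(S)`, where weak continuity of orbits can be tested
against it. -/
theorem exists_functional_integral_translate (p : Measure S) [IsFiniteMeasure p]
    (F : StrongDual ℂ (RegMeasure S)) :
    ∃ G : StrongDual ℂ (RegMeasure S), ∀ ν ∈ semigroupAlgebra S,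
      G ν = ∫ x, F (pushforward (leftMul x) ν) ∂p := by
  have hbound : ∀ (ν : RegMeasure S) (x : S), ‖F (pushforward (leftMul x) ν)‖ ≤ ‖F‖ * ‖ν‖ :=
    fun ν x => (F.le_opNorm _).trans (by gcongr; exact norm_pushforward_le _ _)
  have hint : ∀ ν ∈ semigroupAlgebra S, Integrable (fun x => F (pushforward (leftMul x) ν)) p :=
    fun ν hν => Integrable.of_bound
      (continuous_pushforward_leftMul hν F).measurable.aestronglyMeasurable _
      (Filter.Eventually.of_forall (hbound ν))
  let G₀ : StrongDual ℂ (semigroupSubmodule S) := LinearMap.mkContinuous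
    { toFun := fun ν => ∫ x, F (pushforward (leftMul x) (ν : RegMeasure S)) ∂p
      map_add' := fun μ ν => by
        rw [← MeasureTheory.integral_add (hint μ μ.2) (hint ν ν.2)]
        simp only [← pushforwardCLM_apply, Submodule.coe_add, map_add]
      map_smul' := fun c ν => by
        simp only [← pushforwardCLM_apply, Submodule.coe_smul, map_smul]
        exact MeasureTheory.integral_smul _ _ } (‖F‖ * p.real Set.univ) (fun ν => by
        refine (norm_integral_le_of_norm_le_const
          (Filter.Eventually.of_forall (hbound (ν : RegMeasure S)))).trans (le_of_eq ?_)
        rw [Submodule.coe_norm]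
        ring)
  obtain ⟨G, hG, -⟩ := exists_extension_norm_eq (semigroupSubmodule S) G₀
  exact ⟨G, fun ν hν => hG ⟨ν, hν⟩⟩

/-- On the right, `F(p * q * δ_y) = G(q * δ_y)` with `G` the functional averaged over `p`, so
continuity comes from `q`. On the left, `F(δ_y * p * q)` is the integral of the bounded continuous
function `x ↦ F(δ_x * q)` against `δ_y * p`, so it comes from `p`. -/
theorem IsTranslationContinuous.conv (hp : IsTranslationContinuous p)
    (hq : IsTranslationContinuous q) [IsFiniteMeasure (conv p q)] [(conv p q).Regular] :
    IsTranslationContinuous (conv p q) := by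
  constructor
  · intro F
    obtain ⟨G, hG⟩ := exists_functional_integral_translate p F
    refine (hq.1 G).congr fun y => ?_
    have hqy := hq.map_rightMul y
    have := isFiniteMeasure_conv (p := p) hqy
    have := regular_conv (p := p) hqy
    rw [hG _ hqy.ofMeasure_mem, ofMeasure_congr (conv_map_rightMul hq y), functional_conv hqy]
    simp only [pushforward_ofMeasure]
  · intro F
    refine (hp.2 (integralCLM (fun x => F (ofMeasure (q.map (leftMul x)))) (hq.2 F).measurable _
      (norm_functional_map_leftMul_le F))).congr fun y => ?_
    have := isFiniteMeasure_conv (p := p.map (leftMul y)) hq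
    have := regular_conv (p := p.map (leftMul y)) hq
    rw [ofMeasure_congr (conv_map_leftMul hq y), functional_conv hq, integralCLM_apply,
      integral_ofMeasure (hq.2 F).measurable ⟨_, norm_functional_map_leftMul_le F⟩]

end Convolution

/-! ### The image of `L(S)` in the product of the algebras `B(H_π)` -/

section Instances

variable {S : Type u} [Monoid S] [StarMul S] [TopologicalSpace S]

set_option synthInstance.maxHeartbeats 200000

instance : Module ℂ (RepProduct S) := inferInstance

instance : SMul ℂ (RepProduct S) := inferInstance

instance : IsScalarTower ℂ (RepProduct S) (RepProduct S) := inferInstance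

instance : SMulCommClass ℂ (RepProduct S) (RepProduct S) := inferInstance

instance : StarModule ℂ (RepProduct S) := inferInstance

end Instances

section Integrated

variable {S : Type u} [Monoid S] [StarMul S] [TopologicalSpace S]

theorem StarRep.bounded_coeff (π : StarRep S) (ξ η : π.H) :
    ∃ C : ℝ, ∀ x, ‖⟪η, π.op x ξ⟫_ℂ‖ ≤ C := ⟨_, π.norm_coeff_le ξ η⟩

/-- The family `(π(x))_π` in the product of the algebras `B(H_π)`. -/
def translation (x : S) : RepProduct S :=
  ⟨fun π => π.op x, memℓp_infty ⟨1, by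
    rintro _ ⟨π, rfl⟩
    exact π.norm_le_one x⟩⟩

theorem translation_apply (x : S) (π : StarRep S) : (translation x : RepProduct S) π = π.op x := rfl

theorem repProduct_mul_apply (a b : RepProduct S) (π : StarRep S) : (a * b) π = a π * b π := rfl

theorem repProduct_star_apply (a : RepProduct S) (π : StarRep S) :
    (star a) π = ContinuousLinearMap.adjoint (a π) := rfl

theorem translation_mul (x y : S) :
    (translation (x * y) : RepProduct S) = translation x * translation y := by
  refine lp.ext (funext fun π => ?_)
  rw [repProduct_mul_apply, translation_apply, map_mul]
  rfl

theorem star_translation (x : S) :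
    star (translation x : RepProduct S) = translation (star x) := by
  refine lp.ext (funext fun π => ?_)
  rw [repProduct_star_apply, translation_apply, translation_apply, π.map_star]

theorem norm_translation_le (x : S) : ‖(translation x : RepProduct S)‖ ≤ 1 :=
  lp.norm_le_of_forall_le zero_le_one fun π => π.norm_le_one x

variable [T2Space S] [MeasurableSpace S] [BorelSpace S]

theorem StarRep.measurable_coeff (π : StarRep S) (ξ η : π.H) :
    Measurable fun x => ⟪η, π.op x ξ⟫_ℂ := (π.continuous_coeff ξ η).measurable

theorem StarRep.intOp_add (π : StarRep S) (μ ν : RegMeasure S) :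
    π.intOp (μ + ν) = π.intOp μ + π.intOp ν := by
  refine ContinuousLinearMap.ext fun ξ => ext_inner_left ℂ fun η => ?_
  rw [_root_.add_apply, inner_add_right, π.inner_intOp, π.inner_intOp, π.inner_intOp,
    integral_add_measure (π.measurable_coeff ξ η) (π.bounded_coeff ξ η)]

theorem StarRep.intOp_smul (π : StarRep S) (c : ℂ) (μ : RegMeasure S) :
    π.intOp (c • μ) = c • π.intOp μ := by
  refine ContinuousLinearMap.ext fun ξ => ext_inner_left ℂ fun η => ?_
  rw [_root_.smul_apply, inner_smul_right, π.inner_intOp, π.inner_intOp,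
    integral_smul_measure (π.measurable_coeff ξ η) (π.bounded_coeff ξ η)]

variable (S) in
/-- The map `μ ↦ (π̃(μ))_π`, as a bounded operator. -/
def sigmaCLM : RegMeasure S →L[ℂ] RepProduct S :=
  LinearMap.mkContinuous
    { toFun := sigmaRep
      map_add' := fun μ ν => lp.ext (funext fun π => π.intOp_add μ ν)
      map_smul' := fun c μ => lp.ext (funext fun π => π.intOp_smul c μ) } 1
    (fun μ => by
      rw [one_mul]
      exact lp.norm_le_of_forall_le (norm_nonneg μ) fun π => π.norm_intOp_le μ)

theorem sigmaCLM_apply (μ : RegMeasure S) : sigmaCLM S μ = sigmaRep μ := rfl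

theorem sigmaRep_apply (μ : RegMeasure S) (π : StarRep S) : sigmaRep μ π = π.intOp μ := rfl

variable [ContinuousMul S]

theorem StarRep.intOp_pushforward_leftMul (π : StarRep S) (x : S) (μ : RegMeasure S) :
    π.intOp (pushforward (leftMul x) μ) = π.op x * π.intOp μ := by
  refine ContinuousLinearMap.ext fun ξ => ext_inner_left ℂ fun η => ?_
  rw [π.inner_intOp, integral_pushforward _ (π.measurable_coeff ξ η) (π.bounded_coeff ξ η),
    mul_apply_eq_comp, ← ContinuousLinearMap.adjoint_inner_left, π.inner_intOp]
  congr 1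
  funext y
  rw [ContinuousLinearMap.adjoint_inner_left, ContinuousMap.coe_mk, map_mul,
    mul_apply_eq_comp]

theorem translation_mul_sigmaRep (x : S) (μ : RegMeasure S) :
    translation x * sigmaRep μ = sigmaRep (pushforward (leftMul x) μ) :=
  lp.ext (funext fun π => (π.intOp_pushforward_leftMul x μ).symm)

theorem sigmaRep_conv {p q : Measure S} [IsFiniteMeasure p] [p.Regular] [IsFiniteMeasure q]
    [q.Regular] (hq : IsTranslationContinuous q) [IsFiniteMeasure (conv p q)]
    [(conv p q).Regular] :
    sigmaRep (ofMeasure (conv p q)) = sigmaRep (ofMeasure p) * sigmaRep (ofMeasure q) := by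
  refine lp.ext (funext fun π => ?_)
  rw [repProduct_mul_apply, sigmaRep_apply, sigmaRep_apply, sigmaRep_apply]
  refine ContinuousLinearMap.ext fun ξ => ext_inner_left ℂ fun η => ?_
  rw [π.inner_intOp, integral_conv hq (π.measurable_coeff ξ η) (π.norm_coeff_le ξ η),
    mul_apply_eq_comp, π.inner_intOp,
    integral_ofMeasure (π.measurable_coeff _ η) (π.bounded_coeff _ η)]
  congr 1
  funext x
  rw [← π.inner_intOp, ← pushforward_ofMeasure, π.intOp_pushforward_leftMul]
  rfl

variable [ContinuousStar S]

theorem sigmaRep_map_star (p : Measure S) [IsFiniteMeasure p] [p.Regular] :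
    sigmaRep (ofMeasure (p.map (starMap S))) = star (sigmaRep (ofMeasure p)) := by
  refine lp.ext (funext fun π => ?_)
  rw [repProduct_star_apply, sigmaRep_apply, sigmaRep_apply]
  refine ContinuousLinearMap.ext fun ξ => ext_inner_left ℂ fun η => ?_
  rw [ContinuousLinearMap.adjoint_inner_right, π.inner_intOp, ← pushforward_ofMeasure,
    integral_pushforward _ (π.measurable_coeff ξ η) (π.bounded_coeff ξ η),
    ← inner_conj_symm, π.inner_intOp,
    integral_ofMeasure (π.measurable_coeff η ξ) (π.bounded_coeff η ξ), ← integral_conj,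
    integral_ofMeasure]
  · congr 1
    funext x
    rw [inner_conj_symm, ContinuousMap.coe_mk, π.map_star,
      ContinuousLinearMap.adjoint_inner_right]
  · exact ((π.continuous_coeff ξ η).comp continuous_star).measurable
  · exact ⟨_, fun x => π.norm_coeff_le ξ η _⟩

variable [LocallyCompactSpace S]

variable (S) in
/-- The image of `L(S)` in the product of the algebras `B(H_π)`. -/
def sigmaImage : Submodule ℂ (RepProduct S) :=
  (semigroupSubmodule S).map (sigmaCLM S : RegMeasure S →ₗ[ℂ] RepProduct S)

theorem sigmaRep_mem_sigmaImage {μ : RegMeasure S} (hμ : μ ∈ semigroupAlgebra S) :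
    sigmaRep μ ∈ sigmaImage S := ⟨μ, hμ, rfl⟩

/-- Elements of the image of `L(S)` are combinations of images of positive measures. -/
theorem exists_eq_sum_of_mem_sigmaImage {a : RepProduct S} (ha : a ∈ sigmaImage S) :
    ∃ (p : Fin 4 → Measure S) (_ : ∀ k, IsFiniteMeasure (p k)) (_ : ∀ k, (p k).Regular),
      (∀ k, IsTranslationContinuous (p k)) ∧
      a = ∑ k : Fin 4, Complex.I ^ (k : ℕ) • sigmaRep (ofMeasure (p k)) := by
  obtain ⟨μ, hμ, rfl⟩ := ha
  obtain ⟨p, hfin, hreg, hp, rfl⟩ := exists_eq_sum_of_mem hμ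
  refine ⟨p, hfin, hreg, hp, ?_⟩
  change sigmaCLM S _ = _
  rw [map_sum]
  simp only [map_smul, sigmaCLM_apply]

theorem mul_mem_sigmaImage {a b : RepProduct S} (ha : a ∈ sigmaImage S) (hb : b ∈ sigmaImage S) :
    a * b ∈ sigmaImage S := by
  obtain ⟨p, _, _, hp, rfl⟩ := exists_eq_sum_of_mem_sigmaImage ha
  obtain ⟨q, _, _, hq, rfl⟩ := exists_eq_sum_of_mem_sigmaImage hb
  rw [Finset.sum_mul]
  refine Submodule.sum_mem _ fun k _ => ?_
  rw [Finset.mul_sum]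
  refine Submodule.sum_mem _ fun l _ => ?_
  rw [smul_mul_assoc, mul_smul_comm]
  refine Submodule.smul_mem _ _ (Submodule.smul_mem _ _ ?_)
  have := isFiniteMeasure_conv (p := p k) (hq l)
  have := regular_conv (p := p k) (hq l)
  rw [← sigmaRep_conv (hq l)]
  exact sigmaRep_mem_sigmaImage ((hp k).conv (hq l)).ofMeasure_mem

theorem star_mem_sigmaImage {a : RepProduct S} (ha : a ∈ sigmaImage S) :
    star a ∈ sigmaImage S := by
  obtain ⟨p, _, _, hp, rfl⟩ := exists_eq_sum_of_mem_sigmaImage ha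
  rw [star_sum]
  refine Submodule.sum_mem _ fun k _ => ?_
  rw [star_smul]
  refine Submodule.smul_mem _ _ ?_
  rw [← sigmaRep_map_star]
  exact sigmaRep_mem_sigmaImage (hp k).map_star.ofMeasure_mem

variable (S) in
/-- The image of `L(S)` as a `*`-subalgebra. -/
def sigmaSubalgebra : NonUnitalStarSubalgebra ℂ (RepProduct S) where
  carrier := sigmaImage S
  zero_mem' := Submodule.zero_mem _
  add_mem' := Submodule.add_mem _
  smul_mem' c _ h := Submodule.smul_mem _ c h
  mul_mem' := mul_mem_sigmaImage
  star_mem' := star_mem_sigmaImage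

/-- The image of `L(S)` is already stable under product and involution, so generating a `*`-algebra
adds nothing before the closure is taken. -/
theorem cstarSubalgebra_subset_closure :
    (cstarSubalgebra S : Set (RepProduct S)) ⊆ closure (sigmaImage S : Set (RepProduct S)) := by
  have h : NonUnitalStarAlgebra.adjoin ℂ (sigmaRep '' semigroupAlgebra S) ≤ sigmaSubalgebra S := by
    rw [NonUnitalStarAlgebra.adjoin_le_iff]
    rintro _ ⟨μ, hμ, rfl⟩
    exact sigmaRep_mem_sigmaImage hμ
  exact closure_mono h

/-- The image of `L(S)` is dense in `C*(S)`. -/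
theorem denseRange_toCStar : DenseRange (toCStar : semigroupAlgebra S → SemigroupCStar S) := by
  intro a
  have h : (a.1 : RepProduct S) ∈ closure (sigmaImage S : Set (RepProduct S)) :=
    cstarSubalgebra_subset_closure a.2
  rw [Metric.mem_closure_iff] at h ⊢
  intro ε hε
  obtain ⟨_, ⟨μ, hμ, rfl⟩, hlt⟩ := h ε hε
  exact ⟨toCStar ⟨μ, hμ⟩, ⟨_, rfl⟩, hlt⟩

end Integrated

/-! ### The Gelfand–Naimark–Segal construction for `*`-semigroups -/

section GNS

universe v

variable {S : Type u} [Monoid S] [StarMul S]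

/-- A pointwise bounded `*`-representation of a `*`-semigroup on a semi-inner product space is
contractive. -/
theorem norm_map_le_of_bounded {V : Type v} [SeminormedAddCommGroup V] [InnerProductSpace ℂ V]
    (T : S → V →ₗ[ℂ] V) (hmul : ∀ x y v, T (x * y) v = T x (T y v))
    (hadj : ∀ x v w, ⟪T x v, w⟫_ℂ = ⟪v, T (star x) w⟫_ℂ)
    (hbdd : ∀ v, ∃ B : ℝ, ∀ x, ‖T x v‖ ≤ B) (x : S) (v : V) : ‖T x v‖ ≤ ‖v‖ := by
  obtain ⟨B, hB⟩ := hbdd v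
  have hba : BddAbove (Set.range fun y => ‖T y v‖) := ⟨B, by rintro _ ⟨y, rfl⟩; exact hB y⟩
  set M := ⨆ y, ‖T y v‖ with hM
  have hle : ∀ y, ‖T y v‖ ≤ M := fun y => le_ciSup hba y
  have hM0 : 0 ≤ M := (norm_nonneg _).trans (hle x)
  -- Since `‖T_y v‖² = ⟪v, T_{y*y} v⟫ ≤ ‖v‖ M`, the supremum `M` satisfies `M² ≤ ‖v‖ M`, so the mere
  -- finiteness of `M` forces `M ≤ ‖v‖`.
  have hsq : ∀ y, ‖T y v‖ ^ 2 ≤ ‖v‖ * M := fun y => by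
    have h1 : ⟪T y v, T y v⟫_ℂ = ⟪v, T (star y * y) v⟫_ℂ := by rw [hadj, hmul]
    have h2 : ‖⟪T y v, T y v⟫_ℂ‖ = ‖T y v‖ ^ 2 := by
      rw [inner_self_eq_norm_sq_to_K]; simp
    rw [← h2, h1]
    exact (norm_inner_le_norm _ _).trans (mul_le_mul_of_nonneg_left (hle _) (norm_nonneg v))
  have hMM : M ^ 2 ≤ ‖v‖ * M := by
    have : M ≤ √(‖v‖ * M) := by
      have : Nonempty S := ⟨x⟩
      exact ciSup_le fun y => Real.le_sqrt_of_sq_le (hsq y)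
    calc M ^ 2 ≤ √(‖v‖ * M) ^ 2 := by gcongr
      _ = ‖v‖ * M := Real.sq_sqrt (by positivity)
  refine (hle x).trans ?_
  rcases hM0.eq_or_lt with h0 | h0
  · rw [← h0]; exact norm_nonneg v
  · nlinarith

variable [TopologicalSpace S]

/-- A bounded, weakly continuous `*`-representation on a semi-inner product space extends to the
completion. -/
theorem exists_completion_rep {V : Type v} [SeminormedAddCommGroup V] [InnerProductSpace ℂ V]
    (T : S → V →ₗ[ℂ] V) (hmul : ∀ x y v, T (x * y) v = T x (T y v))
    (hadj : ∀ x v w, ⟪T x v, w⟫_ℂ = ⟪v, T (star x) w⟫_ℂ)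
    (hbdd : ∀ v, ∃ B : ℝ, ∀ x, ‖T x v‖ ≤ B)
    (hcont : ∀ v w, Continuous fun x => ⟪v, T x w⟫_ℂ) :
    ∃ op : S →ₙ* (UniformSpace.Completion V →L[ℂ] UniformSpace.Completion V),
      (∀ x, op (star x) = ContinuousLinearMap.adjoint (op x)) ∧ (∀ x, ‖op x‖ ≤ 1) ∧
      (∀ ξ η, Continuous fun x => ⟪η, op x ξ⟫_ℂ) ∧
      ∀ x (v : V), op x (v : UniformSpace.Completion V) = (T x v : V) := by
  have hle := norm_map_le_of_bounded T hmul hadj hbdd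
  let L : S → V →L[ℂ] V := fun x => (T x).mkContinuous 1 fun v => by simpa using hle x v
  have hL : ∀ x v, L x v = T x v := fun x v => rfl
  let op : S →ₙ* (UniformSpace.Completion V →L[ℂ] UniformSpace.Completion V) :=
    { toFun := fun x => (L x).completion
      map_mul' := fun x y => by
        ext c
        induction c using UniformSpace.Completion.induction_on with
        | hp => apply isClosed_eq <;> fun_prop
        | ih c => simp [hL, hmul] }
  have hop : ∀ x (v : V), op x (v : UniformSpace.Completion V) = (T x v : V) := fun x v => by
    simp [op, hL]
  have hnorm : ∀ x ξ, ‖op x ξ‖ ≤ ‖ξ‖ := fun x ξ => by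
    induction ξ using UniformSpace.Completion.induction_on with
    | hp => apply isClosed_le <;> fun_prop
    | ih v => rw [hop]; simpa using hle x v
  refine ⟨op, fun x => ?_, fun x => ?_, fun ξ η => ?_, hop⟩
  · refine (ContinuousLinearMap.eq_adjoint_iff _ _).mpr fun ξ η => ?_
    induction ξ, η using UniformSpace.Completion.induction_on₂ with
    | hp => apply isClosed_eq <;> fun_prop
    | ih v w =>
      rw [hop, hop, UniformSpace.Completion.inner_coe, UniformSpace.Completion.inner_coe, hadj,
        star_star]
  · exact ContinuousLinearMap.opNorm_le_bound _ zero_le_one fun ξ => by simpa using hnorm x ξ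
  · rw [continuous_iff_continuousAt]
    intro x₀
    rw [ContinuousAt, Metric.tendsto_nhds]
    intro ε hε
    have hd : DenseRange ((↑) : V → UniformSpace.Completion V) :=
      UniformSpace.Completion.denseRange_coe
    set δ : ℝ := ε / (4 * (1 + ‖ξ‖ + ‖η‖)) with hδ
    have hpos : 0 < 1 + ‖ξ‖ + ‖η‖ := by positivity
    have hδ0 : 0 < δ := by positivity
    obtain ⟨w, hw⟩ := hd.exists_dist_lt ξ hδ0
    obtain ⟨v, hv⟩ := hd.exists_dist_lt η (lt_min hδ0 one_pos)
    rw [dist_eq_norm] at hw hv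
    have hv1 : ‖(v : UniformSpace.Completion V)‖ ≤ ‖η‖ + 1 := by
      have := norm_sub_norm_le (v : UniformSpace.Completion V) η
      rw [norm_sub_rev] at this
      linarith [hv.trans_le (min_le_right _ _)]
    -- The approximation of the coefficient by one with vectors from `V` is uniform in `x` because
    -- the operators are contractions. Three errors of size `ε/4` then leave room below `ε`.
    have hkey : ∀ x, ‖⟪η, op x ξ⟫_ℂ - ⟪v, T x w⟫_ℂ‖ ≤ ε / 4 := fun x => by
      have h1 : ⟪η, op x ξ⟫_ℂ - ⟪v, T x w⟫_ℂ
          = ⟪η - v, op x ξ⟫_ℂ + ⟪(v : UniformSpace.Completion V), op x (ξ - w)⟫_ℂ := by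
        rw [map_sub, inner_sub_left, inner_sub_right, hop, UniformSpace.Completion.inner_coe]
        ring
      rw [h1]
      calc _ ≤ ‖η - v‖ * ‖ξ‖ + (‖η‖ + 1) * ‖ξ - w‖ := by
            refine (norm_add_le _ _).trans (add_le_add ?_ ?_)
            · exact (norm_inner_le_norm _ _).trans
                (mul_le_mul_of_nonneg_left (hnorm _ _) (norm_nonneg _))
            · exact (norm_inner_le_norm _ _).trans
                (mul_le_mul hv1 (hnorm _ _) (norm_nonneg _) (by positivity))
        _ ≤ δ * ‖ξ‖ + (‖η‖ + 1) * δ := by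
            gcongr
            exact (hv.trans_le (min_le_left _ _)).le
        _ = ε / 4 := by rw [hδ]; field_simp; ring
    have h2 := (Metric.tendsto_nhds.mp ((hcont v w).continuousAt (x := x₀))) (ε / 4) (by positivity)
    filter_upwards [h2] with x hx
    rw [dist_eq_norm] at hx ⊢
    have h3 : ⟪η, op x ξ⟫_ℂ - ⟪η, op x₀ ξ⟫_ℂ = (⟪η, op x ξ⟫_ℂ - ⟪v, T x w⟫_ℂ)
        + (⟪v, T x w⟫_ℂ - ⟪v, T x₀ w⟫_ℂ) - (⟪η, op x₀ ξ⟫_ℂ - ⟪v, T x₀ w⟫_ℂ) := by ring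
    rw [h3]
    have h4 := norm_sub_le ((⟪η, op x ξ⟫_ℂ - ⟪v, T x w⟫_ℂ)
        + (⟪v, T x w⟫_ℂ - ⟪v, T x₀ w⟫_ℂ)) (⟪η, op x₀ ξ⟫_ℂ - ⟪v, T x₀ w⟫_ℂ)
    have h5 := norm_add_le (⟪η, op x ξ⟫_ℂ - ⟪v, T x w⟫_ℂ) (⟪v, T x w⟫_ℂ - ⟪v, T x₀ w⟫_ℂ)
    linarith [hkey x, hkey x₀]

/-- The Gelfand–Naimark–Segal construction for a semi-inner product given by its core. -/
theorem exists_gns {V : Type v} [AddCommGroup V] [Module ℂ V] (c : PreInnerProductSpace.Core ℂ V)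
    (T : S → V →ₗ[ℂ] V) (hmul : ∀ x y v, T (x * y) v = T x (T y v))
    (hadj : ∀ x v w, c.inner (T x v) w = c.inner v (T (star x) w))
    (hbdd : ∀ v, ∃ B : ℝ, ∀ x, (c.inner (T x v) (T x v)).re ≤ B)
    (hcont : ∀ v w, Continuous fun x => c.inner v (T x w)) :
    ∃ (H : Type v) (_ : NormedAddCommGroup H) (_ : InnerProductSpace ℂ H) (_ : CompleteSpace H)
      (ι : V →ₗ[ℂ] H) (op : S →ₙ* (H →L[ℂ] H)), DenseRange ι ∧
      (∀ v w, ⟪ι v, ι w⟫_ℂ = c.inner v w) ∧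
      (∀ x, op (star x) = ContinuousLinearMap.adjoint (op x)) ∧ (∀ x, ‖op x‖ ≤ 1) ∧
      (∀ ξ η, Continuous fun x => ⟪η, op x ξ⟫_ℂ) ∧ ∀ x v, op x (ι v) = ι (T x v) := by
  let _ : SeminormedAddCommGroup V := InnerProductSpace.Core.toSeminormedAddCommGroup (c := c)
  let _ : InnerProductSpace ℂ V := InnerProductSpace.ofCore c
  obtain ⟨op, h1, h2, h3, h4⟩ := exists_completion_rep T hmul hadj (fun v => by
    obtain ⟨B, hB⟩ := hbdd v
    refine ⟨√B, fun x => Real.le_sqrt_of_sq_le ?_⟩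
    rw [InnerProductSpace.norm_sq_eq_re_inner (𝕜 := ℂ)]
    exact hB x) hcont
  exact ⟨UniformSpace.Completion V, inferInstance, inferInstance, inferInstance,
    (UniformSpace.Completion.toComplL : V →L[ℂ] UniformSpace.Completion V).toLinearMap, op,
    UniformSpace.Completion.denseRange_coe, fun v w => UniformSpace.Completion.inner_coe v w,
    h1, h2, h3, h4⟩

end GNS

/-! ### Positive definite functions as coefficients of representations -/

section PosDef

variable {S : Type u} [Monoid S] [StarMul S]

theorem IsPosDef.sum_nonneg {u : S → ℂ} (hu : IsPosDef u) {ι : Type*} [Fintype ι] (c : ι → ℂ)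
    (x : ι → S) : 0 ≤ ∑ i, ∑ j, c i * conj (c j) * u (x i * star (x j)) := by
  have e := (Fintype.equivFin ι).symm
  have h := hu _ (c ∘ e) (x ∘ e)
  simp only [Function.comp_apply] at h
  rwa [e.sum_comp (fun i => ∑ j, c i * conj (c (e j)) * u (x i * star (x (e j)))),
    Finset.sum_congr rfl fun i _ => e.sum_comp (fun j => c i * conj (c j) * u (x i * star (x j)))]
    at h

/-- Testing at the points `x` and `1`, the coefficients `(1, 1)` force `u x + u (star x)` to be real
and `(i, 1)` force `i (u x - u (star x))` to be real. -/
theorem IsPosDef.map_star {u : S → ℂ} (hu : IsPosDef u) (x : S) : u (star x) = conj (u x) := by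
  have h0 := hu 1 ![1] ![x]
  have h1 := hu 1 ![1] ![1]
  have h2 := hu 2 ![1, 1] ![x, 1]
  have h3 := hu 2 ![Complex.I, 1] ![x, 1]
  simp [Fin.sum_univ_two, Complex.le_def] at h0 h1 h2 h3
  apply Complex.ext
  · simp; linarith
  · simp; linarith

/-- The semi-inner product `⟨f, g⟩ = ∑ conj (f s) g(t) u(s*t)` on finitely supported functions
which is given by a positive definite function `u`. -/
def posDefForm (u : S → ℂ) (f g : S →₀ ℂ) : ℂ :=
  f.sum fun s a => conj a * Finsupp.linearCombination ℂ (fun t => u (star s * t)) g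

theorem posDefForm_eq_sum (u : S → ℂ) (f g : S →₀ ℂ) :
    posDefForm u f g
      = ∑ s ∈ f.support, ∑ t ∈ g.support, conj (f s) * g t * u (star s * t) := by
  simp only [posDefForm, Finsupp.sum, Finsupp.linearCombination_apply, Finset.mul_sum, smul_eq_mul,
    mul_assoc]

theorem IsPosDef.conj_posDefForm {u : S → ℂ} (hu : IsPosDef u) (f g : S →₀ ℂ) :
    conj (posDefForm u g f) = posDefForm u f g := by
  rw [posDefForm_eq_sum, posDefForm_eq_sum, map_sum]
  simp only [map_sum]
  rw [Finset.sum_comm]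
  refine Finset.sum_congr rfl fun s _ => Finset.sum_congr rfl fun t _ => ?_
  rw [map_mul, map_mul, ← hu.map_star, star_mul, star_star, Complex.conj_conj]
  ring

theorem IsPosDef.posDefForm_self_nonneg {u : S → ℂ} (hu : IsPosDef u) (f : S →₀ ℂ) :
    0 ≤ posDefForm u f f := by
  -- Positive definiteness is phrased with `x_i x_j*` and the form with `s* t`, so the points are
  -- the `star s` and the coefficients are conjugated.
  have h := hu.sum_nonneg (fun s : f.support => conj (f s)) (fun s : f.support => star (s : S))
  rw [posDefForm_eq_sum, ← Finset.sum_coe_sort f.support]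
  refine h.trans_eq (Finset.sum_congr rfl fun s _ => ?_)
  rw [← Finset.sum_coe_sort f.support]
  simp

/-- The core of the semi-inner product space given by a positive definite function. -/
@[reducible] def IsPosDef.core {u : S → ℂ} (hu : IsPosDef u) :
    PreInnerProductSpace.Core ℂ (S →₀ ℂ) where
  inner := posDefForm u
  conj_inner_symm := hu.conj_posDefForm
  re_inner_nonneg f := (Complex.le_def.mp (hu.posDefForm_self_nonneg f)).1
  add_left f g h := by
    refine Finsupp.sum_add_index' (fun s => by simp) fun s a b => ?_
    rw [map_add, add_mul]
  smul_left f g c := by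
    change Finsupp.sum _ _ = _ * Finsupp.sum _ _
    rw [Finsupp.sum_smul_index (fun s => by simp), Finsupp.mul_sum]
    simp only [map_mul, mul_assoc]

theorem posDefForm_mapDomain_left (u : S → ℂ) (x : S) (f g : S →₀ ℂ) :
    posDefForm u (f.mapDomain (x * ·)) g = posDefForm u f (g.mapDomain (star x * ·)) := by
  rw [posDefForm, Finsupp.sum_mapDomain_index (fun s => by simp)
    (fun s a b => by rw [map_add, add_mul]), posDefForm]
  simp only [Finsupp.linearCombination_mapDomain, star_mul, Function.comp_def, mul_assoc]

theorem posDefForm_mapDomain_right (u : S → ℂ) (x : S) (f g : S →₀ ℂ) :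
    posDefForm u f (g.mapDomain (x * ·))
      = ∑ s ∈ f.support, conj (f s) * ∑ t ∈ g.support, g t * u (star s * (x * t)) := by
  simp only [posDefForm, Finsupp.linearCombination_mapDomain]
  simp only [Finsupp.sum, Finsupp.linearCombination_apply, Function.comp_def, smul_eq_mul]

variable [TopologicalSpace S] [ContinuousMul S]

/-- Every bounded continuous positive definite function is a coefficient of a representation. -/
theorem exists_starRep_of_mem_posDefFunctions {u : S → ℂ} (hu : u ∈ posDefFunctions S) :
    ∃ (π : StarRep S) (ξ : π.H), ∀ x, u x = ⟪ξ, π.op x ξ⟫_ℂ := by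
  obtain ⟨hcont, ⟨C, hC⟩, hpos⟩ := hu
  obtain ⟨H, _, _, _, ι, op, -, hι, hstar, hnorm, hc, hop⟩ := exists_gns hpos.core
    (fun x => Finsupp.lmapDomain ℂ ℂ (x * ·))
    (fun x y v => by
      simp only [Finsupp.lmapDomain_apply, ← Finsupp.mapDomain_comp, Function.comp_def, mul_assoc])
    (fun x v w => posDefForm_mapDomain_left u x v w)
    -- Since `⟨T_x v, T_x v⟩ = ⟨v, T_{x*x} v⟩` is a fixed finite combination of values of `u`, the
    -- bound on `u` makes the orbits bounded.
    (fun v => by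
      refine ⟨∑ s ∈ v.support, ‖v s‖ * ∑ t ∈ v.support, ‖v t‖ * C, fun x => ?_⟩
      refine (Complex.re_le_norm _).trans ?_
      change ‖posDefForm u (v.mapDomain (x * ·)) (v.mapDomain (x * ·))‖ ≤ _
      rw [posDefForm_mapDomain_left, ← Finsupp.mapDomain_comp]
      have h : (fun y => star x * y) ∘ (fun y => x * y) = fun y => (star x * x) * y := by
        funext y; simp [mul_assoc]
      rw [h, posDefForm_mapDomain_right]
      refine (norm_sum_le _ _).trans (Finset.sum_le_sum fun s _ => ?_)
      rw [norm_mul, RCLike.norm_conj]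
      gcongr
      refine (norm_sum_le _ _).trans (Finset.sum_le_sum fun t _ => ?_)
      rw [norm_mul]
      gcongr
      exact hC _)
    (fun v w => by
      change Continuous fun x => posDefForm u v (w.mapDomain (x * ·))
      simp only [posDefForm_mapDomain_right]
      refine continuous_finsetSum _ fun s _ => continuous_const.mul
        (continuous_finsetSum _ fun t _ => continuous_const.mul (hcont.comp ?_))
      fun_prop)
  -- The vector is the point mass at the identity: `⟨δ_1, δ_x⟩ = u x`.
  refine ⟨⟨H, op, hstar, hnorm, fun ξ η => hc ξ η⟩, ι (Finsupp.single 1 1), fun x => ?_⟩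
  change u x = ⟪ι (Finsupp.single 1 1), op x (ι (Finsupp.single 1 1))⟫_ℂ
  rw [hop, hι]
  change u x = posDefForm u (Finsupp.single 1 1) (Finsupp.lmapDomain ℂ ℂ (x * ·) (Finsupp.single 1 1))
  rw [Finsupp.lmapDomain_apply, Finsupp.mapDomain_single]
  simp [posDefForm]

/-- Diagonal coefficients of bounded weakly continuous `*`-representations are positive
definite. -/
theorem coeff_mem_posDefFunctions {H : Type*} [NormedAddCommGroup H] [InnerProductSpace ℂ H]
    [CompleteSpace H] (op : S →ₙ* (H →L[ℂ] H))
    (hstar : ∀ x, op (star x) = ContinuousLinearMap.adjoint (op x)) (hnorm : ∀ x, ‖op x‖ ≤ 1)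
    (hcont : ∀ ξ η, Continuous fun x => ⟪η, op x ξ⟫_ℂ) (ξ : H) :
    (fun x => ⟪ξ, op x ξ⟫_ℂ) ∈ posDefFunctions S := by
  refine ⟨hcont ξ ξ, ⟨‖ξ‖ * ‖ξ‖, fun x => ?_⟩, fun n c x => ?_⟩
  · refine (norm_inner_le_norm _ _).trans ?_
    gcongr
    simpa using (op x).le_of_opNorm_le (hnorm x) ξ
  · have h : ∑ i, ∑ j, c i * conj (c j) * ⟪ξ, op (x i * star (x j)) ξ⟫_ℂ
        = ⟪∑ i, conj (c i) • op (star (x i)) ξ, ∑ j, conj (c j) • op (star (x j)) ξ⟫_ℂ := by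
      rw [sum_inner]
      refine Finset.sum_congr rfl fun i _ => ?_
      rw [inner_sum]
      refine Finset.sum_congr rfl fun j _ => ?_
      rw [inner_smul_left, inner_smul_right, Complex.conj_conj, map_mul, mul_apply_eq_comp,
        hstar (x i), ContinuousLinearMap.adjoint_inner_left, mul_assoc]
    rw [h, inner_self_eq_norm_sq_to_K]
    positivity

end PosDef

/-! ### The pairing of `B(S)` and `C*(S)` -/

section Pairing

variable {S : Type u} [Monoid S] [StarMul S] [TopologicalSpace S]

theorem continuous_and_bounded_of_mem {u : S → ℂ} (hu : u ∈ fourierStieltjes S) :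
    Continuous u ∧ ∃ C : ℝ, ∀ x, ‖u x‖ ≤ C := by
  refine Submodule.span_induction (p := fun u _ => Continuous u ∧ ∃ C : ℝ, ∀ x, ‖u x‖ ≤ C)
    ?_ ?_ ?_ ?_ hu
  · exact fun u hu => ⟨hu.1, hu.2.1⟩
  · exact ⟨continuous_const, 0, fun x => by simp⟩
  · rintro u v _ _ ⟨hu, C, hC⟩ ⟨hv, D, hD⟩
    exact ⟨hu.add hv, C + D, fun x => (norm_add_le _ _).trans (add_le_add (hC x) (hD x))⟩
  · rintro c u _ ⟨hu, C, hC⟩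
    refine ⟨hu.const_smul c, ‖c‖ * C, fun x => ?_⟩
    rw [Pi.smul_apply, norm_smul]
    gcongr
    exact hC x

variable [T2Space S] [ContinuousMul S] [MeasurableSpace S] [BorelSpace S]

/-- The vector functional `a ↦ ⟨a_π ξ, η⟩` on `C*(S)`. -/
def coeffDual (π : StarRep S) (η ξ : π.H) : StrongDual ℂ (SemigroupCStar S) :=
  LinearMap.mkContinuous
    { toFun := fun a => ⟪η, (a.1 : RepProduct S) π ξ⟫_ℂ
      map_add' := fun a b => inner_add_right _ _ _
      map_smul' := fun c a => inner_smul_right _ _ _ } (‖η‖ * ‖ξ‖)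
    (fun a => by
      refine (norm_inner_le_norm _ _).trans ?_
      have h1 : ‖(a.1 : RepProduct S) π ξ‖ ≤ ‖a‖ * ‖ξ‖ :=
        ((a.1 : RepProduct S) π).le_of_opNorm_le (lp.norm_apply_le_norm ENNReal.top_ne_zero a.1 π) ξ
      calc _ ≤ ‖η‖ * (‖a‖ * ‖ξ‖) := mul_le_mul_of_nonneg_left h1 (norm_nonneg η)
        _ = _ := by ring)

theorem coeffDual_apply (π : StarRep S) (η ξ : π.H) (a : SemigroupCStar S) :
    coeffDual π η ξ a = ⟪η, (a.1 : RepProduct S) π ξ⟫_ℂ := rfl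

theorem coeffDual_toCStar (π : StarRep S) (η ξ : π.H) (μ : semigroupAlgebra S) :
    coeffDual π η ξ (toCStar μ) = integral (fun x => ⟪η, π.op x ξ⟫_ℂ) (μ : RegMeasure S) :=
  π.inner_intOp _ ξ η

theorem exists_dual_of_mem {u : S → ℂ} (hu : u ∈ fourierStieltjes S) :
    ∃ f : StrongDual ℂ (SemigroupCStar S),
      ∀ μ : semigroupAlgebra S, f (toCStar μ) = integral u (μ : RegMeasure S) := by
  refine Submodule.span_induction (p := fun u _ => ∃ f : StrongDual ℂ (SemigroupCStar S),
      ∀ μ : semigroupAlgebra S, f (toCStar μ) = integral u (μ : RegMeasure S))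
    ?_ ?_ ?_ ?_ hu
  · intro u hu
    obtain ⟨π, ξ, h⟩ := exists_starRep_of_mem_posDefFunctions hu
    refine ⟨coeffDual π ξ ξ, fun μ => ?_⟩
    rw [coeffDual_toCStar]
    exact congrArg (fun v => integral v (μ : RegMeasure S)) (funext fun x => (h x).symm)
  · refine ⟨0, fun μ => ?_⟩
    have h := norm_integral_le (f := (0 : S → ℂ)) (C := 0) (fun x => by simp) (μ : RegMeasure S)
    rw [zero_mul, norm_le_zero_iff] at h
    exact h.symm
  · rintro u v hu hv ⟨f, hf⟩ ⟨g, hg⟩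
    obtain ⟨hu, hCu⟩ := continuous_and_bounded_of_mem hu
    obtain ⟨hv, hCv⟩ := continuous_and_bounded_of_mem hv
    refine ⟨f + g, fun μ => ?_⟩
    rw [_root_.add_apply, hf, hg, integral_add hu.measurable hv.measurable hCu hCv]
  · rintro c u _ ⟨f, hf⟩
    refine ⟨c • f, fun μ => ?_⟩
    rw [_root_.smul_apply, hf, smul_eq_mul, ← integral_const_mul]
    rfl

variable [ContinuousStar S] [LocallyCompactSpace S]

/-- Functionals on `C*(S)` are determined by their values on `L(S)`. -/
theorem dual_ext {f g : StrongDual ℂ (SemigroupCStar S)}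
    (h : ∀ μ : semigroupAlgebra S, f (toCStar μ) = g (toCStar μ)) : f = g := by
  refine ContinuousLinearMap.ext fun a => ?_
  exact congrFun (denseRange_toCStar.equalizer f.continuous g.continuous (funext h)) a

theorem exists_toCStar_eq_smul (c : ℂ) (μ : semigroupAlgebra S) :
    ∃ ν : semigroupAlgebra S, toCStar ν = c • toCStar μ :=
  ⟨⟨c • (μ : RegMeasure S), (semigroupSubmodule S).smul_mem c μ.2⟩,
    Subtype.ext (map_smul (sigmaCLM S) _ _)⟩

/-- A functional which represents `u` on `L(S)` has norm `‖u‖`. -/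
theorem norm_eq_fsNorm {u : S → ℂ} {f : StrongDual ℂ (SemigroupCStar S)}
    (h : ∀ μ : semigroupAlgebra S, f (toCStar μ) = integral u (μ : RegMeasure S)) :
    BddAbove (pairingValues u) ∧ ‖f‖ = fsNorm u := by
  have hub : ∀ r ∈ pairingValues u, r ≤ ‖f‖ := by
    rintro r ⟨μ, hμ, hle, rfl⟩
    rw [← h ⟨μ, hμ⟩]
    refine (f.le_opNorm _).trans ?_
    rw [norm_toCStar]
    exact mul_le_of_le_one_right (norm_nonneg f) hle
  have hbdd : BddAbove (pairingValues u) := ⟨_, hub⟩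
  have hzero : (0 : ℝ) ∈ pairingValues u := by
    refine ⟨0, (semigroupSubmodule S).zero_mem, ?_, ?_⟩
    · rw [← norm_sigmaRep, ← sigmaCLM_apply, map_zero, norm_zero]
      exact zero_le_one
    · have h0 := h ⟨0, (semigroupSubmodule S).zero_mem⟩
      have h1 : toCStar (⟨0, (semigroupSubmodule S).zero_mem⟩ : semigroupAlgebra S) = 0 :=
        Subtype.ext (map_zero (sigmaCLM S))
      rw [h1, map_zero] at h0
      rw [← h0, norm_zero]
  refine ⟨hbdd, le_antisymm ?_ (csSup_le ⟨0, hzero⟩ hub)⟩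
  have h0 : 0 ≤ fsNorm u := le_csSup hbdd hzero
  refine f.opNorm_le_bound h0 fun a => ?_
  refine denseRange_toCStar.induction_on (p := fun a => ‖f a‖ ≤ fsNorm u * ‖a‖) a
    (isClosed_le (by fun_prop) (by fun_prop)) fun μ => ?_
  refine le_of_forall_pos_le_add fun ε hε => ?_
  set D : ℝ := ‖toCStar μ‖ with hD
  have hD0 : 0 ≤ D := norm_nonneg _
  -- Scaling by `D + δ` instead of `D` allows for `D = 0`; this `δ` keeps the excess `fsNorm u * δ`
  -- below `ε`.
  set δ : ℝ := ε / (fsNorm u + 1) with hδ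
  have hδ0 : 0 < δ := by positivity
  have hDδ : 0 < D + δ := by positivity
  have hinv : ‖(((D + δ)⁻¹ : ℝ) : ℂ)‖ = (D + δ)⁻¹ := by
    rw [Complex.norm_real, Real.norm_of_nonneg (inv_nonneg.2 hDδ.le)]
  obtain ⟨ν, hν⟩ := exists_toCStar_eq_smul (((D + δ)⁻¹ : ℝ) : ℂ) μ
  have hle : ‖f (toCStar ν)‖ ≤ fsNorm u := by
    refine le_csSup hbdd ⟨ν, ν.2, ?_, by rw [h]⟩
    rw [← norm_toCStar ν, hν, norm_smul, hinv, inv_mul_le_one₀ hDδ]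
    linarith
  rw [hν, map_smul, norm_smul, hinv, inv_mul_le_iff₀ hDδ] at hle
  refine hle.trans ?_
  have : fsNorm u * δ ≤ ε := by
    rw [hδ, mul_div_assoc', div_le_iff₀ (by positivity)]
    nlinarith
  nlinarith

/-- If `S` is foundation, a bounded continuous function is determined by its integrals against
`L(S)`. -/
theorem eq_zero_of_integral_eq_zero (hfound : IsFoundation S) {u : S → ℂ} (hu : Continuous u)
    (hC : ∃ C : ℝ, ∀ x, ‖u x‖ ≤ C) (h : ∀ μ ∈ semigroupAlgebra S, integral u μ = 0) : u = 0 := by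
  have hclosed : IsClosed {x | u x = 0} := isClosed_eq hu continuous_const
  have hsub : (⋃ μ ∈ semigroupAlgebra S, (μ : ComplexMeasure S).variation.support)
      ⊆ {x | u x = 0} := by
    refine Set.iUnion₂_subset fun μ hμ x hx => ?_
    have hp := mem_semigroupAlgebra_iff.1 hμ
    set p := (μ : ComplexMeasure S).variation
    have : p.Regular := μ.2
    have hint : Integrable u p := by
      obtain ⟨C, hC⟩ := hC
      exact Integrable.of_bound hu.measurable.aestronglyMeasurable C
        (Filter.Eventually.of_forall hC)
    -- Every restriction of `|μ|` again belongs to `L(S)`, so `u` integrates to zero over all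
    -- measurable sets. By continuity it then vanishes on the support.
    have hae : u =ᵐ[p] 0 := by
      refine hint.ae_eq_zero_of_forall_setIntegral_eq_zero fun E hE _ => ?_
      have : (p.restrict E).Regular := regular_of_le (ν := p) Measure.restrict_le_self
      rw [← integral_ofMeasure hu.measurable hC]
      exact h _ (hp.of_le Measure.restrict_le_self).ofMeasure_mem
    by_contra hne
    have hU : {y | u y = 0}ᶜ ∈ 𝓝 x := hclosed.isOpen_compl.mem_nhds hne
    exact ((Measure.mem_support_iff_forall x).1 hx _ hU).ne' hae
  funext x
  have hx : x ∈ closure {x | u x = 0} := closure_mono hsub (hfound x)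
  rw [hclosed.closure_eq] at hx
  simpa using hx

end Pairing

/-! ### Decomposition of functionals on `C*(S)` into positive ones -/

section WeakStar

variable {E : Type*} [NormedAddCommGroup E] [NormedSpace ℂ E]

/-- A weak* compact convex set of functionals is determined by its support function. -/
theorem mem_of_forall_re_le {K : Set (WeakDual ℂ E)} (hK : IsCompact K) (hconv : Convex ℝ K)
    {f : WeakDual ℂ E} (h : ∀ a (r : ℝ), (∀ g ∈ K, (g a).re ≤ r) → (f a).re ≤ r) : f ∈ K := by
  by_contra hf
  have : IsScalarTower ℝ ℂ (WeakDual ℂ E) := 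
    ⟨fun r c g => DFunLike.ext _ _ fun a => smul_assoc r c (g a)⟩
  have hlc : LocallyConvexSpace ℝ (WeakDual ℂ E) :=
    (topDualPairing ℂ E).weakBilin_withSeminorms.toLocallyConvexSpace
  -- A separating weak*-continuous functional is evaluation at some `a`, so the separation
  -- contradicts the assumed inequality at that `a`.
  obtain ⟨F, r, hlt, hgt⟩ := @RCLike.geometric_hahn_banach_closed_point ℂ (WeakDual ℂ E) _ _ _ K f _ _ _ _ _
    hlc hconv hK.isClosed hf
  obtain ⟨a, rfl⟩ := LinearMap.dualEmbedding_surjective (topDualPairing ℂ E) F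
  exact absurd (h a r fun g hg => (hlt g hg).le) (not_le.2 hgt)

end WeakStar

/-! ### Quasi-states and their combinations with phases `i^k` -/

section QuasiStates

variable (A : Type*) [NonUnitalNormedRing A] [StarRing A] [NormedSpace ℂ A]

/-- The positive functionals `φ` of norm at most one, with the Cauchy–Schwarz inequality
`|φ(a)|² ≤ φ(a*a)`. -/
def quasiStates : Set (WeakDual ℂ A) :=
  {φ | ∀ a, 0 ≤ φ (star a * a) ∧ φ (star a) = conj (φ a) ∧ ‖φ a‖ ^ 2 ≤ (φ (star a * a)).re ∧
    ‖φ a‖ ≤ ‖a‖}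

variable {A}

theorem mem_quasiStates {φ : WeakDual ℂ A} : φ ∈ quasiStates A ↔
    ∀ a, 0 ≤ φ (star a * a) ∧ φ (star a) = conj (φ a) ∧ ‖φ a‖ ^ 2 ≤ (φ (star a * a)).re ∧
      ‖φ a‖ ≤ ‖a‖ := by
  simp [quasiStates]

/-- Each defining condition involves only point evaluations and is closed, and the last one confines
the set to the unit ball, which is weak*-compact by Banach–Alaoglu. -/
theorem isCompact_quasiStates : IsCompact (quasiStates A) := by
  refine (WeakDual.isCompact_closedBall (𝕜 := ℂ) (E := A) 0 1).of_isClosed_subset ?_ ?_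
  · have h : quasiStates A = ⋂ a, {φ : WeakDual ℂ A | 0 ≤ φ (star a * a) ∧
        φ (star a) = conj (φ a) ∧ ‖φ a‖ ^ 2 ≤ (φ (star a * a)).re ∧ ‖φ a‖ ≤ ‖a‖} := by
      ext φ; simp [mem_quasiStates]
    rw [h]
    have hc : ∀ b : A, Continuous fun φ : WeakDual ℂ A => φ b := WeakDual.eval_continuous
    refine isClosed_iInter fun a => ?_
    refine (isClosed_le continuous_const (hc _)).inter ((isClosed_eq (hc _)
      (Complex.continuous_conj.comp (hc a))).inter ((isClosed_le ((hc a).norm.pow 2)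
      (Complex.continuous_re.comp (hc _))).inter (isClosed_le (hc a).norm continuous_const)))
  · intro φ hφ
    rw [Set.mem_preimage, mem_closedBall_zero_iff]
    refine ContinuousLinearMap.opNorm_le_bound _ zero_le_one fun a => ?_
    rw [one_mul]
    exact (mem_quasiStates.1 hφ a).2.2.2

/-- The only nonlinear point is the Cauchy–Schwarz condition, which is preserved because the square
is convex. -/
theorem convex_quasiStates : Convex ℝ (quasiStates A) := by
  intro φ hφ ψ hψ s t hs ht hst
  rw [mem_quasiStates] at *
  intro a
  obtain ⟨h1, h2, h3, h4⟩ := hφ a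
  obtain ⟨k1, k2, k3, k4⟩ := hψ a
  have happ : ∀ b, (s • φ + t • ψ) b = (s : ℂ) * φ b + (t : ℂ) * ψ b := fun b => rfl
  have hnorm : ‖(s : ℂ) * φ a + (t : ℂ) * ψ a‖ ≤ s * ‖φ a‖ + t * ‖ψ a‖ := by
    refine (norm_add_le _ _).trans (le_of_eq ?_)
    rw [norm_mul, norm_mul, Complex.norm_real, Complex.norm_real, Real.norm_of_nonneg hs,
      Real.norm_of_nonneg ht]
  simp only [happ]
  refine ⟨?_, ?_, ?_, ?_⟩
  · have hs' : (0 : ℂ) ≤ s := by exact_mod_cast hs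
    have ht' : (0 : ℂ) ≤ t := by exact_mod_cast ht
    exact add_nonneg (mul_nonneg hs' h1) (mul_nonneg ht' k1)
  · rw [h2, k2]; simp
  · have h5 : ((s : ℂ) * φ (star a * a) + (t : ℂ) * ψ (star a * a)).re
        = s * (φ (star a * a)).re + t * (ψ (star a * a)).re := by simp
    rw [h5]
    calc ‖(s : ℂ) * φ a + (t : ℂ) * ψ a‖ ^ 2 ≤ (s * ‖φ a‖ + t * ‖ψ a‖) ^ 2 := by gcongr
      _ ≤ s * ‖φ a‖ ^ 2 + t * ‖ψ a‖ ^ 2 := by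
        have : s * ‖φ a‖ ^ 2 + t * ‖ψ a‖ ^ 2 - (s * ‖φ a‖ + t * ‖ψ a‖) ^ 2
            = s * t * (‖φ a‖ - ‖ψ a‖) ^ 2 := by
          have : t = 1 - s := by linarith
          subst this; ring
        have : 0 ≤ s * t * (‖φ a‖ - ‖ψ a‖) ^ 2 := by positivity
        linarith
      _ ≤ _ := by gcongr
  · calc _ ≤ s * ‖φ a‖ + t * ‖ψ a‖ := hnorm
      _ ≤ s * ‖a‖ + t * ‖a‖ := by gcongr
      _ = ‖a‖ := by rw [← add_mul, hst, one_mul]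

variable (A) in
/-- The map `(φ_k) ↦ ∑ i^k φ_k`. -/
def phaseSum : (Fin 4 → WeakDual ℂ A) →L[ℂ] WeakDual ℂ A :=
  ∑ k : Fin 4, Complex.I ^ (k : ℕ) • ContinuousLinearMap.proj k

theorem phaseSum_apply (φ : Fin 4 → WeakDual ℂ A) (a : A) :
    phaseSum A φ a = ∑ k : Fin 4, Complex.I ^ (k : ℕ) * φ k a := by
  have h : phaseSum A φ = ∑ k : Fin 4, Complex.I ^ (k : ℕ) • φ k := by
    simp [phaseSum]
  rw [h, Fin.sum_univ_four, Fin.sum_univ_four]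
  rfl

variable (A) in
/-- The functionals `∑ i^k φ_k` with quasi-states `φ_k`. -/
def phaseHull : Set (WeakDual ℂ A) := phaseSum A '' Set.univ.pi fun _ => quasiStates A

theorem isCompact_phaseHull : IsCompact (phaseHull A) :=
  (isCompact_univ_pi fun _ => isCompact_quasiStates).image (phaseSum A).continuous

theorem convex_phaseHull : Convex ℝ (phaseHull A) := by
  rintro _ ⟨φ, hφ, rfl⟩ _ ⟨ψ, hψ, rfl⟩ s t hs ht hst
  refine ⟨s • φ + t • ψ, fun k hk => convex_quasiStates (hφ k hk) (hψ k hk) hs ht hst, ?_⟩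
  refine DFunLike.ext _ _ fun a => ?_
  have h : (s • phaseSum A φ + t • phaseSum A ψ) a
      = (s : ℂ) * phaseSum A φ a + (t : ℂ) * phaseSum A ψ a := rfl
  have h' : ∀ k, (s • φ + t • ψ) k a = (s : ℂ) * φ k a + (t : ℂ) * ψ k a := fun k => rfl
  rw [h, phaseSum_apply, phaseSum_apply, phaseSum_apply]
  simp only [h', Fin.sum_univ_four]
  ring

end QuasiStates

/-! ### Vector functionals norm `C*(S)` -/

section VectorFunctionals

variable {S : Type u} [Monoid S] [StarMul S] [TopologicalSpace S]
  [T2Space S] [ContinuousMul S] [MeasurableSpace S] [BorelSpace S]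

theorem semigroupCStar_star_mul_apply (a b : SemigroupCStar S) (π : StarRep S) (ξ : π.H) :
    ((star a * b).1 : RepProduct S) π ξ
      = ContinuousLinearMap.adjoint ((a.1 : RepProduct S) π) ((b.1 : RepProduct S) π ξ) := rfl

theorem coeffDual_mem_quasiStates (π : StarRep S) (ξ : π.H) (hξ : ‖ξ‖ ≤ 1) :
    StrongDual.toWeakDual (coeffDual π ξ ξ) ∈ quasiStates (SemigroupCStar S) := by
  rw [mem_quasiStates]
  intro a
  change 0 ≤ coeffDual π ξ ξ (star a * a) ∧ coeffDual π ξ ξ (star a) = conj (coeffDual π ξ ξ a) ∧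
    ‖coeffDual π ξ ξ a‖ ^ 2 ≤ (coeffDual π ξ ξ (star a * a)).re ∧ ‖coeffDual π ξ ξ a‖ ≤ ‖a‖
  set η := (a.1 : RepProduct S) π ξ with hη
  have h1 : coeffDual π ξ ξ (star a * a) = ⟪η, η⟫_ℂ := by
    rw [coeffDual_apply, semigroupCStar_star_mul_apply, ContinuousLinearMap.adjoint_inner_right]
  have h2 : ‖coeffDual π ξ ξ a‖ ≤ ‖η‖ := by
    rw [coeffDual_apply]
    refine (norm_inner_le_norm _ _).trans ?_
    exact mul_le_of_le_one_left (norm_nonneg _) hξ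
  have h3 : ‖η‖ ≤ ‖a‖ := by
    have h4 : ‖η‖ ≤ ‖a‖ * ‖ξ‖ :=
      ((a.1 : RepProduct S) π).le_of_opNorm_le (lp.norm_apply_le_norm ENNReal.top_ne_zero a.1 π) ξ
    exact h4.trans (mul_le_of_le_one_right (norm_nonneg _) hξ)
  refine ⟨?_, ?_, ?_, h2.trans h3⟩
  · rw [h1, inner_self_eq_norm_sq_to_K]; positivity
  · rw [coeffDual_apply, coeffDual_apply, inner_conj_symm]
    exact ContinuousLinearMap.adjoint_inner_right _ _ _
  · rw [h1, inner_self_eq_norm_sq_to_K]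
    have h5 : ((((‖η‖ : ℝ) : ℂ)) ^ 2).re = ‖η‖ ^ 2 := by
      rw [← Complex.ofReal_pow, Complex.ofReal_re]
    exact (pow_le_pow_left₀ (norm_nonneg _) h2 2).trans_eq h5.symm

theorem coeffDual_mem_phaseHull (π : StarRep S) (η ξ : π.H) (hη : ‖η‖ ≤ 1) (hξ : ‖ξ‖ ≤ 1) :
    StrongDual.toWeakDual (coeffDual π η ξ) ∈ phaseHull (SemigroupCStar S) := by
  -- Polarisation: the sum of `i^k ⟪ξ + i^k η, T (ξ + i^k η)⟫` is `4 ⟪η, T ξ⟫`. The factor `1/2`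
  -- absorbs the 4 and keeps the vectors in the unit ball.
  let ζ : Fin 4 → π.H := fun k => (1 / 2 : ℂ) • (ξ + Complex.I ^ (k : ℕ) • η)
  have hζ : ∀ k, ‖ζ k‖ ≤ 1 := fun k => by
    have h1 : ‖ξ + Complex.I ^ (k : ℕ) • η‖ ≤ 1 + 1 := by
      refine (norm_add_le _ _).trans (add_le_add hξ ?_)
      rw [norm_smul, norm_pow, Complex.norm_I, one_pow, one_mul]
      exact hη
    rw [norm_smul]
    norm_num at h1 ⊢
    linarith
  refine ⟨fun k => StrongDual.toWeakDual (coeffDual π (ζ k) (ζ k)),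
    fun k _ => coeffDual_mem_quasiStates π _ (hζ k), ?_⟩
  refine DFunLike.ext _ _ fun a => ?_
  rw [phaseSum_apply]
  change ∑ k : Fin 4, Complex.I ^ (k : ℕ) * coeffDual π (ζ k) (ζ k) a = coeffDual π η ξ a
  simp only [coeffDual_apply, ζ, map_smul, map_add, inner_smul_left, inner_smul_right,
    inner_add_left, inner_add_right, Fin.sum_univ_four]
  have h3 : ((3 : Fin 4) : ℕ) = 3 := rfl
  have hI : Complex.I ^ 2 = -1 := Complex.I_sq
  have hI3 : Complex.I ^ 3 = -Complex.I := by rw [pow_succ, hI]; ring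
  simp only [Fin.val_zero, Fin.val_one, Fin.val_two, h3, pow_zero, pow_one,
    hI, hI3, map_neg, map_one, Complex.conj_I, map_div₀, map_ofNat]
  ring_nf
  simp only [hI]
  ring

/-- Functionals of norm at most one are combinations of four quasi-states. -/
theorem mem_phaseHull_of_norm_le_one {f : StrongDual ℂ (SemigroupCStar S)} (hf : ‖f‖ ≤ 1) :
    StrongDual.toWeakDual f ∈ phaseHull (SemigroupCStar S) := by
  refine mem_of_forall_re_le isCompact_phaseHull convex_phaseHull fun a r hr => ?_
  have hcoeff : ∀ (π : StarRep S) (η ξ : π.H), ‖η‖ ≤ 1 → ‖ξ‖ ≤ 1 →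
      (⟪η, (a.1 : RepProduct S) π ξ⟫_ℂ).re ≤ r :=
    fun π η ξ hη hξ => hr _ (coeffDual_mem_phaseHull π η ξ hη hξ)
  have hr0 : 0 ≤ r := by
    have h0 : (0 : WeakDual ℂ (SemigroupCStar S)) ∈ phaseHull (SemigroupCStar S) := by
      refine ⟨0, fun k _ => mem_quasiStates.2 fun b => ?_, map_zero _⟩
      change 0 ≤ (0 : ℂ) ∧ (0 : ℂ) = conj 0 ∧ ‖(0 : ℂ)‖ ^ 2 ≤ (0 : ℂ).re ∧ ‖(0 : ℂ)‖ ≤ ‖b‖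
      simp
    exact hr 0 h0
  have hnorm : ‖a‖ ≤ r := by
    refine lp.norm_le_of_forall_le (f := (a.1 : RepProduct S)) hr0 fun π => ?_
    refine ContinuousLinearMap.opNorm_le_of_unit_norm hr0 fun ξ hξ => ?_
    set ζ := (a.1 : RepProduct S) π ξ with hζ
    rcases eq_or_ne ζ 0 with h0 | h0
    · rw [h0, norm_zero]; exact hr0
    have hpos : 0 < ‖ζ‖ := norm_pos_iff.2 h0
    -- Pairing `ζ = a_π ξ` with the unit vector in its own direction recovers its norm, so the
    -- support function of the hull at `a` is at least `‖a‖`.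
    have h1 := hcoeff π (((‖ζ‖⁻¹ : ℝ) : ℂ) • ζ) ξ (by
      rw [norm_smul, Complex.norm_real, norm_inv, norm_norm, inv_mul_cancel₀ hpos.ne']) hξ.le
    rw [← hζ, inner_smul_left, Complex.conj_ofReal, Complex.re_ofReal_mul] at h1
    have h2 : (⟪ζ, ζ⟫_ℂ).re = ‖ζ‖ * ‖ζ‖ := by
      rw [← pow_two]
      exact inner_self_eq_norm_sq (𝕜 := ℂ) ζ
    rwa [h2, inv_mul_cancel_left₀ hpos.ne'] at h1
  calc (f a).re ≤ ‖f a‖ := Complex.re_le_norm _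
    _ ≤ ‖f‖ * ‖a‖ := f.le_opNorm a
    _ ≤ 1 * ‖a‖ := by gcongr
    _ ≤ r := by rw [one_mul]; exact hnorm

end VectorFunctionals

/-! ### Positive functionals on `C*(S)` and positive definite functions -/

section Translations

variable {S : Type u} [Monoid S] [StarMul S] [TopologicalSpace S]
  [T2Space S] [ContinuousMul S] [MeasurableSpace S] [BorelSpace S] [ContinuousStar S]
  [LocallyCompactSpace S]

variable (S) in
/-- The canonical map `L(S) → C*(S)`, as a bounded operator. -/
def toCStarCLM : ↥(semigroupSubmodule S) →L[ℂ] SemigroupCStar S :=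
  LinearMap.mkContinuous
    { toFun := fun μ => toCStar ⟨μ.1, μ.2⟩
      map_add' := fun μ ν => Subtype.ext (map_add (sigmaCLM S) μ.1 ν.1)
      map_smul' := fun c μ => Subtype.ext (map_smul (sigmaCLM S) c μ.1) } 1
    (fun μ => by
      rw [one_mul]
      exact lp.norm_le_of_forall_le (f := sigmaRep μ.1) (norm_nonneg μ) fun π =>
        π.norm_intOp_le μ.1)

theorem denseRange_toCStarCLM : DenseRange (toCStarCLM S) := by
  intro a
  refine closure_mono ?_ (denseRange_toCStar a)
  rintro _ ⟨μ, rfl⟩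
  exact ⟨⟨μ.1, μ.2⟩, rfl⟩

/-- The weak continuity built into `L(S)` is tested by functionals on `M(S)`; Hahn–Banach makes
those of `C*(S)` available for this. -/
theorem exists_functional_extension (ψ : StrongDual ℂ (SemigroupCStar S)) :
    ∃ F : StrongDual ℂ (RegMeasure S), ∀ μ : ↥(semigroupSubmodule S),
      F μ = ψ (toCStarCLM S μ) := by
  obtain ⟨F, hF, -⟩ := exists_extension_norm_eq (semigroupSubmodule S) (ψ.comp (toCStarCLM S))
  exact ⟨F, hF⟩

/-- `U_x` sends the image of `μ` to that of `δ_x * μ`, which lies again in the image of `L(S)`;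
continuity of multiplication passes to the closure. -/
theorem translation_mul_mem_cstarSubalgebra (x : S) {a : RepProduct S}
    (ha : a ∈ cstarSubalgebra S) : translation x * a ∈ cstarSubalgebra S := by
  have hcl : IsClosed (cstarSubalgebra S : Set (RepProduct S)) :=
    NonUnitalStarSubalgebra.isClosed_topologicalClosure _
  have hmaps : Set.MapsTo (fun b : RepProduct S => translation x * b)
      (sigmaImage S : Set (RepProduct S)) (cstarSubalgebra S : Set (RepProduct S)) := by
    rintro _ ⟨μ, hμ, rfl⟩
    change translation x * sigmaRep μ ∈ cstarSubalgebra S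
    rw [translation_mul_sigmaRep]
    exact (toCStar ⟨_, pushforward_leftMul_mem hμ x⟩).2
  have hcont : Continuous fun b : RepProduct S => translation x * b := continuous_const_mul _
  have h := hmaps.closure hcont (cstarSubalgebra_subset_closure ha)
  rwa [hcl.closure_eq] at h

/-- The operator `a ↦ U_x a` on `C*(S)`, where `U_x = (π(x))_π`. -/
def leftTranslate (x : S) : SemigroupCStar S →ₗ[ℂ] SemigroupCStar S where
  toFun a := ⟨translation x * a.1, translation_mul_mem_cstarSubalgebra x a.2⟩
  map_add' a b := Subtype.ext (mul_add (translation x) a.1 b.1)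
  map_smul' c a := Subtype.ext (mul_smul_comm c (translation x) a.1)

theorem leftTranslate_mul (x y : S) (a : SemigroupCStar S) :
    leftTranslate (x * y) a = leftTranslate x (leftTranslate y a) := by
  refine Subtype.ext ?_
  change translation (x * y) * a.1 = translation x * (translation y * a.1)
  rw [translation_mul, mul_assoc]

theorem star_leftTranslate_mul (x : S) (a b : SemigroupCStar S) :
    star (leftTranslate x a) * b = star a * leftTranslate (star x) b := by
  refine Subtype.ext ?_
  change star (translation x * a.1) * b.1 = star a.1 * (translation (star x) * b.1)
  rw [star_mul, star_translation, mul_assoc]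

theorem norm_leftTranslate_le (x : S) (a : SemigroupCStar S) : ‖leftTranslate x a‖ ≤ ‖a‖ := by
  change ‖translation x * (a.1 : RepProduct S)‖ ≤ ‖(a.1 : RepProduct S)‖
  exact (norm_mul_le _ _).trans (mul_le_of_le_one_left (norm_nonneg _) (norm_translation_le x))

theorem leftTranslate_toCStar (x : S) {μ : RegMeasure S} (hμ : μ ∈ semigroupAlgebra S) :
    leftTranslate x (toCStar ⟨μ, hμ⟩)
      = toCStar ⟨pushforward (leftMul x) μ, pushforward_leftMul_mem hμ x⟩ :=
  Subtype.ext (translation_mul_sigmaRep x μ)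

theorem norm_functional_leftTranslate_le (ψ : StrongDual ℂ (SemigroupCStar S)) (x : S)
    (a : SemigroupCStar S) : ‖ψ (leftTranslate x a)‖ ≤ ‖ψ‖ * ‖a‖ :=
  (ψ.le_opNorm _).trans (by gcongr; exact norm_leftTranslate_le x a)

/-- Translations are weakly continuous on `C*(S)`. -/
theorem continuous_functional_leftTranslate (ψ : StrongDual ℂ (SemigroupCStar S))
    (a : SemigroupCStar S) : Continuous fun x => ψ (leftTranslate x a) := by
  obtain ⟨F, hF⟩ := exists_functional_extension ψ
  refine continuous_of_uniform_approx_of_continuous fun V hV => ?_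
  obtain ⟨ε, hε, hεV⟩ := Metric.mem_uniformity_dist.1 hV
  -- Approximating `a` by the image of a measure is uniform in `x`, since each `U_x` is a
  -- contraction.
  obtain ⟨μ, hμ⟩ := denseRange_toCStar.exists_dist_lt a (ε := ε / (‖ψ‖ + 1)) (by positivity)
  refine ⟨fun x => F (pushforward (leftMul x) μ), continuous_pushforward_leftMul μ.2 F,
    fun x => hεV ?_⟩
  have h1 : F (pushforward (leftMul x) (μ : RegMeasure S)) = ψ (leftTranslate x (toCStar μ)) := by
    rw [leftTranslate_toCStar x μ.2]
    exact hF ⟨_, pushforward_leftMul_mem μ.2 x⟩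
  beta_reduce
  rw [h1, dist_eq_norm, ← map_sub, ← map_sub]
  refine (norm_functional_leftTranslate_le ψ x _).trans_lt ?_
  rw [dist_eq_norm, lt_div_iff₀ (by positivity)] at hμ
  nlinarith [norm_nonneg (a - toCStar μ)]

/-- The functional `a ↦ ∫ ψ(U_x a) dμ(x)`. -/
def integralTranslate (ψ : StrongDual ℂ (SemigroupCStar S)) (μ : RegMeasure S) :
    StrongDual ℂ (SemigroupCStar S) :=
  LinearMap.mkContinuous
    { toFun := fun a => integral (fun x => ψ (leftTranslate x a)) μ
      map_add' := fun a b => by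
        simp only [map_add]
        exact integral_add (continuous_functional_leftTranslate ψ a).measurable
          (continuous_functional_leftTranslate ψ b).measurable
          ⟨_, fun x => norm_functional_leftTranslate_le ψ x a⟩
          ⟨_, fun x => norm_functional_leftTranslate_le ψ x b⟩ μ
      map_smul' := fun c a => by
        simp only [map_smul, smul_eq_mul]
        exact integral_const_mul c _ μ } (‖ψ‖ * ‖μ‖)
    (fun a => (norm_integral_le (fun x => norm_functional_leftTranslate_le ψ x a) μ).trans_eq
      (by ring))

theorem integralTranslate_apply (ψ : StrongDual ℂ (SemigroupCStar S)) (μ : RegMeasure S)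
    (a : SemigroupCStar S) :
    integralTranslate ψ μ a = integral (fun x => ψ (leftTranslate x a)) μ := rfl

/-- The product is the image of the convolution of `p` and `q`, and `functional_conv` takes the
extension of `ψ` to `M(S)` inside that convolution. -/
theorem integral_functional_leftTranslate_ofMeasure (ψ : StrongDual ℂ (SemigroupCStar S))
    {p q : Measure S} [IsFiniteMeasure p] [p.Regular] [IsFiniteMeasure q] [q.Regular]
    (hp : IsTranslationContinuous p) (hq : IsTranslationContinuous q) :
    integral (fun x => ψ (leftTranslate x (toCStar ⟨ofMeasure q, hq.ofMeasure_mem⟩)))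
        (ofMeasure p)
      = ψ (toCStar ⟨ofMeasure p, hp.ofMeasure_mem⟩ * toCStar ⟨ofMeasure q, hq.ofMeasure_mem⟩) := by
  obtain ⟨F, hF⟩ := exists_functional_extension ψ
  have := isFiniteMeasure_conv (p := p) hq
  have := regular_conv (p := p) hq
  have h1 : toCStar ⟨ofMeasure p, hp.ofMeasure_mem⟩ * toCStar ⟨ofMeasure q, hq.ofMeasure_mem⟩
      = toCStar ⟨ofMeasure (conv p q), (hp.conv hq).ofMeasure_mem⟩ :=
    Subtype.ext (sigmaRep_conv hq).symm
  have h2 : ψ (toCStar ⟨ofMeasure (conv p q), (hp.conv hq).ofMeasure_mem⟩)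
      = F (ofMeasure (conv p q)) :=
    (hF ⟨ofMeasure (conv p q), (hp.conv hq).ofMeasure_mem⟩).symm
  rw [h1, h2, functional_conv hq, integral_ofMeasure
    (continuous_functional_leftTranslate ψ _).measurable
    ⟨_, fun x => norm_functional_leftTranslate_le ψ x _⟩]
  refine integral_congr_ae (Filter.Eventually.of_forall fun x => ?_)
  change ψ (leftTranslate x (toCStar ⟨ofMeasure q, hq.ofMeasure_mem⟩))
    = F (ofMeasure (q.map (leftMul x)))
  rw [leftTranslate_toCStar, ← pushforward_ofMeasure]
  exact (hF ⟨_, pushforward_leftMul_mem hq.ofMeasure_mem x⟩).symm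

/-- The product in `C*(S)` is an integral of translates. -/
theorem integral_functional_leftTranslate (ψ : StrongDual ℂ (SemigroupCStar S))
    (μ : ↥(semigroupSubmodule S)) (a : SemigroupCStar S) :
    integral (fun x => ψ (leftTranslate x a)) (μ : RegMeasure S) = ψ (toCStarCLM S μ * a) := by
  have key : ∀ (p : Measure S) [IsFiniteMeasure p] [p.Regular] (hp : IsTranslationContinuous p)
      (b : SemigroupCStar S), integral (fun x => ψ (leftTranslate x b)) (ofMeasure p)
        = ψ (toCStarCLM S ⟨ofMeasure p, hp.ofMeasure_mem⟩ * b) := by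
    intro p _ _ hp b
    rw [← integralTranslate_apply]
    refine denseRange_toCStarCLM.induction_on (p := fun b => integralTranslate ψ (ofMeasure p) b
      = ψ (toCStarCLM S ⟨ofMeasure p, hp.ofMeasure_mem⟩ * b)) b
      (isClosed_eq (by fun_prop) (by fun_prop)) fun ν => ?_
    obtain ⟨q, _, _, hq, hν⟩ := exists_eq_sum_of_mem ν.2
    have hν' : ν = ∑ k : Fin 4, Complex.I ^ (k : ℕ) •
        (⟨ofMeasure (q k), (hq k).ofMeasure_mem⟩ : ↥(semigroupSubmodule S)) :=
      Subtype.ext (by rw [hν]; simp)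
    rw [hν', map_sum, map_sum, Finset.mul_sum, map_sum]
    refine Finset.sum_congr rfl fun k _ => ?_
    rw [map_smul, map_smul, mul_smul_comm, map_smul]
    congr 1
    exact integral_functional_leftTranslate_ofMeasure ψ hp (hq k)
  obtain ⟨p, _, _, hp, hμ⟩ := exists_eq_sum_of_mem μ.2
  have hμ' : μ = ∑ k : Fin 4, Complex.I ^ (k : ℕ) •
      (⟨ofMeasure (p k), (hp k).ofMeasure_mem⟩ : ↥(semigroupSubmodule S)) :=
    Subtype.ext (by rw [hμ]; simp)
  have h1 : integral (fun x => ψ (leftTranslate x a)) (μ : RegMeasure S)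
      = ∑ k : Fin 4, Complex.I ^ (k : ℕ) •
        integral (fun x => ψ (leftTranslate x a)) (ofMeasure (p k)) := by
    simp only [← integralCLM_apply _ (continuous_functional_leftTranslate ψ a).measurable _
      (fun x => norm_functional_leftTranslate_le ψ x a)]
    rw [hμ, map_sum]
    simp only [map_smul]
  rw [h1, hμ', map_sum, Finset.sum_mul, map_sum]
  refine Finset.sum_congr rfl fun k _ => ?_
  rw [map_smul, smul_mul_assoc, map_smul, key (p k) (hp k)]

end Translations

/-! ### Representation of dominated functionals by vectors -/

section Riesz

/-- A functional dominated by the seminorm of a map into a Hilbert space is given by a vector. -/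
theorem exists_vector_of_norm_le {V H : Type*} [AddCommGroup V] [Module ℂ V]
    [NormedAddCommGroup H] [InnerProductSpace ℂ H] [CompleteSpace H] (ι : V →ₗ[ℂ] H)
    (φ : V →ₗ[ℂ] ℂ) (h : ∀ v, ‖φ v‖ ≤ ‖ι v‖) : ∃ Ω : H, ∀ v, φ v = ⟪Ω, ι v⟫_ℂ := by
  -- `φ` kills the kernel of `ι`, so composing it with a linear section of `ι` gives a well-defined
  -- contraction on the range. It extends to `H` by Hahn–Banach and is given by a vector by Riesz.
  obtain ⟨s, hs⟩ := ι.rangeRestrict.exists_rightInverse_of_surjective ι.range_rangeRestrict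
  have hs' : ∀ w, ι (s w) = w := fun w => congrArg Subtype.val (LinearMap.congr_fun hs w)
  have hφ : ∀ v, φ (s (ι.rangeRestrict v)) = φ v := fun v => by
    rw [← sub_eq_zero, ← map_sub, ← norm_le_zero_iff]
    refine (h _).trans ?_
    rw [map_sub, hs', norm_le_zero_iff]
    exact sub_self _
  let g : StrongDual ℂ (LinearMap.range ι) := (φ ∘ₗ s).mkContinuous 1 fun w => by
    rw [one_mul]
    refine (h _).trans_eq ?_
    rw [hs']
    rfl
  obtain ⟨G, hG, -⟩ := exists_extension_norm_eq (LinearMap.range ι) g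
  refine ⟨(InnerProductSpace.toDual ℂ H).symm G, fun v => ?_⟩
  rw [InnerProductSpace.toDual_symm_apply, ← hφ v]
  exact (hG (ι.rangeRestrict v)).symm

end Riesz

/-! ### Every functional on `C*(S)` comes from `B(S)` -/

section Surjectivity

variable {S : Type u} [Monoid S] [StarMul S] [TopologicalSpace S]
  [T2Space S] [ContinuousMul S] [MeasurableSpace S] [BorelSpace S] [ContinuousStar S]
  [LocallyCompactSpace S]

/-- The semi-inner product `⟨a, b⟩ = φ(a*b)` of a quasi-state. -/
@[reducible] def quasiStateCore {A : Type*} [NonUnitalCStarAlgebra A] {φ : WeakDual ℂ A}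
    (hφ : φ ∈ quasiStates A) : PreInnerProductSpace.Core ℂ A where
  inner a b := φ (star a * b)
  conj_inner_symm a b := by
    rw [← (mem_quasiStates.1 hφ _).2.1, star_mul, star_star]
  re_inner_nonneg a := (Complex.le_def.1 (mem_quasiStates.1 hφ a).1).1
  add_left a b c := by rw [star_add, add_mul, map_add]
  smul_left a b c := by
    rw [star_smul, smul_mul_assoc, map_smul, smul_eq_mul]
    rfl

/-- Every quasi-state of `C*(S)` is given by a positive definite function. -/
theorem exists_posDef_of_mem_quasiStates {φ : WeakDual ℂ (SemigroupCStar S)}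
    (hφ : φ ∈ quasiStates (SemigroupCStar S)) :
    ∃ u ∈ posDefFunctions S, ∀ μ : semigroupAlgebra S,
      φ (toCStar μ) = integral u (μ : RegMeasure S) := by
  let ψ : StrongDual ℂ (SemigroupCStar S) := WeakDual.toStrongDual φ
  have hψ : ∀ a, ψ a = φ a := fun a => rfl
  -- This Hilbert space lives in the universe of `C*(S)`, one above that of `S`, so it yields no
  -- `StarRep S`. Only the positive definiteness of its coefficients is used.
  obtain ⟨H, _, _, _, ι, op, hdense, hι, hstar, hnorm, hcont, hop⟩ := exists_gns
    (quasiStateCore hφ) (leftTranslate (S := S)) leftTranslate_mul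
    (fun x v w => by
      change φ (star (leftTranslate x v) * w) = φ (star v * leftTranslate (star x) w)
      rw [star_leftTranslate_mul])
    (fun v => ⟨‖v‖ * ‖v‖, fun x => by
      change (φ (star (leftTranslate x v) * leftTranslate x v)).re ≤ _
      refine (Complex.re_le_norm _).trans (((mem_quasiStates.1 hφ _).2.2.2).trans ?_)
      refine (norm_mul_le _ _).trans ?_
      rw [norm_star]
      gcongr <;> exact norm_leftTranslate_le x v⟩)
    (fun v w => continuous_functional_leftTranslate
      (ψ.comp (ContinuousLinearMap.mul ℂ (SemigroupCStar S) (star v))) w)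
  have hι' : ∀ a b, ⟪ι a, ι b⟫_ℂ = φ (star a * b) := hι
  obtain ⟨Ω, hΩ⟩ := exists_vector_of_norm_le ι (ψ : SemigroupCStar S →ₗ[ℂ] ℂ) fun a => by
    have h1 : ‖ι a‖ ^ 2 = (φ (star a * a)).re := by
      rw [← hι']
      exact (inner_self_eq_norm_sq (𝕜 := ℂ) (ι a)).symm
    refine (sq_le_sq₀ (norm_nonneg _) (norm_nonneg _)).1 ?_
    rw [h1]
    exact (mem_quasiStates.1 hφ a).2.2.1
  have hΩ' : ∀ a, φ a = ⟪Ω, ι a⟫_ℂ := hΩ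
  have hbound : ∀ (ζ : H) x, ‖⟪Ω, op x ζ⟫_ℂ‖ ≤ ‖Ω‖ * ‖ζ‖ := fun ζ x => by
    refine (norm_inner_le_norm _ _).trans ?_
    gcongr
    simpa using (op x).le_of_opNorm_le (hnorm x) ζ
  refine ⟨_, coeff_mem_posDefFunctions op hstar hnorm hcont Ω, fun μ => ?_⟩
  let G : StrongDual ℂ H := LinearMap.mkContinuous
    { toFun := fun ζ => integral (fun x => ⟪Ω, op x ζ⟫_ℂ) (μ : RegMeasure S)
      map_add' := fun ζ ζ' => by
        simp only [map_add, inner_add_right]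
        exact integral_add (hcont ζ Ω).measurable (hcont ζ' Ω).measurable ⟨_, hbound ζ⟩
          ⟨_, hbound ζ'⟩ _
      map_smul' := fun c ζ => by
        simp only [map_smul, inner_smul_right]
        exact integral_const_mul c _ _ } (‖Ω‖ * ‖(μ : RegMeasure S)‖)
    (fun ζ => (norm_integral_le (hbound ζ) _).trans_eq (by ring))
  have hG : ∀ ζ, G ζ = integral (fun x => ⟪Ω, op x ζ⟫_ℂ) (μ : RegMeasure S) := fun ζ => rfl
  -- On the dense set of vectors `ι a` this reads `∫ φ(U_x a) dμ = φ(μ a) = ⟪ι (μ*), ι a⟫`. At `ζ =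
  -- Ω` it gives `∫ u dμ = conj (φ (μ*)) = φ μ`.
  have hkey : ∀ ζ, G ζ = ⟪ι (star (toCStar μ)), ζ⟫_ℂ := fun ζ => by
    refine hdense.induction_on (p := fun ζ => G ζ = ⟪ι (star (toCStar μ)), ζ⟫_ℂ) ζ
      (isClosed_eq (by fun_prop) (by fun_prop)) fun a => ?_
    rw [hG, hι', star_star]
    simp only [hop, ← hΩ', ← hψ]
    exact integral_functional_leftTranslate ψ ⟨μ.1, μ.2⟩ a
  rw [← hG, hkey, ← inner_conj_symm, ← hΩ', (mem_quasiStates.1 hφ _).2.1, Complex.conj_conj]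

/-- Every functional on `C*(S)` is given by an element of `B(S)`. -/
theorem exists_mem_fourierStieltjes (f : StrongDual ℂ (SemigroupCStar S)) :
    ∃ u ∈ fourierStieltjes S, ∀ μ : semigroupAlgebra S,
      f (toCStar μ) = integral u (μ : RegMeasure S) := by
  -- The `+ 1` keeps the scaling invertible when `f = 0`.
  set r : ℝ := ‖f‖ + 1 with hr
  have hr0 : 0 < r := by positivity
  have hle : ‖((r⁻¹ : ℝ) : ℂ) • f‖ ≤ 1 := by
    rw [norm_smul, Complex.norm_real, Real.norm_of_nonneg (inv_nonneg.2 hr0.le),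
      inv_mul_le_one₀ hr0]
    linarith
  obtain ⟨φ, hφ, hsum⟩ := mem_phaseHull_of_norm_le_one hle
  choose u hu hint using fun k => exists_posDef_of_mem_quasiStates (hφ k (Set.mem_univ k))
  have hmem : ∀ k, u k ∈ fourierStieltjes S := fun k => Submodule.subset_span (hu k)
  refine ⟨(r : ℂ) • ∑ k : Fin 4, Complex.I ^ (k : ℕ) • u k, Submodule.smul_mem _ _
    (Submodule.sum_mem _ fun k _ => Submodule.smul_mem _ _ (hmem k)), fun μ => ?_⟩
  have h1 : ((r⁻¹ : ℝ) : ℂ) * f (toCStar μ)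
      = ∑ k : Fin 4, Complex.I ^ (k : ℕ) * integral (u k) (μ : RegMeasure S) := by
    have h2 := phaseSum_apply φ (toCStar μ)
    rw [hsum] at h2
    simp only [hint] at h2
    exact h2
  have hsumint : ∀ T : Finset (Fin 4),
      integral (∑ k ∈ T, Complex.I ^ (k : ℕ) • u k) (μ : RegMeasure S)
        = ∑ k ∈ T, Complex.I ^ (k : ℕ) * integral (u k) (μ : RegMeasure S) := by
    intro T
    induction T using Finset.induction_on with
    | empty =>
      have h := norm_integral_le (f := (0 : S → ℂ)) (C := 0) (fun x => by simp) (μ : RegMeasure S)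
      rw [zero_mul, norm_le_zero_iff] at h
      simpa using h
    | insert k T hk ih =>
      obtain ⟨c1, b1⟩ := continuous_and_bounded_of_mem
        (Submodule.smul_mem _ (Complex.I ^ (k : ℕ)) (hmem k))
      obtain ⟨c2, b2⟩ := continuous_and_bounded_of_mem
        (Submodule.sum_mem _ fun k (_ : k ∈ T) =>
          Submodule.smul_mem _ (Complex.I ^ (k : ℕ)) (hmem k))
      rw [Finset.sum_insert hk, Finset.sum_insert hk,
        integral_add c1.measurable c2.measurable b1 b2, ih]
      congr 1
      exact integral_const_mul _ _ _
  have h3 : integral ((r : ℂ) • ∑ k : Fin 4, Complex.I ^ (k : ℕ) • u k) (μ : RegMeasure S)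
      = (r : ℂ) * integral (∑ k : Fin 4, Complex.I ^ (k : ℕ) • u k) (μ : RegMeasure S) :=
    integral_const_mul _ _ _
  rw [h3, hsumint, ← h1, ← mul_assoc, ← Complex.ofReal_mul, mul_inv_cancel₀ hr0.ne',
    Complex.ofReal_one, one_mul]

end Surjectivity

/-! ### The bijection between `B(S)` and the dual of `C*(S)` -/

section Duality

variable {S : Type u} [Monoid S] [StarMul S] [TopologicalSpace S]
  [T2Space S] [ContinuousMul S] [MeasurableSpace S] [BorelSpace S] [ContinuousStar S]
  [LocallyCompactSpace S]

variable (S) in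
/-- The functional on `C*(S)` given by an element of `B(S)`. -/
def toDual : fourierStieltjes S →ₗ[ℂ] StrongDual ℂ (SemigroupCStar S) where
  toFun u := (exists_dual_of_mem u.2).choose
  map_add' u v := by
    obtain ⟨hu, hCu⟩ := continuous_and_bounded_of_mem u.2
    obtain ⟨hv, hCv⟩ := continuous_and_bounded_of_mem v.2
    refine dual_ext fun μ => ?_
    rw [_root_.add_apply, (exists_dual_of_mem (u + v).2).choose_spec,
      (exists_dual_of_mem u.2).choose_spec, (exists_dual_of_mem v.2).choose_spec, ← integral_add hu.measurable hv.measurable hCu hCv]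
    rfl
  map_smul' c u := by
    refine dual_ext fun μ => ?_
    rw [_root_.smul_apply, (exists_dual_of_mem (c • u).2).choose_spec,
      (exists_dual_of_mem u.2).choose_spec]
    exact integral_const_mul _ _ _

theorem toDual_toCStar (u : fourierStieltjes S) (μ : semigroupAlgebra S) :
    toDual S u (toCStar μ) = integral (u : S → ℂ) (μ : RegMeasure S) :=
  (exists_dual_of_mem u.2).choose_spec μ

theorem toDual_bijective (hfound : IsFoundation S) : Function.Bijective (toDual S) := by
  constructor
  · refine (injective_iff_map_eq_zero _).2 fun u hu => Subtype.ext ?_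
    obtain ⟨hc, hC⟩ := continuous_and_bounded_of_mem u.2
    refine eq_zero_of_integral_eq_zero hfound hc hC fun μ hμ => ?_
    rw [← toDual_toCStar u ⟨μ, hμ⟩, hu]
    rfl
  · intro f
    obtain ⟨u, hu, h⟩ := exists_mem_fourierStieltjes f
    refine ⟨⟨u, hu⟩, dual_ext fun μ => ?_⟩
    rw [toDual_toCStar, h]

end Duality

end FoundationSemigroup

end

theorem theorem3p3 {S : Type u} [Monoid S] [StarMul S] [TopologicalSpace S] [T2Space S]
    [LocallyCompactSpace S] [ContinuousMul S] [ContinuousStar S] [MeasurableSpace S] [BorelSpace S]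
    (hfound : FoundationSemigroup.IsFoundation S)
    (hsep : FoundationSemigroup.RepsSeparatePoints S) :
    ∃ Φ : FoundationSemigroup.fourierStieltjes S ≃ₗ[ℂ]
        StrongDual ℂ (FoundationSemigroup.SemigroupCStar S),
      (∀ (u : FoundationSemigroup.fourierStieltjes S)
          (μ : FoundationSemigroup.semigroupAlgebra S),
        Φ u (FoundationSemigroup.toCStar μ)
          = FoundationSemigroup.integral (u : S → ℂ) (μ : FoundationSemigroup.RegMeasure S)) ∧
      ∀ u : FoundationSemigroup.fourierStieltjes S,
        BddAbove (FoundationSemigroup.pairingValues (u : S → ℂ)) ∧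
        ‖Φ u‖ = FoundationSemigroup.fsNorm (u : S → ℂ) := by
  refine ⟨LinearEquiv.ofBijective (FoundationSemigroup.toDual S)
    (FoundationSemigroup.toDual_bijective hfound), FoundationSemigroup.toDual_toCStar, fun u => ?_⟩
  exact FoundationSemigroup.norm_eq_fsNorm (FoundationSemigroup.toDual_toCStar u)
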